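/- Let $N\ge 2$ be an integer, $\kappa_N=(-1)^{N-1}$, and let $a<b$ be real numbers. Let $p(t;x)$ be the signed kernel with $\int_{\mathbb R}e^{iux}p(t;x)\,dx=e^{-tu^{2N}}$, and let $(X_t)_{t\ge0}$ be the pseudo-process with finite-dimensional signed densities $$\mathbb P_x\{X_{t_1}\in dx_1,\dots,X_{t_m}\in dx_m\}=\prod_{j=1}^m p(t_j-t_{j-1};x_{j-1}-x_j)\,dx_1\cdots dx_m\qquad(t_0=0,\ x_0=x).$$ Put $\tau_{ab,n}=2^{-n}\min\{m\ge 0: X_{m/2^n}\notin(a,b)\}$ and, for $x\in(a,b)$, $\lambda>0$ and a bounded smooth function $\varphi:\mathbb R\to\mathbb R$, define $$\mathbb E_x\big(e^{-\lambda\tau_{ab}}\varphi(X_{\tau_{ab}})\mathbf 1_{\{\tau_{ab}<\infty\}}\big):=\lim_{n\to\infty}\sum_{m\ge0}e^{-\lambda m/2^n}\,\mathbb E_x\big(\varphi(X_{m/2^n})\mathbf 1_{\{\tau_{ab,n}=m/2^n\}}\big).$$ Let $\theta_\ell=e^{i\frac{2\ell+N-1}{2N}\pi}$ for $1\le\ell\le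 2N$ (the $2N$-th roots of $\kappa_N$). For $\lambda>0$ let $\Delta(\lambda)$ be the determinant of the $2N\times2N$ matrix with rows $\big(\theta_\ell^{k}e^{\lambda^{1/(2N)}\theta_\ell a}\big)_{1\le\ell\le 2N}$, $0\le k\le N-1$, followed by the rows $\big(\theta_\ell^{k}e^{\lambda^{1/(2N)}\theta_\ell b}\big)_{1\le\ell\le 2N}$, $0\le k\le N-1$. Let $\Delta_k^-(\lambda;x)$ (resp. $\Delta_k^+(\lambda;x)$) be the determinant obtained by replacing the row of $\Delta(\lambda)$ with exponent $k$ at $a$ (resp. at $b$) by $\big(e^{\lambda^{1/(2N)}\theta_\ell x}\big)_{\ell}$. Let $\langle\delta_c^{(k)},\varphi\rangle=(-1)^k\varphi^{(k)}(c)$. **Theorem.** One has $\Delta(\lambda)\ne0$ for all $\lambda>0$, and there are real-valued functions $I_k^\pm(t;x)$, $0\le k\le N-1$, $t>0$, $x\in(a,b)$, with the following properties. (i) For $x\in(a,b)$, the joint pseudo-distribution of $(\tau_{ab},X_{\tau_{ab}})$ is $$\mathbb P_x\{\tau_{ab}\in dt,X_{\tau_{ab}}\in dz\}/dt\,dz=\sum_{k=0}^{N-1}(-1)^kI_k^-(t;x)\,\delta_a^{(k)}(z)+\sum_{k=0}^{N-1}(-1)^kI_k^+(t;x)\,\delta_b^{(k)}(z),$$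 that is: for all $\varphi$ and $\lambda$ as above, the expectations and series in the definition converge absolutely, the limit exists, and $$\mathbb E_x\big(e^{-\lambda\tau_{ab}}\varphi(X_{\tau_{ab}})\mathbf 1_{\{\tau_{ab}<\infty\}}\big)=\int_0^\infty e^{-\lambda t}\sum_{k=0}^{N-1}\big[I_k^-(t;x)\varphi^{(k)}(a)+I_k^+(t;x)\varphi^{(k)}(b)\big]dt,$$ with an absolutely convergent integral. (ii) For $x\in(a,b)$, $I_k^\pm(\cdot\,;x)$ is characterized (up to a null set of times) by its Laplace transform: $$\int_0^\infty I_k^\pm(t;x)e^{-\lambda t}\,dt=\lambda^{-\frac k{2N}}\frac{\Delta_k^\pm(\lambda;x)}{\Delta(\lambda)},\qquad\lambda>0.$$ (iii) $I_k^-$ is characterized, as a function on $(0,\infty)\times(a,b)$, by the boundary value problem $$\frac{\partial I_k^-}{\partial t}=\kappa_N\frac{\partial^{2N}I_k^-}{\partial x^{2N}},\qquad \frac{\partial^\ell I_k^-}{\partial x^\ell}(t;a)=\delta_{k\ell}\,\delta_0(t),\quad \frac{\partial^\ell I_k^-}{\partial x^\ell}(t;b)=0\qquad(0\le\ell\le N-1),$$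 together with $I_k^-(t;x)\to0$ as $t\to0^+$ for every $x\in(a,b)$, and boundedness of $\partial_x^\ell I_k^-$, $0\le\ell\le2N$, on $(0,\infty)\times[c,d]$ for every $[c,d]\subset(a,b)$. Here $\delta_{k\ell}$ is the Kronecker symbol, $\delta_0(t)$ is the Dirac mass at time $0$, and the boundary data are understood through Laplace transforms: for all $\lambda>0$, $$\int_0^\infty e^{-\lambda t}\,\partial_x^\ell I_k^-(t;x)\,dt\to\delta_{k\ell}\ \ (x\to a^+),\qquad \int_0^\infty e^{-\lambda t}\,\partial_x^\ell I_k^-(t;x)\,dt\to0\ \ (x\to b^-).$$ Likewise $I_k^+$ is characterized by the same problem with the boundary data at $a$ and $b$ interchanged: $\partial_x^\ell I_k^+(t;a)=0$, $\partial_x^\ell I_k^+(t;b)=\delta_{k\ell}\,\delta_0(t)$. -/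

import Mathlib

open MeasureTheory Filter Set Topology
open scoped ContDiff

noncomputable section

namespace PseudoBM

/-- The heat-type kernel of order `2N`, `p(t;x) = (1/2π) ∫ e^{-iux} e^{-t u^{2N}} du`: the function
whose Fourier transform `∫ e^{iux} p(t;x) dx` is `e^{-t u^{2N}}`. The imaginary part of the integral
vanishes by parity, which leaves the cosine. -/
def heatKernel (N : ℕ) (t x : ℝ) : ℝ :=
  (2 * Real.pi)⁻¹ * ∫ u : ℝ, Real.cos (u * x) * Real.exp (-t * u ^ (2 * N))

/-- The trajectory `(x₀, x₁, …, x_m)` with `x₀ = x`. -/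
def path {m : ℕ} (x : ℝ) (y : Fin m → ℝ) : Fin (m + 1) → ℝ := Fin.cons x y

/-- The density of the signed measure `ℙ_x{X_h ∈ dx₁, X_{2h} ∈ dx₂, …, X_{mh} ∈ dx_m}`, namely
`∏_{j=1}^m p(h; x_{j-1} - x_j)` with `x₀ = x`. -/
def chainDensity (N : ℕ) (h x : ℝ) {m : ℕ} (y : Fin m → ℝ) : ℝ :=
  ∏ j : Fin m, heatKernel N h (path x y j.castSucc - path x y j.succ)

/-- The trajectory leaves `(a,b)` for the first time at step `m` (its last step). -/
def ExitsAtLast (a b x : ℝ) {m : ℕ} (y : Fin m → ℝ) : Prop :=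
  (∀ j : Fin m, path x y j.castSucc ∈ Ioo a b) ∧ path x y (Fin.last m) ∉ Ioo a b

open Classical in
/-- The integrand of `𝔼_x[φ(X_{mh}) ; X sampled at 0, h, 2h, … first leaves (a,b) at time mh]`. -/
def exitIntegrand (N : ℕ) (a b h : ℝ) (φ : ℝ → ℝ) (x : ℝ) (m : ℕ) (y : Fin m → ℝ) : ℝ :=
  if ExitsAtLast a b x y then φ (path x y (Fin.last m)) * chainDensity N h x y else 0

/-- `𝔼_x[φ(X_{mh}) ; X sampled at 0, h, 2h, … first leaves (a,b) at time mh]`. -/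
def exitExpectation (N : ℕ) (a b h : ℝ) (φ : ℝ → ℝ) (x : ℝ) (m : ℕ) : ℝ :=
  ∫ y : Fin m → ℝ, exitIntegrand N a b h φ x m y

/-- The `m`-th term of the series defining
`Φ_n(x) = 𝔼_x[e^{-lam τ_n} φ(X_{τ_n}) ; τ_n < ∞]`, where `τ_n = 2⁻ⁿ min{m : X_{m/2ⁿ} ∉ (a,b)}`:
the contribution of the event `τ_n = m/2ⁿ`. -/
def feynmanKacTerm (N : ℕ) (a b lam : ℝ) (φ : ℝ → ℝ) (x : ℝ) (n m : ℕ) : ℝ :=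
  Real.exp (-lam * (m / 2 ^ n)) * exitExpectation N a b (1 / 2 ^ n) φ x m

/-- `Φ_n(x) = 𝔼_x[e^{-lam τ_n} φ(X_{τ_n}) ; τ_n < ∞]`. -/
def feynmanKacApprox (N : ℕ) (a b lam : ℝ) (φ : ℝ → ℝ) (x : ℝ) (n : ℕ) : ℝ :=
  ∑' m : ℕ, feynmanKacTerm N a b lam φ x n m

/-- `ℙ_x{τ_ab ∈ dt, X_{τ_ab} ∈ dz} / dt dz = μ t (z)` on `t > 0`, as Schwartz distributions in `z`.
The functional `Φ(x) = 𝔼_x[e^{-lam τ_ab} φ(X_{τ_ab}) ; τ_ab < ∞]` is by definition the limit of the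
`Φ_n(x)`; all expectations `Φ_n(x)` must make sense, the limit must exist, and it must equal
`∫_0^∞ e^{-lam t} ⟨μ t, φ⟩ dt`. The test functions are all bounded smooth functions. -/
def IsJointPseudoDensity (N : ℕ) (a b x : ℝ) (μ : ℝ → (ℝ → ℝ) → ℝ) : Prop :=
  ∀ φ : ℝ → ℝ, ContDiff ℝ ∞ φ → (∃ C : ℝ, ∀ z, |φ z| ≤ C) → ∀ lam : ℝ, 0 < lam →
    (∀ n m : ℕ, Integrable (exitIntegrand N a b (1 / 2 ^ n) φ x m)) ∧
    (∀ n : ℕ, Summable (feynmanKacTerm N a b lam φ x n)) ∧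
    IntegrableOn (fun t => Real.exp (-lam * t) * μ t φ) (Ioi 0) ∧
    Tendsto (feynmanKacApprox N a b lam φ x) atTop
      (𝓝 (∫ t in Ioi (0 : ℝ), Real.exp (-lam * t) * μ t φ))

/-- The distribution `δ_c^{(k)}`: `⟨δ_c^{(k)}, φ⟩ = (-1)^k φ^{(k)}(c)`. -/
def diracDeriv (c : ℝ) (k : ℕ) (φ : ℝ → ℝ) : ℝ := (-1) ^ k * iteratedDeriv k φ c

/-- `θ_ℓ = exp(i (2ℓ+N-1)π/(2N))`; for `1 ≤ ℓ ≤ 2N` these are the `2N`-th roots of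
`κ_N = (-1)^{N-1}`. -/
def theta (N ℓ : ℕ) : ℂ :=
  Complex.exp (Complex.I * (((2 * ℓ + N - 1) / (2 * N) : ℂ) * Real.pi))

/-- The roots `θ_1, …, θ_{2N}` in this order, indexed by two consecutive blocks of length `N`. -/
def root (N : ℕ) : Fin N ⊕ Fin N → ℂ :=
  Sum.elim (fun j => theta N (j + 1)) (fun j => theta N (N + j + 1))

/-- `e_lam^z = exp(lam^{1/(2N)} z)`. -/
def expo (N : ℕ) (lam : ℝ) (z : ℂ) : ℂ :=
  Complex.exp (((lam ^ (1 / (2 * N) : ℝ) : ℝ) : ℂ) * z)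

/-- The `2N × 2N` matrix with rows `(θ_j^k e_lam^{θ_j a})_j`, `0 ≤ k < N`, followed by the rows
`(θ_j^k e_lam^{θ_j b})_j`, `0 ≤ k < N`. -/
def bvpMatrix (N : ℕ) (a b lam : ℝ) : Matrix (Fin N ⊕ Fin N) (Fin N ⊕ Fin N) ℂ :=
  Matrix.of fun r j =>
    Sum.elim (fun k : Fin N => root N j ^ (k : ℕ) * expo N lam (root N j * a))
      (fun k : Fin N => root N j ^ (k : ℕ) * expo N lam (root N j * b)) r

/-- `Δ(lam)`. -/
def Delta (N : ℕ) (a b lam : ℝ) : ℂ := (bvpMatrix N a b lam).det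

/-- `Δ_k^-(lam; x)`: the row `(θ_j^k e_lam^{θ_j a})_j` is replaced by `(e_lam^{θ_j x})_j`. -/
def DeltaMinus (N : ℕ) (a b : ℝ) (k : Fin N) (lam x : ℝ) : ℂ :=
  ((bvpMatrix N a b lam).updateRow (Sum.inl k) fun j => expo N lam (root N j * x)).det

/-- `Δ_k^+(lam; x)`: the row `(θ_j^k e_lam^{θ_j b})_j` is replaced by `(e_lam^{θ_j x})_j`. -/
def DeltaPlus (N : ℕ) (a b : ℝ) (k : Fin N) (lam x : ℝ) : ℂ :=
  ((bvpMatrix N a b lam).updateRow (Sum.inr k) fun j => expo N lam (root N j * x)).det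

/-- `∫_0^∞ f(t) e^{-lam t} dt` converges absolutely and equals `F lam`, for every `lam > 0`. -/
def HasLaplaceTransform (f : ℝ → ℝ) (F : ℝ → ℂ) : Prop :=
  ∀ lam : ℝ, 0 < lam → IntegrableOn (fun t => Real.exp (-lam * t) * f t) (Ioi 0) ∧
    ((∫ t in Ioi (0 : ℝ), Real.exp (-lam * t) * f t : ℝ) : ℂ) = F lam

/-- `f` is characterized, up to a null set of times, by having the Laplace transform `F`. -/
def IsCharacterizedByLaplace (f : ℝ → ℝ) (F : ℝ → ℂ) : Prop :=
  HasLaplaceTransform f F ∧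
    ∀ g : ℝ → ℝ, HasLaplaceTransform g F → g =ᵐ[volume.restrict (Ioi 0)] f

/-- `u` solves `∂u/∂t = κ_N ∂^{2N}u/∂x^{2N}` on `(0,∞) × (a,b)`, is bounded together with its
`x`-derivatives up to order `2N` on `(0,∞) × [c,d]` whenever `[c,d] ⊆ (a,b)`, vanishes as `t → 0⁺`,
and has the lateral boundary data `∂^ℓu/∂x^ℓ(t;a) = A ℓ · δ₀(t)`, `∂^ℓu/∂x^ℓ(t;b) = B ℓ · δ₀(t)` for
`0 ≤ ℓ < N`. The data are multiples of the Dirac mass at time `0`, whose Laplace transform is `1`,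
and are attained in the sense of Laplace transforms in time. -/
structure IsHeatBVPSolution (N : ℕ) (a b : ℝ) (A B : ℕ → ℝ) (u : ℝ → ℝ → ℝ) : Prop where
  regular : ∀ t : ℝ, 0 < t → ContDiffOn ℝ (2 * N : ℕ) (u t) (Ioo a b)
  equation : ∀ t : ℝ, 0 < t → ∀ x ∈ Ioo a b,
    HasDerivAt (fun s => u s x) ((-1) ^ (N - 1) * iteratedDeriv (2 * N) (u t) x) t
  bounded : ∀ c d : ℝ, a < c → d < b → ∀ ℓ : ℕ, ℓ ≤ 2 * N →
    ∃ C : ℝ, ∀ t : ℝ, 0 < t → ∀ x ∈ Icc c d, |iteratedDeriv ℓ (u t) x| ≤ C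
  initial : ∀ x ∈ Ioo a b, Tendsto (fun t => u t x) (𝓝[>] 0) (𝓝 0)
  left : ∀ ℓ : ℕ, ℓ < N → ∀ lam : ℝ, 0 < lam →
    Tendsto (fun x => ∫ t in Ioi (0 : ℝ), Real.exp (-lam * t) * iteratedDeriv ℓ (u t) x)
      (𝓝[>] a) (𝓝 (A ℓ))
  right : ∀ ℓ : ℕ, ℓ < N → ∀ lam : ℝ, 0 < lam →
    Tendsto (fun x => ∫ t in Ioi (0 : ℝ), Real.exp (-lam * t) * iteratedDeriv ℓ (u t) x)
      (𝓝[<] b) (𝓝 (B ℓ))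

/-- `u` is characterized, on `(0,∞) × (a,b)`, by the boundary value problem with data `A`, `B`. -/
def IsCharacterizedByBVP (N : ℕ) (a b : ℝ) (A B : ℕ → ℝ) (u : ℝ → ℝ → ℝ) : Prop :=
  IsHeatBVPSolution N a b A B u ∧
    ∀ v : ℝ → ℝ → ℝ, IsHeatBVPSolution N a b A B v →
      ∀ t : ℝ, 0 < t → ∀ x ∈ Ioo a b, v t x = u t x

/-- The Kronecker symbol `δ_{kℓ}` as a function of `ℓ`. -/
def kron (k ℓ : ℕ) : ℝ := if k = ℓ then 1 else 0

end PseudoBM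

end

open MeasureTheory Filter Set Topology
open scoped ContDiff

noncomputable section

/-! A Laplace transform in time turns the boundary value problem into the two-point problem `f^(2N)
= κ_N λ f` with Dirichlet data of orders `0, …, N-1` at both ends. Since `(-1)^N κ_N = -1`,
integrating by parts `N` times gives `∫ |f^(N)|² = -λ ∫ |f|²` for zero data, so this problem is
uniquely solvable in the whole closed half-plane `Re λ ≥ 0` (`eq_zero_of_boundary_zero`,
`isUnit_boundaryMap`). Its solution `sol` is holomorphic in `λ`; for `λ > 0` Cramer's rule writes it
as the quotient of determinants (`det_ratio_eq_sol`).

For large `λ` the solution is a combination of exponentials that decay from one end or the other,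
with bounded coefficients. Inside the interval it is therefore of size `exp(-c |λ|^{1/(2N)})`
(`exists_sol_bound`). This is enough to invert the Laplace transform along the imaginary axis: the
inverse transforms are the functions `I_k^±`, Cauchy's theorem gives their zero initial values and
their Laplace transforms (`HalfPlaneDecay.cauchy`), and uniqueness follows from injectivity of the
Laplace transform together with uniqueness for the two-point problem.

The joint pseudo-distribution is a convergence theorem for a numerical scheme. The discounted exit
value `v` of the walk with step `h` satisfies `v = e^{-λh} T_h v` on `(a,b)` and `v = φ` outside,
where `T_h` is the Fourier multiplier `exp(-h (2πξ)^{2N})`. The kernel is signed, so there is no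
maximum principle; what replaces it is that `T_h` is a positive contraction of `L²`. Let `u` be the
solution of the two-point problem with the derivatives of `φ` as data, glued to `φ` outside. The
error `ψ = v - u` is supported in `(a,b)`, and testing its equation with `ψ` controls `‖ψ‖²` and the
defect `⟨(1 - T_h)ψ, ψ⟩ / h` by the residual of the glued function (`tendsto_energy`). Up to a
smooth function and a distant one, the glued function consists of two one-sided pieces with contact
of order `N` at the ends, hence with `N` derivatives in `L²`; translating them slightly away from
`(a,b)` makes their contribution `o(h)` up to an absorbable part of the defect
(`exists_abs_integral_heatOp_mul_le`). A Sobolev-type bound turns small energy into pointwise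
convergence (`tendsto_exitValue`). -/

namespace PseudoBM

set_option linter.unusedSectionVars false

/-! ### Operator exponentials depending on a parameter. -/

section Propagator

variable {E : Type*} [NormedAddCommGroup E] [NormedSpace ℂ E] [CompleteSpace E]

/-- The propagator `exp (x A)` of the equation `y' = A y`. -/
def propagator (A : E →L[ℂ] E) (x : ℝ) : E →L[ℂ] E := NormedSpace.exp ((x : ℂ) • A)

/-- The affine family of operators `S + c T`. -/
def pencil (S T : E →L[ℂ] E) (c : ℂ) : E →L[ℂ] E := S + c • T

theorem pencil_apply (S T : E →L[ℂ] E) (c : ℂ) (y : E) : pencil S T c y = S y + c • T y := rfl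

theorem propagator_zero (A : E →L[ℂ] E) : propagator A 0 = 1 := by
  simp [propagator, NormedSpace.exp_zero]

theorem commute_propagator (A : E →L[ℂ] E) (x : ℝ) : Commute A (propagator A x) :=
  ((Commute.refl A).smul_right (x : ℂ)).exp_right

theorem propagator_pow_apply (A : E →L[ℂ] E) (l : ℕ) (x : ℝ) (y : E) :
    propagator A x ((A ^ l) y) = (A ^ l) (propagator A x y) :=
  congrArg (fun T => T y) ((commute_propagator A x).pow_left l).eq.symm

theorem propagator_add (A : E →L[ℂ] E) (x y : ℝ) :
    propagator A (x + y) = propagator A x * propagator A y := by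
  unfold propagator
  let : NormedAlgebra ℚ (E →L[ℂ] E) := .restrictScalars ℚ ℂ _
  rw [← NormedSpace.exp_add_of_commute, ← add_smul]
  · push_cast; rfl
  · exact ((Commute.refl _).smul_left _).smul_right _

theorem propagator_add_apply (A : E →L[ℂ] E) (x y : ℝ) (v : E) :
    propagator A (x + y) v = propagator A x (propagator A y v) := by
  rw [propagator_add]; rfl

theorem propagator_zero_apply (A : E →L[ℂ] E) (v : E) : propagator A 0 v = v := by
  rw [propagator_zero]; rfl

theorem hasDerivAt_propagator (A : E →L[ℂ] E) (x : ℝ) :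
    HasDerivAt (propagator A) (propagator A x * A) x := by
  have h1 := hasDerivAt_exp_smul_const (𝕂 := ℂ) A (x : ℂ)
  have := h1.scomp x Complex.ofRealCLM.hasDerivAt
  rw [Complex.ofRealCLM_apply, Complex.ofReal_one, one_smul] at this
  exact this

theorem hasDerivAt_propagator_apply (A : E →L[ℂ] E) {s : ℝ → ℝ} {s' : ℝ} {g : ℝ → E} {g' : E}
    {x : ℝ} (hs : HasDerivAt s s' x) (hg : HasDerivAt g g' x) :
    HasDerivAt (fun z => propagator A (s z) (g z))
      (s' • propagator A (s x) (A (g x)) + propagator A (s x) g') x := by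
  have h1 := (hasDerivAt_propagator A (s x)).scomp x hs
  have h2 := (ContinuousLinearMap.restrictScalarsL ℂ E E ℝ ℝ).hasFDerivAt.comp_hasDerivAt x h1
  exact h2.clm_apply hg

theorem continuous_pencil (S T : E →L[ℂ] E) : Continuous (pencil S T) := by
  unfold pencil; fun_prop

theorem differentiable_pencil (S T : E →L[ℂ] E) : Differentiable ℂ (pencil S T) := by
  unfold pencil; fun_prop

theorem continuous_propagator_pencil (S T : E →L[ℂ] E) :
    Continuous fun p : ℂ × ℝ => propagator (pencil S T p.1) p.2 := by
  unfold propagator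
  let : NormedAlgebra ℚ (E →L[ℂ] E) := .restrictScalars ℚ ℂ _
  refine NormedSpace.exp_continuous.comp ?_
  have := (continuous_pencil S T).comp (continuous_fst (X := ℂ) (Y := ℝ))
  exact (Complex.continuous_ofReal.comp continuous_snd).smul this

theorem differentiable_propagator_pencil (S T : E →L[ℂ] E) (x : ℝ) :
    Differentiable ℂ fun c : ℂ => propagator (pencil S T c) x := by
  intro c
  unfold propagator
  have h1 : DifferentiableAt ℂ (fun c : ℂ => (x : ℂ) • pencil S T c) c :=
    DifferentiableAt.fun_const_smul (differentiable_pencil S T c) _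
  exact (NormedSpace.exp_analytic (𝕂 := ℂ) _).differentiableAt.comp c h1

/-- The map from initial data to two-point data. -/
def pencilBoundary (S T P Q : E →L[ℂ] E) (x : ℝ) (c : ℂ) : E →L[ℂ] E :=
  P + Q * propagator (pencil S T c) x

theorem differentiable_pencilBoundary (S T P Q : E →L[ℂ] E) (x : ℝ) :
    Differentiable ℂ (pencilBoundary S T P Q x) := by
  unfold pencilBoundary
  exact ((differentiable_propagator_pencil S T x).const_mul Q).const_add P

/-- The generator is affine in `c`, so everything except the inverse is entire, and the inverse is
holomorphic wherever the boundary operator is a unit. This is the source of holomorphy in the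
Laplace variable. -/
theorem differentiableAt_pencilSolution (S T P Q : E →L[ℂ] E) (φ : E →L[ℂ] ℂ) (d : E) (l : ℕ)
    (β x : ℝ) (c : ℂ) (hu : IsUnit (pencilBoundary S T P Q β c)) :
    DifferentiableAt ℂ (fun c => φ (propagator (pencil S T c) x
      ((pencil S T c ^ l) (Ring.inverse (pencilBoundary S T P Q β c) d)))) c := by
  have h1 : DifferentiableAt ℂ (fun c => Ring.inverse (pencilBoundary S T P Q β c)) c :=
    (differentiableAt_inverse (𝕜 := ℂ) hu).comp c (differentiable_pencilBoundary S T P Q β c)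
  have h2 : DifferentiableAt ℂ (fun c => pencil S T c ^ l) c :=
    (differentiable_pencil S T c).pow l
  have h3 := differentiable_propagator_pencil S T x c
  have h4 : DifferentiableAt ℂ (fun c => propagator (pencil S T c) x *
      (pencil S T c ^ l * Ring.inverse (pencilBoundary S T P Q β c))) c := h3.mul (h2.mul h1)
  exact φ.differentiableAt.comp c (h4.clm_apply (differentiableAt_const d))

/-- Joint continuity in parameter and position serves a compactness argument that bounds the
solutions for bounded parameters. -/
theorem continuousAt_pencilSolution (S T P Q : E →L[ℂ] E) (φ : E →L[ℂ] ℂ) (d : E) (l : ℕ)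
    (β : ℝ) (p : ℂ × ℝ) (hu : IsUnit (pencilBoundary S T P Q β p.1)) :
    ContinuousAt (fun p : ℂ × ℝ => φ (propagator (pencil S T p.1) p.2
      ((pencil S T p.1 ^ l) (Ring.inverse (pencilBoundary S T P Q β p.1) d)))) p := by
  obtain ⟨u, hu⟩ := hu
  have h1 : ContinuousAt (fun p : ℂ × ℝ => Ring.inverse (pencilBoundary S T P Q β p.1)) p := by
    have := NormedRing.inverse_continuousAt u
    rw [hu] at this
    exact ContinuousAt.comp (f := fun p : ℂ × ℝ => pencilBoundary S T P Q β p.1) this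
      ((differentiable_pencilBoundary S T P Q β).continuous.comp continuous_fst).continuousAt
  have h2 : ContinuousAt (fun p : ℂ × ℝ => pencil S T p.1 ^ l) p :=
    (((continuous_pencil S T).comp continuous_fst).pow l).continuousAt
  have h3 := (continuous_propagator_pencil S T).continuousAt (x := p)
  have h4 : ContinuousAt (fun p : ℂ × ℝ => propagator (pencil S T p.1) p.2 *
      (pencil S T p.1 ^ l * Ring.inverse (pencilBoundary S T P Q β p.1))) p := h3.mul (h2.mul h1)
  exact φ.continuous.continuousAt.comp (h4.clm_apply continuousAt_const)

end Propagator

/-! ### The equation `f^(n) = c f` as a first-order system. -/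

section Companion

variable {n : ℕ} [NeZero n]

/-- The shift part of the companion matrix. -/
def shiftMap (n : ℕ) [NeZero n] : (Fin n → ℂ) →L[ℂ] (Fin n → ℂ) :=
  LinearMap.toContinuousLinearMap
    { toFun := fun y j => if h : (j : ℕ) + 1 < n then y ⟨j + 1, h⟩ else 0
      map_add' := by intro x y; ext j; by_cases h : (j : ℕ) + 1 < n <;> simp [h]
      map_smul' := by intro c y; ext j; by_cases h : (j : ℕ) + 1 < n <;> simp [h] }

/-- The last row of the companion matrix. -/
def wrapMap (n : ℕ) [NeZero n] : (Fin n → ℂ) →L[ℂ] (Fin n → ℂ) :=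
  LinearMap.toContinuousLinearMap
    { toFun := fun y j => if (j : ℕ) + 1 < n then 0 else y 0
      map_add' := by intro x y; ext j; by_cases h : (j : ℕ) + 1 < n <;> simp [h]
      map_smul' := by intro c y; ext j; by_cases h : (j : ℕ) + 1 < n <;> simp [h] }

/-- The companion operator of the equation `f^{(n)} = c f`. -/
def companion (n : ℕ) [NeZero n] (c : ℂ) : (Fin n → ℂ) →L[ℂ] (Fin n → ℂ) :=
  pencil (shiftMap n) (wrapMap n) c

theorem companion_apply (c : ℂ) (y : Fin n → ℂ) (j : Fin n) :
    companion n c y j = if h : (j : ℕ) + 1 < n then y ⟨j + 1, h⟩ else c * y 0 := by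
  rw [companion, pencil_apply]
  by_cases h : (j : ℕ) + 1 < n <;> simp [shiftMap, wrapMap, h]

theorem companion_pow_succ_apply (c : ℂ) (l : ℕ) (y : Fin n → ℂ) :
    (companion n c ^ (l + 1)) y = companion n c ((companion n c ^ l) y) := by
  rw [pow_succ']; rfl

theorem companion_pow_succ_apply' (c : ℂ) (l : ℕ) (y : Fin n → ℂ) :
    (companion n c ^ (l + 1)) y = (companion n c ^ l) (companion n c y) := by
  rw [pow_succ]; rfl

theorem companion_pow_apply (c : ℂ) (y : Fin n → ℂ) (l : ℕ) (j : Fin n) (h : (j : ℕ) + l < n) :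
    (companion n c ^ l) y j = y ⟨j + l, h⟩ := by
  induction l generalizing j with
  | zero => simp
  | succ l ih =>
    rw [companion_pow_succ_apply, companion_apply, dif_pos (by omega), ih]
    · congr 2; simp; omega
    · simp; omega

theorem companion_pow_zero_apply (c : ℂ) (y : Fin n → ℂ) (l : ℕ) (h : l < n) :
    (companion n c ^ l) y 0 = y ⟨l, h⟩ := by
  rw [companion_pow_apply c y l 0 (by simpa using h)]; congr 2; simp

/-- The first application puts `c * y 0` into the last coordinate, and the remaining `n - 1` shift
it to coordinate `0`. -/
theorem companion_pow_self (c : ℂ) (y : Fin n → ℂ) : (companion n c ^ n) y 0 = c * y 0 := by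
  obtain ⟨m, hm⟩ : ∃ m, n = m + 1 := ⟨n - 1, by have := NeZero.pos n; omega⟩
  have h1 : (companion n c ^ n) y = (companion n c ^ m) (companion n c y) := by
    rw [← companion_pow_succ_apply', ← hm]
  rw [h1, companion_pow_zero_apply c _ m (by omega), companion_apply, dif_neg (by simp; omega)]

/-- The `l`-th derivative of the solution of `f^{(n)} = c f` with data `y` at `0`. -/
def orbit (n : ℕ) [NeZero n] (c : ℂ) (y : Fin n → ℂ) (l : ℕ) (x : ℝ) : ℂ :=
  propagator (companion n c) x ((companion n c ^ l) y) 0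

theorem hasDerivAt_orbit (c : ℂ) (y : Fin n → ℂ) (l : ℕ) (x : ℝ) :
    HasDerivAt (orbit n c y l) (orbit n c y (l + 1) x) x := by
  have h1 := hasDerivAt_propagator_apply (companion n c) (hasDerivAt_id x)
    (hasDerivAt_const x ((companion n c ^ l) y))
  have h2 := (hasDerivAt_pi.1 h1) 0
  convert! h2 using 1
  rw [orbit, companion_pow_succ_apply]
  simp

theorem orbit_add_self (c : ℂ) (y : Fin n → ℂ) (l : ℕ) (x : ℝ) :
    orbit n c y (l + n) x = c * orbit n c y l x := by
  have h : (companion n c ^ (l + n)) y = (companion n c ^ n) ((companion n c ^ l) y) := by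
    rw [add_comm l n, pow_add]; rfl
  rw [orbit, h, propagator_pow_apply, companion_pow_self]; rfl

theorem orbit_of_lt (c : ℂ) (y : Fin n → ℂ) (l : ℕ) (h : l < n) (x : ℝ) :
    orbit n c y l x = propagator (companion n c) x y ⟨l, h⟩ := by
  rw [orbit, propagator_pow_apply, companion_pow_zero_apply c _ l h]

theorem orbit_zero_right (c : ℂ) (y : Fin n → ℂ) (l : ℕ) (h : l < n) :
    orbit n c y l 0 = y ⟨l, h⟩ := by
  rw [orbit_of_lt c y l h, propagator_zero_apply]

/-- Every solution of `f^{(n)} = c f` on an open interval is an orbit. -/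
theorem exists_orbit_of_hasDerivAt {a b : ℝ} (hab : a < b) (c : ℂ) (g : ℕ → ℝ → ℂ)
    (hg : ∀ l < n, ∀ x ∈ Ioo a b, HasDerivAt (g l) (g (l + 1) x) x)
    (hn : ∀ x ∈ Ioo a b, g n x = c * g 0 x) :
    ∃ y : Fin n → ℂ, ∀ l < n, ∀ x ∈ Ioo a b, g l x = orbit n c y l (x - a) := by
  set G : ℝ → Fin n → ℂ := fun x j => g j x with hG
  have hGd : ∀ x ∈ Ioo a b, HasDerivAt G (companion n c (G x)) x := by
    intro x hx
    rw [hasDerivAt_pi]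
    intro j
    rw [companion_apply]
    split_ifs with h
    · exact hg j j.2 x hx
    · have hj : (j : ℕ) + 1 = n := by have := j.2; omega
      have := hg j j.2 x hx
      rw [hj, hn x hx] at this
      simpa [hG] using this
  obtain ⟨x₀, hx₀⟩ : ∃ x₀, x₀ ∈ Ioo a b := nonempty_Ioo.2 hab
  -- Pulling the state back along the flow gives a vector with zero derivative. Its constant value
  -- is the Cauchy data at `a`, although nothing is assumed about `g` at `a` itself.
  set H : ℝ → Fin n → ℂ := fun x => propagator (companion n c) (-(x - a)) (G x) with hH
  have hHd : ∀ x ∈ Ioo a b, HasDerivAt H 0 x := by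
    intro x hx
    have h2 := hasDerivAt_propagator_apply (companion n c)
      (((hasDerivAt_id x).sub_const a).neg) (hGd x hx)
    convert! h2 using 1
    simp
  have hconst : ∀ x ∈ Ioo a b, H x = H x₀ := by
    intro x hx
    refine isOpen_Ioo.is_const_of_deriv_eq_zero (𝕜 := ℝ) isPreconnected_Ioo ?_ ?_ hx hx₀
    · intro z hz; exact (hHd z hz).differentiableAt.differentiableWithinAt
    · intro z hz; exact (hHd z hz).deriv
  refine ⟨H x₀, fun l hl x hx => ?_⟩
  rw [orbit_of_lt c _ l hl, ← hconst x hx, hH]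
  simp only []
  rw [← propagator_add_apply, add_neg_cancel, propagator_zero_apply]

end Companion

/-! ### The sign `κ_N` and the energy identity. -/

/-- The sign `κ_N = (-1)^{N-1}`. -/
def kappa (N : ℕ) : ℂ := (-1) ^ (N - 1)

theorem kappa_mul_self (N : ℕ) : kappa N * kappa N = 1 := by
  rw [kappa, ← mul_pow]; norm_num

/-- This sign makes the energy identity coercive in the half-plane `Re λ ≥ 0`. -/
theorem neg_one_pow_mul_kappa (N : ℕ) (hN : 0 < N) : (-1) ^ N * kappa N = -1 := by
  obtain ⟨m, rfl⟩ : ∃ m, N = m + 1 := ⟨N - 1, by omega⟩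
  rw [kappa, Nat.add_sub_cancel, pow_succ, mul_assoc, mul_comm (-1 : ℂ), ← mul_assoc, ← mul_pow]
  norm_num

theorem norm_kappa (N : ℕ) : ‖kappa N‖ = 1 := by simp [kappa]

theorem conj_kappa (N : ℕ) : (starRingEnd ℂ) (kappa N) = kappa N := by simp [kappa]

section Energy

theorem continuous_of_hasDerivAt_seq {f : ℕ → ℝ → ℂ}
    (hf : ∀ l x, HasDerivAt (f l) (f (l + 1) x) x) (l : ℕ) : Continuous (f l) :=
  continuous_iff_continuousAt.2 fun x => (hf l x).continuousAt

/-- Each integration by parts moves one derivative onto the conjugate factor, and its boundary term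
contains `f j` at an end, which vanishes as long as `j < N`. -/
theorem integral_mul_conj_of_boundary_zero {N : ℕ} {a b : ℝ} {f : ℕ → ℝ → ℂ}
    (hf : ∀ l x, HasDerivAt (f l) (f (l + 1) x) x)
    (ha : ∀ l < N, f l a = 0) (hb : ∀ l < N, f l b = 0) (j : ℕ) (hj : j ≤ N) :
    ∫ x in a..b, f (2 * N - j) x * (starRingEnd ℂ) (f j x)
      = (-1) ^ j * ∫ x in a..b, f (2 * N) x * (starRingEnd ℂ) (f 0 x) := by
  induction j with
  | zero => simp
  | succ j ih =>
    have hc := continuous_of_hasDerivAt_seq hf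
    have hconj : ∀ l x, HasDerivAt (fun x => (starRingEnd ℂ) (f l x))
        ((starRingEnd ℂ) (f (l + 1) x)) x := fun l x => (hf l x).star
    have hcc : ∀ l, Continuous fun x => (starRingEnd ℂ) (f l x) :=
      fun l => Complex.continuous_conj.comp (hc l)
    have hi : 2 * N - j = (2 * N - (j + 1)) + 1 := by omega
    have h1 := intervalIntegral.integral_deriv_mul_eq_sub (a := a) (b := b)
      (u := f (2 * N - (j + 1))) (v := fun x => (starRingEnd ℂ) (f j x))
      (u' := f (2 * N - j)) (v' := fun x => (starRingEnd ℂ) (f (j + 1) x))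
      (fun x _ => by rw [hi]; exact hf _ x) (fun x _ => hconj j x)
      ((hc _).intervalIntegrable _ _) ((hcc _).intervalIntegrable _ _)
    have hint : ∀ k l, IntervalIntegrable (fun x => f k x * (starRingEnd ℂ) (f l x)) volume a b :=
      fun k l => ((hc k).mul (hcc l)).intervalIntegrable _ _
    rw [intervalIntegral.integral_add (hint _ _) (hint _ _), ih (by omega), ha j (by omega),
      hb j (by omega)] at h1
    simp only [map_zero, mul_zero, sub_zero] at h1
    rw [pow_succ]
    linear_combination h1

/-- A solution of `f^{(2N)} = κ_N λ f`, `Re λ ≥ 0`, with vanishing Dirichlet data vanishes. -/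
theorem eq_zero_of_boundary_zero {N : ℕ} (hN : 0 < N) {a b : ℝ} (hab : a < b) {lam : ℂ}
    (hlam : 0 ≤ lam.re) {f : ℕ → ℝ → ℂ}
    (hf : ∀ l x, HasDerivAt (f l) (f (l + 1) x) x)
    (hper : ∀ x, f (2 * N) x = kappa N * lam * f 0 x)
    (ha : ∀ l < N, f l a = 0) (hb : ∀ l < N, f l b = 0) :
    ∀ l ≤ N, ∀ x ∈ Icc a b, f l x = 0 := by
  have hc := continuous_of_hasDerivAt_seq hf
  have h1 := integral_mul_conj_of_boundary_zero hf ha hb N le_rfl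
  have hNN : 2 * N - N = N := by omega
  rw [hNN] at h1
  have hsq : ∀ l, ∫ x in a..b, f l x * (starRingEnd ℂ) (f l x)
      = ((∫ x in a..b, ‖f l x‖ ^ 2 : ℝ) : ℂ) := by
    intro l
    rw [← intervalIntegral.integral_ofReal]
    refine intervalIntegral.integral_congr fun x _ => ?_
    simp [Complex.mul_conj, Complex.normSq_eq_norm_sq]
  have h2 : ∫ x in a..b, f (2 * N) x * (starRingEnd ℂ) (f 0 x)
      = kappa N * lam * ((∫ x in a..b, ‖f 0 x‖ ^ 2 : ℝ) : ℂ) := by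
    rw [← hsq, ← intervalIntegral.integral_const_mul]
    refine intervalIntegral.integral_congr fun x _ => ?_
    simp only [hper]; ring
  rw [h2, hsq, ← mul_assoc, ← mul_assoc, neg_one_pow_mul_kappa N hN] at h1
  have h3 := congrArg Complex.re h1
  rw [neg_one_mul, Complex.ofReal_re, Complex.re_mul_ofReal, Complex.neg_re] at h3
  have hnn : ∀ l, 0 ≤ ∫ x in a..b, ‖f l x‖ ^ 2 := fun l =>
    intervalIntegral.integral_nonneg hab.le fun x _ => by positivity
  -- The real part of the identity reads `∫ |f_N|² = -Re λ ∫ |f_0|²`: a nonnegative number equal to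
  -- a nonpositive one.
  have h4 : ∫ x in a..b, ‖f N x‖ ^ 2 = 0 := by nlinarith [hnn N, hnn 0, mul_nonneg hlam (hnn 0)]
  have hbase : ∀ x ∈ Icc a b, f N x = 0 := by
    by_contra! hcon
    obtain ⟨x, hx, hfx⟩ := hcon
    have := intervalIntegral.integral_pos hab (f := fun x => ‖f N x‖ ^ 2)
      ((hc N).norm.pow 2).continuousOn (fun x _ => by positivity) ⟨x, hx, by positivity⟩
    linarith
  -- Descent from order `N`: if the next derivative vanishes then `f l` is constant, and its value
  -- at `a` is one of the zero data.
  intro l hl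
  induction hl using Nat.decreasingInduction with
  | self => exact hbase
  | of_succ l hl ih =>
    intro x hx
    rw [← ha l hl]
    refine constant_of_has_deriv_right_zero (hc l).continuousOn (fun z hz => ?_) x hx
    have := hf l z
    rw [ih z ⟨hz.1, hz.2.le⟩] at this
    exact this.hasDerivWithinAt

end Energy

/-! ### The two-point Dirichlet problem in the closed right half-plane. -/

section Boundary

variable {N : ℕ} [NeZero N]

instance neZeroTwoMul : NeZero (2 * N) := ⟨by have := NeZero.pos N; omega⟩

/-- The projection onto the data of order `< N` at the left end. -/
def leftMap (N : ℕ) : (Fin (2 * N) → ℂ) →L[ℂ] (Fin (2 * N) → ℂ) :=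
  LinearMap.toContinuousLinearMap
    { toFun := fun y j => if (j : ℕ) < N then y j else 0
      map_add' := by intro x y; ext j; by_cases h : (j : ℕ) < N <;> simp [h]
      map_smul' := by intro c y; ext j; by_cases h : (j : ℕ) < N <;> simp [h] }

/-- The data of order `< N`, placed in the second half of the coordinates. -/
def rightMap (N : ℕ) : (Fin (2 * N) → ℂ) →L[ℂ] (Fin (2 * N) → ℂ) :=
  LinearMap.toContinuousLinearMap
    { toFun := fun y j => if (j : ℕ) < N then 0 else y ⟨j - N, by omega⟩
      map_add' := by intro x y; ext j; by_cases h : (j : ℕ) < N <;> simp [h]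
      map_smul' := by intro c y; ext j; by_cases h : (j : ℕ) < N <;> simp [h] }

/-- The map from the initial data at `a` to the Dirichlet data at `a` and `b`. -/
def boundaryMap (N : ℕ) [NeZero N] (a b : ℝ) (c : ℂ) :
    (Fin (2 * N) → ℂ) →L[ℂ] (Fin (2 * N) → ℂ) :=
  pencilBoundary (shiftMap (2 * N)) (wrapMap (2 * N)) (leftMap N) (rightMap N) (b - a) c

theorem boundaryMap_apply_left (a b : ℝ) (c : ℂ) (y : Fin (2 * N) → ℂ) (l : ℕ) (h : l < N) :
    boundaryMap N a b c y ⟨l, by omega⟩ = orbit (2 * N) c y l 0 := by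
  rw [orbit_zero_right c y l (by omega)]
  change leftMap N y ⟨l, _⟩ + rightMap N _ ⟨l, _⟩ = _
  simp [leftMap, rightMap, h]

theorem boundaryMap_apply_right (a b : ℝ) (c : ℂ) (y : Fin (2 * N) → ℂ) (l : ℕ) (h : l < N) :
    boundaryMap N a b c y ⟨N + l, by omega⟩ = orbit (2 * N) c y l (b - a) := by
  rw [orbit_of_lt c y l (by omega)]
  change leftMap N y ⟨N + l, _⟩ + rightMap N _ ⟨N + l, _⟩ = _
  simp [leftMap, rightMap]
  rfl

theorem hasDerivAt_orbit_sub (a : ℝ) (c : ℂ) (y : Fin (2 * N) → ℂ) (l : ℕ) (x : ℝ) :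
    HasDerivAt (fun x => orbit (2 * N) c y l (x - a)) (orbit (2 * N) c y (l + 1) (x - a)) x := by
  have := (hasDerivAt_orbit c y l (x - a)).scomp x ((hasDerivAt_id x).sub_const a)
  rw [one_smul] at this
  exact this

/-- In finite dimension injectivity suffices, and a kernel vector generates a solution with zero
Dirichlet data, which the energy identity kills. The imaginary axis, including `λ = 0`, is covered;
the inversion contour runs along it. -/
theorem isUnit_boundaryMap {a b : ℝ} (hab : a < b) {lam : ℂ} (hlam : 0 ≤ lam.re) :
    IsUnit (boundaryMap N a b (kappa N * lam)) := by
  set c := kappa N * lam with hcdef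
  have hinj : Function.Injective (boundaryMap N a b c) := by
    rw [injective_iff_map_eq_zero]
    intro y hy
    set f : ℕ → ℝ → ℂ := fun l x => orbit (2 * N) c y l (x - a) with hf
    have hfd : ∀ l x, HasDerivAt (f l) (f (l + 1) x) x := hasDerivAt_orbit_sub a c y
    have h0 := eq_zero_of_boundary_zero (NeZero.pos N) hab hlam (f := f) hfd
      (fun x => by simpa [hf] using orbit_add_self c y 0 (x - a))
      (fun l hl => by simp only [hf, sub_self]; rw [← boundaryMap_apply_left a b c y l hl, hy]; rfl)
      (fun l hl => by simp only [hf]; rw [← boundaryMap_apply_right a b c y l hl, hy]; rfl)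
      0 (Nat.zero_le _)
    have hall : ∀ l, ∀ x ∈ Ioo a b, f l x = 0 := by
      intro l
      induction l with
      | zero => exact fun x hx => h0 x (Ioo_subset_Icc_self hx)
      | succ l ih =>
        intro x hx
        refine (hfd l x).unique ?_
        refine (hasDerivAt_const x (0 : ℂ)).congr_of_eventuallyEq ?_
        filter_upwards [isOpen_Ioo.mem_nhds hx] with z hz using ih z hz
    obtain ⟨x, hx⟩ : ∃ x, x ∈ Ioo a b := nonempty_Ioo.2 hab
    have h1 : propagator (companion (2 * N) c) (x - a) y = 0 := by
      ext j
      rw [Pi.zero_apply, ← hall j x hx, hf]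
      exact (orbit_of_lt c y j j.2 (x - a)).symm
    have h2 := propagator_add_apply (companion (2 * N) c) (-(x - a)) (x - a) y
    rw [h1, map_zero, neg_add_cancel, propagator_zero_apply] at h2
    exact h2
  rw [ContinuousLinearMap.isUnit_iff_bijective]
  exact ⟨hinj, (LinearMap.injective_iff_surjective
    (f := (boundaryMap N a b c).toLinearMap)).1 hinj⟩

/-- The `l`-th derivative of the solution of `f^{(2N)} = κ_N λ f` with the Dirichlet data `d`
(first half of the coordinates: data at `a`; second half: data at `b`). -/
def sol (N : ℕ) [NeZero N] (a b : ℝ) (d : Fin (2 * N) → ℂ) (lam : ℂ) (l : ℕ) (x : ℝ) : ℂ :=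
  orbit (2 * N) (kappa N * lam) (Ring.inverse (boundaryMap N a b (kappa N * lam)) d) l (x - a)

variable {a b : ℝ} {d : Fin (2 * N) → ℂ}

theorem hasDerivAt_sol (a b : ℝ) (d : Fin (2 * N) → ℂ) (lam : ℂ) (l : ℕ) (x : ℝ) :
    HasDerivAt (sol N a b d lam l) (sol N a b d lam (l + 1) x) x :=
  hasDerivAt_orbit_sub a _ _ l x

theorem sol_add_two_mul (a b : ℝ) (d : Fin (2 * N) → ℂ) (lam : ℂ) (l : ℕ) (x : ℝ) :
    sol N a b d lam (l + 2 * N) x = kappa N * lam * sol N a b d lam l x :=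
  orbit_add_self _ _ l _

theorem sol_two_mul (a b : ℝ) (d : Fin (2 * N) → ℂ) (lam : ℂ) (x : ℝ) :
    sol N a b d lam (2 * N) x = kappa N * lam * sol N a b d lam 0 x := by
  simpa using sol_add_two_mul a b d lam 0 x

theorem continuous_sol (a b : ℝ) (d : Fin (2 * N) → ℂ) (lam : ℂ) (l : ℕ) :
    Continuous (sol N a b d lam l) :=
  continuous_of_hasDerivAt_seq (hasDerivAt_sol a b d lam) l

theorem boundaryMap_inverse_apply (hab : a < b) {lam : ℂ} (hlam : 0 ≤ lam.re)
    (d : Fin (2 * N) → ℂ) :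
    boundaryMap N a b (kappa N * lam) (Ring.inverse (boundaryMap N a b (kappa N * lam)) d) = d :=
  congrArg (fun T => T d) (Ring.mul_inverse_cancel _ (isUnit_boundaryMap hab hlam))

theorem sol_left (hab : a < b) {lam : ℂ} (hlam : 0 ≤ lam.re) (l : ℕ) (h : l < N) :
    sol N a b d lam l a = d ⟨l, by omega⟩ := by
  rw [sol, sub_self, ← boundaryMap_apply_left a b _ _ l h, boundaryMap_inverse_apply hab hlam]

theorem sol_right (hab : a < b) {lam : ℂ} (hlam : 0 ≤ lam.re) (l : ℕ) (h : l < N) :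
    sol N a b d lam l b = d ⟨N + l, by omega⟩ := by
  rw [sol, ← boundaryMap_apply_right a b _ _ l h, boundaryMap_inverse_apply hab hlam]

/-- Uniqueness for the two-point boundary value problem on the open interval. -/
theorem eq_sol_of_hasDerivAt (hab : a < b) {lam : ℂ} (hlam : 0 ≤ lam.re) {g : ℕ → ℝ → ℂ}
    (hg : ∀ l < 2 * N, ∀ x ∈ Ioo a b, HasDerivAt (g l) (g (l + 1) x) x)
    (hn : ∀ x ∈ Ioo a b, g (2 * N) x = kappa N * lam * g 0 x)
    (hl : ∀ l (h : l < N), Tendsto (g l) (𝓝[>] a) (𝓝 (d ⟨l, by omega⟩)))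
    (hr : ∀ l (h : l < N), Tendsto (g l) (𝓝[<] b) (𝓝 (d ⟨N + l, by omega⟩)))
    (l : ℕ) (hl2 : l ≤ 2 * N) (x : ℝ) (hx : x ∈ Ioo a b) : g l x = sol N a b d lam l x := by
  obtain ⟨y, hy⟩ := exists_orbit_of_hasDerivAt hab (kappa N * lam) g hg hn
  have hNpos := NeZero.pos N
  have hc : ∀ l, Continuous fun x => orbit (2 * N) (kappa N * lam) y l (x - a) :=
    continuous_of_hasDerivAt_seq (hasDerivAt_orbit_sub a _ y)
  -- On the open interval `g` agrees with an orbit, which is smooth on the whole line, so the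
  -- one-sided limits of `g` are the boundary values of the orbit.
  have hB : boundaryMap N a b (kappa N * lam) y = d := by
    ext ⟨j, hj⟩
    by_cases h : j < N
    · rw [boundaryMap_apply_left a b _ y j h]
      refine tendsto_nhds_unique (f := g j) (l := 𝓝[>] a) ?_ (hl j h)
      have h1 := ((hc j).tendsto a).mono_left (nhdsWithin_le_nhds (s := Ioi a))
      rw [sub_self] at h1
      refine h1.congr' ?_
      filter_upwards [Ioo_mem_nhdsGT hab] with z hz using (hy j (by omega) z hz).symm
    · obtain ⟨i, rfl⟩ : ∃ i, j = N + i := ⟨j - N, by omega⟩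
      rw [boundaryMap_apply_right a b _ y i (by omega)]
      refine tendsto_nhds_unique (f := g i) (l := 𝓝[<] b) ?_ (hr i (by omega))
      have h1 := ((hc i).tendsto b).mono_left (nhdsWithin_le_nhds (s := Iio b))
      refine h1.congr' ?_
      filter_upwards [Ioo_mem_nhdsLT hab] with z hz using (hy i (by omega) z hz).symm
  have hy2 : Ring.inverse (boundaryMap N a b (kappa N * lam)) d = y := by
    rw [← hB]
    exact congrArg (fun T => T y) (Ring.inverse_mul_cancel _ (isUnit_boundaryMap hab hlam))
  have hlt : ∀ l < 2 * N, g l x = sol N a b d lam l x := by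
    intro l hl
    rw [hy l hl x hx, sol, hy2]
  rcases hl2.lt_or_eq with h | rfl
  · exact hlt l h
  · rw [hn x hx, hlt 0 (by omega), sol_two_mul]

theorem differentiableAt_sol (hab : a < b) {lam : ℂ} (hlam : 0 ≤ lam.re)
    (d : Fin (2 * N) → ℂ) (l : ℕ) (x : ℝ) :
    DifferentiableAt ℂ (fun lam => sol N a b d lam l x) lam := by
  have h := differentiableAt_pencilSolution (shiftMap (2 * N)) (wrapMap (2 * N)) (leftMap N)
    (rightMap N) (ContinuousLinearMap.proj (R := ℂ) (φ := fun _ : Fin (2 * N) => ℂ) 0) d l (b - a)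
    (x - a) (kappa N * lam) (isUnit_boundaryMap hab hlam)
  exact h.comp lam ((differentiableAt_id).const_mul (kappa N))

theorem continuousAt_sol (hab : a < b) {lam : ℂ} (hlam : 0 ≤ lam.re)
    (d : Fin (2 * N) → ℂ) (l : ℕ) (x : ℝ) :
    ContinuousAt (fun p : ℂ × ℝ => sol N a b d p.1 l p.2) (lam, x) := by
  have h := continuousAt_pencilSolution (shiftMap (2 * N)) (wrapMap (2 * N)) (leftMap N)
    (rightMap N) (ContinuousLinearMap.proj (R := ℂ) (φ := fun _ : Fin (2 * N) => ℂ) 0) d l (b - a)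
    (kappa N * lam, x - a) (isUnit_boundaryMap hab hlam)
  have hc : Continuous fun p : ℂ × ℝ => (kappa N * p.1, p.2 - a) :=
    (continuous_const.mul continuous_fst).prodMk (continuous_snd.sub continuous_const)
  exact ContinuousAt.comp (f := fun p : ℂ × ℝ => (kappa N * p.1, p.2 - a)) (x := (lam, x)) h
    hc.continuousAt

/-- Since `κ_N` is real, conjugating a solution for `λ` gives a solution for the conjugate parameter
with the same real data, and uniqueness applies. For real `λ` it follows that `sol` is real. -/
theorem sol_conj (hab : a < b) {lam : ℂ} (hlam : 0 ≤ lam.re)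
    (hd : ∀ j, (starRingEnd ℂ) (d j) = d j) (l : ℕ) (hl : l ≤ 2 * N) (x : ℝ) (hx : x ∈ Ioo a b) :
    (starRingEnd ℂ) (sol N a b d lam l x) = sol N a b d ((starRingEnd ℂ) lam) l x := by
  refine eq_sol_of_hasDerivAt (g := fun l x => (starRingEnd ℂ) (sol N a b d lam l x)) hab
    (by simpa using hlam) (fun l _ x _ => (hasDerivAt_sol a b d lam l x).star) ?_ ?_ ?_ l hl x hx
  · intro x _
    rw [sol_two_mul, map_mul, map_mul, conj_kappa]
  · intro l h
    rw [← hd, ← sol_left (d := d) hab hlam l h]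
    exact ((Complex.continuous_conj.comp (continuous_sol a b d lam l)).tendsto a).mono_left
      nhdsWithin_le_nhds
  · intro l h
    rw [← hd, ← sol_right (d := d) hab hlam l h]
    exact ((Complex.continuous_conj.comp (continuous_sol a b d lam l)).tendsto b).mono_left
      nhdsWithin_le_nhds

theorem sol_im_eq_zero (hab : a < b) {lam : ℝ} (hlam : 0 ≤ lam)
    (hd : ∀ j, (starRingEnd ℂ) (d j) = d j) (l : ℕ) (hl : l ≤ 2 * N) (x : ℝ) (hx : x ∈ Ioo a b) :
    (((sol N a b d lam l x).re : ℝ) : ℂ) = sol N a b d lam l x := by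
  have := sol_conj hab (lam := lam) (by simpa using hlam) hd l hl x hx
  rw [Complex.conj_ofReal] at this
  exact Complex.conj_eq_iff_re.1 this

end Boundary

/-! ### The roots of `κ_N` and their distance from the imaginary axis. -/

section Roots

theorem theta_eq (N l : ℕ) (hN : 0 < N) :
    theta N l = theta N 0 * Complex.exp (2 * Real.pi * Complex.I / (2 * N : ℕ)) ^ l := by
  have hN' : (N : ℂ) ≠ 0 := by exact_mod_cast hN.ne'
  rw [theta, theta, ← Complex.exp_nat_mul, ← Complex.exp_add]
  congr 1
  push_cast
  field_simp
  ring

theorem theta_pow (N l : ℕ) (hN : 0 < N) : theta N l ^ (2 * N) = kappa N := by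
  have hN' : (N : ℂ) ≠ 0 := by exact_mod_cast hN.ne'
  have h1 : theta N l ^ (2 * N) = Complex.exp (Real.pi * Complex.I) ^ (2 * l + (N - 1)) := by
    rw [theta, ← Complex.exp_nat_mul, ← Complex.exp_nat_mul]
    congr 1
    push_cast [Nat.cast_sub (Nat.one_le_iff_ne_zero.2 hN.ne')]
    field_simp
    ring
  rw [h1, Complex.exp_pi_mul_I, kappa, pow_add, pow_mul]
  norm_num

theorem root_pow (N : ℕ) (hN : 0 < N) (j : Fin N ⊕ Fin N) : root N j ^ (2 * N) = kappa N := by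
  rcases j with j | j <;> exact theta_pow N _ hN

theorem norm_theta (N l : ℕ) : ‖theta N l‖ = 1 := by
  rw [theta, mul_comm]
  have : (((2 * l + N - 1) / (2 * N) : ℂ) * Real.pi)
      = (((2 * l + N - 1) / (2 * N) * Real.pi : ℝ) : ℂ) := by push_cast; ring
  rw [this, Complex.norm_exp_ofReal_mul_I]

theorem norm_root (N : ℕ) (j : Fin N ⊕ Fin N) : ‖root N j‖ = 1 := by
  rcases j with j | j <;> exact norm_theta N _

theorem root_injective (N : ℕ) (hN : 0 < N) : Function.Injective (root N) := by
  have hprim := Complex.isPrimitiveRoot_exp (2 * N) (by omega)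
  have h0 : theta N 0 ≠ 0 := Complex.exp_ne_zero _
  have key : ∀ i j : ℕ, i < 2 * N → j < 2 * N → theta N (i + 1) = theta N (j + 1) → i = j := by
    intro i j hi hj h
    rw [theta_eq N _ hN, theta_eq N (j + 1) hN, pow_succ, pow_succ] at h
    exact hprim.pow_inj hi hj (mul_right_cancel₀ (Complex.exp_ne_zero _) (mul_left_cancel₀ h0 h))
  rintro (⟨i, hi⟩ | ⟨i, hi⟩) (⟨j, hj⟩ | ⟨j, hj⟩) h <;> simp only [root, Sum.elim_inl, Sum.elim_inr] at h
  · have := key i j (by omega) (by omega) h; subst this; rfl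
  · have := key i (N + j) (by omega) (by omega) h; omega
  · have := key (N + i) j (by omega) (by omega) h; omega
  · have : i = j := by have := key (N + i) (N + j) (by omega) (by omega) h; omega
    subst this; rfl

/-- A `2N`-th root of `λ`, with argument `arg λ / (2N)`. -/
def mu (N : ℕ) (lam : ℂ) : ℂ :=
  ((‖lam‖ ^ (1 / (2 * N) : ℝ) : ℝ) : ℂ) * Complex.exp ((lam.arg / (2 * N) : ℝ) * Complex.I)

theorem norm_mu (N : ℕ) (lam : ℂ) : ‖mu N lam‖ = ‖lam‖ ^ (1 / (2 * N) : ℝ) := by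
  rw [mu, norm_mul, Complex.norm_exp_ofReal_mul_I, mul_one, Complex.norm_real,
    Real.norm_of_nonneg (by positivity)]

theorem norm_mu_pow (N : ℕ) (hN : 0 < N) (lam : ℂ) : ‖mu N lam‖ ^ (2 * N) = ‖lam‖ := by
  have hN' : (N : ℝ) ≠ 0 := by exact_mod_cast hN.ne'
  rw [norm_mu, ← Real.rpow_natCast, ← Real.rpow_mul (norm_nonneg _)]
  push_cast
  rw [show (1 / (2 * (N : ℝ)) * (2 * N)) = 1 by field_simp, Real.rpow_one]

theorem mu_pow (N : ℕ) (hN : 0 < N) (lam : ℂ) : mu N lam ^ (2 * N) = lam := by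
  have hN' : (N : ℂ) ≠ 0 := by exact_mod_cast hN.ne'
  have h1 := norm_mu_pow N hN lam
  rw [norm_mu] at h1
  rw [mu, mul_pow, ← Complex.ofReal_pow, h1, ← Complex.exp_nat_mul]
  have h2 : ((2 * N : ℕ) : ℂ) * (((lam.arg / (2 * N) : ℝ) : ℂ) * Complex.I)
      = lam.arg * Complex.I := by
    push_cast; field_simp
  rw [h2, Complex.norm_mul_exp_arg_mul_I]

theorem mu_ofReal (N : ℕ) {lam : ℝ} (hlam : 0 < lam) :
    mu N lam = ((lam ^ (1 / (2 * N) : ℝ) : ℝ) : ℂ) := by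
  rw [mu, Complex.arg_ofReal_of_nonneg hlam.le, Complex.norm_real, Real.norm_of_nonneg hlam.le]
  simp

/-- The angle between the imaginary axis and the sectors containing `μ θ_ℓ`. -/
def sectorSin (N : ℕ) : ℝ := Real.sin (Real.pi / (4 * N))

theorem sectorSin_pos (N : ℕ) (hN : 0 < N) : 0 < sectorSin N := by
  have hN' : (1 : ℝ) ≤ N := by exact_mod_cast hN
  refine Real.sin_pos_of_pos_of_lt_pi (by positivity) ?_
  rw [div_lt_iff₀ (by positivity)]
  nlinarith [Real.pi_pos]

theorem re_mu_mul_theta (N l : ℕ) (lam : ℂ) :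
    (mu N lam * theta N l).re =
      ‖mu N lam‖ * Real.cos (lam.arg / (2 * N) + (2 * l + N - 1) / (2 * N) * Real.pi) := by
  rw [norm_mu, mu, theta, mul_assoc, ← Complex.exp_add, Complex.re_ofReal_mul]
  have : ((lam.arg / (2 * N) : ℝ) : ℂ) * Complex.I
      + Complex.I * (((2 * l + N - 1) / (2 * N) : ℂ) * Real.pi)
      = ((lam.arg / (2 * N) + (2 * l + N - 1) / (2 * N) * Real.pi : ℝ) : ℂ) * Complex.I := by
    push_cast; ring
  rw [this, Complex.exp_ofReal_mul_I_re]

theorem cos_add_pi_div_two_le {y s : ℝ} (h1 : s ≤ y) (h2 : y ≤ Real.pi - s) (hs : 0 ≤ s) :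
    Real.cos (y + Real.pi / 2) ≤ -Real.sin s := by
  have hs2 : s ≤ Real.pi / 2 := by linarith
  rw [Real.cos_add_pi_div_two, neg_le_neg_iff]
  rcases le_total y (Real.pi / 2) with h | h
  · exact Real.sin_le_sin_of_le_of_le_pi_div_two (by linarith [Real.pi_pos]) h h1
  · rw [← Real.sin_pi_sub y]
    exact Real.sin_le_sin_of_le_of_le_pi_div_two (by linarith [Real.pi_pos]) (by linarith)
      (by linarith)

/-- With `|arg λ| ≤ π/2`, the argument of `μ θ_ℓ` for the first `N` roots stays between `π/2 +
π/(4N)` and `3π/2 - π/(4N)`. This gap, uniform over the half-plane, is what makes the decay uniform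
in the direction of `λ`. -/
theorem re_mu_mul_root_inl (N : ℕ) {lam : ℂ} (hlam : 0 ≤ lam.re) (j : Fin N) :
    (mu N lam * root N (Sum.inl j)).re ≤ -(sectorSin N * ‖mu N lam‖) := by
  have hj := j.2
  have hN : 0 < N := by omega
  have hN' : (0 : ℝ) < N := by exact_mod_cast hN
  have harg := abs_le.1 (Complex.abs_arg_le_pi_div_two_iff.2 hlam)
  have hj1 : ((j : ℕ) : ℝ) + 1 ≤ N := by exact_mod_cast hj
  have hj0 : (0 : ℝ) ≤ ((j : ℕ) : ℝ) := by positivity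
  change (mu N lam * theta N (j + 1)).re ≤ _
  rw [re_mu_mul_theta]
  have hang : lam.arg / (2 * N) + (2 * ((j + 1 : ℕ) : ℝ) + N - 1) / (2 * N) * Real.pi
      = (lam.arg + (2 * j + 1) * Real.pi) / (2 * N) + Real.pi / 2 := by
    push_cast; field_simp; ring
  have hpi := Real.pi_pos
  have h := cos_add_pi_div_two_le (y := (lam.arg + (2 * j + 1) * Real.pi) / (2 * N))
    (s := Real.pi / (4 * N)) (by
      rw [div_le_div_iff₀ (by positivity) (by positivity)]
      nlinarith [mul_nonneg hj0 hpi.le]) (by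
      rw [div_le_iff₀ (by positivity)]
      have : (Real.pi - Real.pi / (4 * N)) * (2 * N) = 2 * N * Real.pi - Real.pi / 2 := by
        field_simp; ring
      rw [this]
      nlinarith [mul_le_mul_of_nonneg_right hj1 hpi.le]) (by positivity)
  rw [hang, sectorSin]
  nlinarith [mul_le_mul_of_nonneg_left h (norm_nonneg (mu N lam))]

theorem root_inr_eq (N : ℕ) (j : Fin N) : root N (Sum.inr j) = -root N (Sum.inl j) := by
  have hN : (N : ℂ) ≠ 0 := by exact_mod_cast (by have := j.2; omega : N ≠ 0)
  simp only [root, Sum.elim_inl, Sum.elim_inr, theta]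
  have : Complex.I * (((2 * ((N + j + 1 : ℕ) : ℂ) + N - 1) / (2 * N) : ℂ) * Real.pi)
      = Complex.I * (((2 * ((j + 1 : ℕ) : ℂ) + N - 1) / (2 * N) : ℂ) * Real.pi)
        + Real.pi * Complex.I := by
    push_cast; field_simp; ring
  rw [this, Complex.exp_add, Complex.exp_pi_mul_I]; ring

theorem re_mu_mul_root_inr (N : ℕ) {lam : ℂ} (hlam : 0 ≤ lam.re) (j : Fin N) :
    sectorSin N * ‖mu N lam‖ ≤ (mu N lam * root N (Sum.inr j)).re := by
  have := re_mu_mul_root_inl N hlam j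
  rw [root_inr_eq, mul_neg, Complex.neg_re]; linarith

end Roots

/-! ### Exponential sums as solutions. -/

section ExpSum

/-- The `l`-th derivative of `∑ v_j exp(w_j (x - s_j))`. -/
def expSum {ι : Type*} [Fintype ι] (w : ι → ℂ) (s : ι → ℝ) (v : ι → ℂ) (l : ℕ) (x : ℝ) : ℂ :=
  ∑ j, v j * w j ^ l * Complex.exp (w j * ((x : ℂ) - s j))

variable {ι : Type*} [Fintype ι] (w : ι → ℂ) (s : ι → ℝ) (v : ι → ℂ)

theorem hasDerivAt_expSum (l : ℕ) (x : ℝ) :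
    HasDerivAt (expSum w s v l) (expSum w s v (l + 1) x) x := by
  unfold expSum
  refine HasDerivAt.fun_sum fun j _ => ?_
  have h1 : HasDerivAt (fun x : ℝ => w j * ((x : ℂ) - s j)) (w j) x := by
    have := ((Complex.ofRealCLM.hasDerivAt (x := x)).sub_const (s j : ℂ)).const_mul (w j)
    simpa using this
  have h2 := (h1.cexp).const_mul (v j * w j ^ l)
  convert! h2 using 1
  ring

theorem expSum_period {n : ℕ} {c : ℂ} (hw : ∀ j, w j ^ n = c) (l : ℕ) (x : ℝ) :
    expSum w s v (l + n) x = c * expSum w s v l x := by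
  simp only [expSum, Finset.mul_sum]
  refine Finset.sum_congr rfl fun j _ => ?_
  rw [pow_add, hw]; ring

/-- Two differentiation-closed sequences agree as soon as their first terms agree. -/
theorem eqOn_of_hasDerivAt_seq {f g : ℕ → ℝ → ℂ} {U : Set ℝ} (hU : IsOpen U)
    (hf : ∀ l, ∀ x ∈ U, HasDerivAt (f l) (f (l + 1) x) x)
    (hg : ∀ l, ∀ x ∈ U, HasDerivAt (g l) (g (l + 1) x) x)
    (h0 : ∀ x ∈ U, f 0 x = g 0 x) (l : ℕ) : ∀ x ∈ U, f l x = g l x := by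
  induction l with
  | zero => exact h0
  | succ l ih =>
    intro x hx
    refine (hf l x hx).unique ((hg l x hx).congr_of_eventuallyEq ?_)
    filter_upwards [hU.mem_nhds hx] with z hz using ih z hz

theorem eq_zero_of_forall_sum_mul_pow_eq_zero {ι : Type*} [Fintype ι] {w v : ι → ℂ}
    (hw : Function.Injective w) (h : ∀ l : ℕ, ∑ j, v j * w j ^ l = 0) : v = 0 := by
  have e := Fintype.equivFin ι
  have h1 : (fun i => v (e.symm i)) = 0 := by
    refine Matrix.eq_zero_of_forall_pow_sum_mul_pow_eq_zero (f := fun i => w (e.symm i))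
      (hw.comp e.symm.injective) fun i => ?_
    rw [← h i]
    exact e.symm.sum_comp (fun j => v j * w j ^ (i : ℕ))
  ext j
  simpa using congrFun h1 (e j)

end ExpSum

/-! ### The determinants `Δ`, `Δ_k^±` and Cramer's rule. -/

section Determinant

variable {N : ℕ} [NeZero N] {a b : ℝ}

/-- The matrix of Dirichlet data of the exponentials `exp(m θ_j (x - s_j))`, with the row of
order `k` divided by `m^k`. -/
def expMatrix (N : ℕ) (a b : ℝ) (s : Fin N ⊕ Fin N → ℝ) (m : ℂ) :
    Matrix (Fin N ⊕ Fin N) (Fin N ⊕ Fin N) ℂ :=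
  Matrix.of fun r j =>
    Sum.elim (fun k : Fin N => root N j ^ (k : ℕ) * Complex.exp (m * root N j * ((a : ℂ) - s j)))
      (fun k : Fin N => root N j ^ (k : ℕ) * Complex.exp (m * root N j * ((b : ℂ) - s j))) r

theorem expMatrix_mulVec_inl (s : Fin N ⊕ Fin N → ℝ) (m : ℂ) (v : Fin N ⊕ Fin N → ℂ) (k : Fin N) :
    m ^ (k : ℕ) * (expMatrix N a b s m).mulVec v (Sum.inl k)
      = expSum (fun j => m * root N j) s v k a := by
  simp only [Matrix.mulVec, dotProduct, expMatrix, Matrix.of_apply, Sum.elim_inl, expSum,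
    Finset.mul_sum, mul_pow]
  exact Finset.sum_congr rfl fun j _ => by ring

theorem expMatrix_mulVec_inr (s : Fin N ⊕ Fin N → ℝ) (m : ℂ) (v : Fin N ⊕ Fin N → ℂ) (k : Fin N) :
    m ^ (k : ℕ) * (expMatrix N a b s m).mulVec v (Sum.inr k)
      = expSum (fun j => m * root N j) s v k b := by
  simp only [Matrix.mulVec, dotProduct, expMatrix, Matrix.of_apply, Sum.elim_inr, expSum,
    Finset.mul_sum, mul_pow]
  exact Finset.sum_congr rfl fun j _ => by ring

theorem bvpMatrix_eq_expMatrix {lam : ℝ} (hlam : 0 < lam) :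
    bvpMatrix N a b lam = expMatrix N a b 0 (mu N lam) := by
  ext r j
  rcases r with k | k <;> simp [bvpMatrix, expMatrix, expo, mu_ofReal N hlam, mul_assoc]

theorem mu_mul_root_pow (lam : ℂ) (j : Fin N ⊕ Fin N) :
    (mu N lam * root N j) ^ (2 * N) = kappa N * lam := by
  rw [mul_pow, mu_pow N (NeZero.pos N), root_pow N (NeZero.pos N), mul_comm]

theorem expSum_eq_sol (hab : a < b) {lam : ℂ} (hlam : 0 ≤ lam.re) (s : Fin N ⊕ Fin N → ℝ)
    (v : Fin N ⊕ Fin N → ℂ) (d : Fin (2 * N) → ℂ)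
    (hl : ∀ k : Fin N, expSum (fun j => mu N lam * root N j) s v k a = d ⟨k, by omega⟩)
    (hr : ∀ k : Fin N, expSum (fun j => mu N lam * root N j) s v k b = d ⟨N + k, by omega⟩)
    (l : ℕ) (x : ℝ) (hx : x ∈ Ioo a b) :
    expSum (fun j => mu N lam * root N j) s v l x = sol N a b d lam l x := by
  set f := expSum (fun j => mu N lam * root N j) s v with hf
  have hfd : ∀ l x, HasDerivAt (f l) (f (l + 1) x) x := hasDerivAt_expSum _ s v
  have hc := continuous_of_hasDerivAt_seq hfd
  refine eqOn_of_hasDerivAt_seq isOpen_Ioo (fun l x _ => hfd l x)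
    (fun l x _ => hasDerivAt_sol a b d lam l x) ?_ l x hx
  refine eq_sol_of_hasDerivAt hab hlam (fun l _ x _ => hfd l x) ?_ ?_ ?_ 0 (Nat.zero_le _)
  · intro x _
    simpa using expSum_period (fun j => mu N lam * root N j) s v (mu_mul_root_pow lam) 0 x
  · intro l h
    rw [← hl ⟨l, h⟩]
    exact ((hc l).tendsto a).mono_left nhdsWithin_le_nhds
  · intro l h
    rw [← hr ⟨l, h⟩]
    exact ((hc l).tendsto b).mono_left nhdsWithin_le_nhds

theorem mu_ne_zero {lam : ℂ} (h : lam ≠ 0) : mu N lam ≠ 0 := by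
  intro h0
  have := mu_pow N (NeZero.pos N) lam
  rw [h0, zero_pow (by have := NeZero.pos N; omega)] at this
  exact h this.symm

/-- A kernel vector of the matrix is an exponential sum with zero Dirichlet data, hence zero on the
interval together with all derivatives. The exponents are distinct, so a Vandermonde argument at one
point kills the coefficients. -/
theorem Delta_ne_zero (hab : a < b) {lam : ℝ} (hlam : 0 < lam) : Delta N a b lam ≠ 0 := by
  have hN := NeZero.pos N
  have hlam' : (0 : ℝ) ≤ (lam : ℂ).re := by simpa using hlam.le
  intro h0
  obtain ⟨v, hv, hMv⟩ := Matrix.exists_mulVec_eq_zero_iff.2 h0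
  rw [bvpMatrix_eq_expMatrix hlam] at hMv
  set w : Fin N ⊕ Fin N → ℂ := fun j => mu N lam * root N j with hw
  have hfd := hasDerivAt_expSum w 0 v
  have hzero := eq_zero_of_boundary_zero hN hab hlam' (f := expSum w 0 v) hfd
    (fun x => by simpa using expSum_period w 0 v (mu_mul_root_pow (lam : ℂ)) 0 x)
    (fun l hl => by rw [← expMatrix_mulVec_inl (a := a) (b := b) 0 (mu N lam) v ⟨l, hl⟩, hMv]; simp)
    (fun l hl => by rw [← expMatrix_mulVec_inr (a := a) (b := b) 0 (mu N lam) v ⟨l, hl⟩, hMv]; simp)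
    0 (Nat.zero_le _)
  obtain ⟨x, hx⟩ : ∃ x, x ∈ Ioo a b := nonempty_Ioo.2 hab
  have hall : ∀ l, expSum w 0 v l x = 0 := fun l =>
    eqOn_of_hasDerivAt_seq (g := fun _ _ => 0) isOpen_Ioo (fun l x _ => hfd l x)
      (fun _ x _ => hasDerivAt_const x 0) (fun x hx => hzero x (Ioo_subset_Icc_self hx)) l x hx
  have hwinj : Function.Injective w := fun i j hij => root_injective N hN
    (mul_left_cancel₀ (mu_ne_zero (by exact_mod_cast hlam.ne')) hij)
  have h1 : (fun j => v j * Complex.exp (w j * ((x : ℂ) - (0 : ℝ)))) = 0 := by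
    refine eq_zero_of_forall_sum_mul_pow_eq_zero hwinj fun l => ?_
    rw [← hall l, expSum]
    exact Finset.sum_congr rfl fun j _ => by simp; ring
  apply hv
  ext j
  have := congrFun h1 j
  simpa [Complex.exp_ne_zero] using this

theorem det_updateRow_eq_sum {ι : Type*} [Fintype ι] [DecidableEq ι] (M : Matrix ι ι ℂ) (i : ι)
    (g : ι → ℂ) : (M.updateRow i g).det = ∑ j, M.adjugate j i * g j := by
  rw [← Matrix.cramer_transpose_apply, Matrix.cramer_eq_adjugate_mulVec, ← Matrix.adjugate_transpose]
  rfl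

/-- Expanding along the replaced row exhibits the quotient as an exponential sum whose coefficients
form column `r` of the inverse matrix, so its data are concentrated in row `r`. The rows carry `θ^k`
instead of `(μ θ)^k`; the factor `λ^{-k/(2N)} = μ^{-k}` corrects this. Keeping `k` separate from `r`
lets both ends share the proof; in the applications `m = k` and the power of `μ` is `1`. -/
theorem det_ratio_eq_sol (hab : a < b) {lam : ℝ} (hlam : 0 < lam) (r : Fin N ⊕ Fin N) (k : ℕ)
    (d : Fin (2 * N) → ℂ)
    (hl : ∀ m : Fin N, d ⟨m, by omega⟩ = if r = Sum.inl m then mu N lam ^ ((m : ℤ) - k) else 0)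
    (hr : ∀ m : Fin N, d ⟨N + m, by omega⟩ = if r = Sum.inr m then mu N lam ^ ((m : ℤ) - k) else 0)
    (x : ℝ) (hx : x ∈ Ioo a b) :
    ((lam ^ (-(k : ℝ) / (2 * N)) : ℝ) : ℂ) *
      (((bvpMatrix N a b lam).updateRow r fun j => expo N lam (root N j * x)).det /
        Delta N a b lam) = sol N a b d lam 0 x := by
  have hlam' : (0 : ℝ) ≤ (lam : ℂ).re := by simpa using hlam.le
  have hmu : mu N lam ≠ 0 := mu_ne_zero (by exact_mod_cast hlam.ne')
  have hD := Delta_ne_zero (N := N) hab hlam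
  have hpow : ((lam ^ (-(k : ℝ) / (2 * N)) : ℝ) : ℂ) = mu N lam ^ (-(k : ℤ)) := by
    rw [mu_ofReal N hlam, ← Complex.ofReal_zpow, ← Real.rpow_intCast, ← Real.rpow_mul hlam.le]
    congr 2; push_cast; ring
  rw [hpow]
  set M := bvpMatrix N a b lam with hM
  set v : Fin N ⊕ Fin N → ℂ := fun j =>
    mu N lam ^ (-(k : ℤ)) * (M.adjugate j r / Delta N a b lam) with hv
  have hMv : ∀ i, M.mulVec v i = if r = i then mu N lam ^ (-(k : ℤ)) else 0 := by
    intro i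
    have h1 : M.mulVec v i
        = mu N lam ^ (-(k : ℤ)) / Delta N a b lam * (M * M.adjugate) i r := by
      simp only [Matrix.mulVec, dotProduct, hv, Matrix.mul_apply, Finset.mul_sum]
      exact Finset.sum_congr rfl fun j _ => by ring
    rw [h1, Matrix.mul_adjugate, Matrix.smul_apply, Matrix.one_apply, smul_eq_mul, ← Delta]
    by_cases h : r = i
    · simp [h, hD]
    · simp [h, Ne.symm h]
  have key := expSum_eq_sol hab hlam' 0 v d
    (fun m => by
      rw [← expMatrix_mulVec_inl (a := a) (b := b), ← bvpMatrix_eq_expMatrix hlam, ← hM, hMv, hl,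
        mul_ite, mul_zero, ← zpow_natCast, ← zpow_add₀ hmu, sub_eq_add_neg])
    (fun m => by
      rw [← expMatrix_mulVec_inr (a := a) (b := b), ← bvpMatrix_eq_expMatrix hlam, ← hM, hMv, hr,
        mul_ite, mul_zero, ← zpow_natCast, ← zpow_add₀ hmu, sub_eq_add_neg])
    0 x hx
  rw [← key, det_updateRow_eq_sum, expSum, Finset.sum_div, Finset.mul_sum]
  refine Finset.sum_congr rfl fun j _ => ?_
  simp only [hv, expo, mu_ofReal N hlam, pow_zero, mul_one, Pi.zero_apply, Complex.ofReal_zero,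
    sub_zero]
  rw [mul_assoc _ (root N j)]
  ring

/-- The Dirichlet data `∂^k = 1` at the left end, all others `0`. -/
def leftData (k : Fin N) : Fin (2 * N) → ℂ := Pi.single ⟨k, by omega⟩ 1

/-- The Dirichlet data `∂^k = 1` at the right end, all others `0`. -/
def rightData (k : Fin N) : Fin (2 * N) → ℂ := Pi.single ⟨N + k, by omega⟩ 1

theorem leftData_left (k : Fin N) (m : ℕ) (hm : m < N) :
    leftData k ⟨m, by omega⟩ = if (k : ℕ) = m then 1 else 0 := by
  simp [leftData, Pi.single_apply, eq_comm]

theorem leftData_right (k : Fin N) (m : ℕ) (hm : m < N) :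
    leftData k ⟨N + m, by omega⟩ = 0 := by
  have := k.2
  simp [leftData, Pi.single_apply]; omega

theorem rightData_right (k : Fin N) (m : ℕ) (hm : m < N) :
    rightData k ⟨N + m, by omega⟩ = if (k : ℕ) = m then 1 else 0 := by
  simp [rightData, Pi.single_apply, eq_comm]

theorem rightData_left (k : Fin N) (m : ℕ) (hm : m < N) :
    rightData k ⟨m, by omega⟩ = 0 := by
  have := k.2
  simp [rightData, Pi.single_apply]; omega

theorem DeltaMinus_ratio (hab : a < b) {lam : ℝ} (hlam : 0 < lam) (k : Fin N) (x : ℝ)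
    (hx : x ∈ Ioo a b) :
    ((lam ^ (-(k : ℝ) / (2 * N)) : ℝ) : ℂ) * (DeltaMinus N a b k lam x / Delta N a b lam)
      = sol N a b (leftData k) lam 0 x := by
  refine det_ratio_eq_sol hab hlam (Sum.inl k) k (leftData k) (fun m => ?_) (fun m => ?_) x hx
  · rw [leftData_left k m m.2]
    by_cases h : k = m
    · simp [h]
    · have : (k : ℕ) ≠ m := fun h' => h (Fin.ext h')
      simp [h, this]
  · rw [leftData_right k m m.2]; simp

theorem DeltaPlus_ratio (hab : a < b) {lam : ℝ} (hlam : 0 < lam) (k : Fin N) (x : ℝ)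
    (hx : x ∈ Ioo a b) :
    ((lam ^ (-(k : ℝ) / (2 * N)) : ℝ) : ℂ) * (DeltaPlus N a b k lam x / Delta N a b lam)
      = sol N a b (rightData k) lam 0 x := by
  refine det_ratio_eq_sol hab hlam (Sum.inr k) k (rightData k) (fun m => ?_) (fun m => ?_) x hx
  · rw [rightData_left k m m.2]; simp
  · rw [rightData_right k m m.2]
    by_cases h : k = m
    · simp [h]
    · have : (k : ℕ) ≠ m := fun h' => h (Fin.ext h')
      simp [h, this]

end Determinant

/-! ### Decay of the solutions for large parameters. -/

section LargeParameter

variable {N : ℕ} [NeZero N] {a b : ℝ}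

/-- The base points from which the exponentials decay into the interval. -/
def basePoint (N : ℕ) (a b : ℝ) : Fin N ⊕ Fin N → ℝ := Sum.elim (fun _ => a) (fun _ => b)

/-- The limit of the matrix of scaled exponentials for large parameters. -/
def limitMatrix (N : ℕ) : Matrix (Fin N ⊕ Fin N) (Fin N ⊕ Fin N) ℂ :=
  Matrix.fromBlocks (Matrix.vandermonde fun j => root N (Sum.inl j)).transpose 0 0
    (Matrix.vandermonde fun j => root N (Sum.inr j)).transpose

theorem det_limitMatrix_ne_zero (N : ℕ) [NeZero N] : (limitMatrix N).det ≠ 0 := by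
  rw [limitMatrix, Matrix.det_fromBlocks_zero₂₁, Matrix.det_transpose, Matrix.det_transpose]
  have h := root_injective N (NeZero.pos N)
  exact mul_ne_zero (Matrix.det_vandermonde_ne_zero_iff.2 (h.comp Sum.inl_injective))
    (Matrix.det_vandermonde_ne_zero_iff.2 (h.comp Sum.inr_injective))

/-- The filter `|λ| → ∞` in the closed right half-plane. -/
def largeRight : Filter ℂ := comap (fun z : ℂ => ‖z‖) atTop ⊓ 𝓟 {z | 0 ≤ z.re}

theorem tendsto_norm_mu : Tendsto (fun lam : ℂ => ‖mu N lam‖) largeRight atTop := by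
  have hN : (0 : ℝ) < N := by exact_mod_cast NeZero.pos N
  simp only [norm_mu]
  exact (tendsto_rpow_atTop (by positivity)).comp
    (tendsto_comap.mono_left inf_le_left : Tendsto (fun z : ℂ => ‖z‖) largeRight atTop)

theorem eventually_re_nonneg : ∀ᶠ lam : ℂ in largeRight, 0 ≤ lam.re :=
  mem_inf_of_right (mem_principal_self _)

theorem tendsto_exp_of_re_le {f : ℂ → ℂ} {c : ℝ} (hc : 0 < c)
    (h : ∀ lam : ℂ, 0 ≤ lam.re → (f lam).re ≤ -(c * ‖mu N lam‖)) :
    Tendsto (fun lam => Complex.exp (f lam)) largeRight (𝓝 0) := by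
  rw [tendsto_zero_iff_norm_tendsto_zero]
  simp only [Complex.norm_exp]
  have h1 : Tendsto (fun lam : ℂ => Real.exp (-(c * ‖mu N lam‖))) largeRight (𝓝 0) :=
    Real.tendsto_exp_atBot.comp (tendsto_neg_atTop_atBot.comp (tendsto_norm_mu.const_mul_atTop hc))
  refine squeeze_zero' (Eventually.of_forall fun _ => (Real.exp_pos _).le) ?_ h1
  filter_upwards [eventually_re_nonneg] with lam hlam using Real.exp_le_exp.2 (h lam hlam)

/-- Normalised at its base point, each exponential equals `1` at its own end and is exponentially
small at the other, so only the two Vandermonde blocks survive. -/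
theorem tendsto_expMatrix (hab : a < b) :
    Tendsto (fun lam => expMatrix N a b (basePoint N a b) (mu N lam)) largeRight
      (𝓝 (limitMatrix N)) := by
  have hba : 0 < b - a := sub_pos.2 hab
  have hs := sectorSin_pos N (NeZero.pos N)
  refine tendsto_pi_nhds.2 fun r => tendsto_pi_nhds.2 fun j => ?_
  rcases r with k | k <;> rcases j with j | j
  · simpa [expMatrix, basePoint, limitMatrix, Matrix.vandermonde_apply] using tendsto_const_nhds
  · have := tendsto_exp_of_re_le (N := N) (f := fun lam => mu N lam * root N (Sum.inr j) *
      ((a : ℂ) - b)) (mul_pos hs hba) (fun lam hlam => by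
        rw [← Complex.ofReal_sub, Complex.re_mul_ofReal]
        nlinarith [mul_le_mul_of_nonneg_right (re_mu_mul_root_inr N hlam j) hba.le])
    simpa [expMatrix, basePoint, limitMatrix] using
      this.const_mul (root N (Sum.inr j) ^ (k : ℕ))
  · have := tendsto_exp_of_re_le (N := N) (f := fun lam => mu N lam * root N (Sum.inl j) *
      ((b : ℂ) - a)) (mul_pos hs hba) (fun lam hlam => by
        rw [← Complex.ofReal_sub, Complex.re_mul_ofReal]
        nlinarith [mul_le_mul_of_nonneg_right (re_mu_mul_root_inl N hlam j) hba.le])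
    simpa [expMatrix, basePoint, limitMatrix] using
      this.const_mul (root N (Sum.inl j) ^ (k : ℕ))
  · simpa [expMatrix, basePoint, limitMatrix, Matrix.vandermonde_apply] using tendsto_const_nhds

theorem eventually_inverse_bound (hab : a < b) : ∃ K : ℝ, ∀ᶠ lam in largeRight,
    (expMatrix N a b (basePoint N a b) (mu N lam)).det ≠ 0 ∧
    ∀ i j, ‖((expMatrix N a b (basePoint N a b) (mu N lam)).det)⁻¹ *
      (expMatrix N a b (basePoint N a b) (mu N lam)).adjugate i j‖ ≤ K := by
  have hM := tendsto_expMatrix (N := N) hab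
  have hdet : Tendsto (fun lam => (expMatrix N a b (basePoint N a b) (mu N lam)).det) largeRight
      (𝓝 (limitMatrix N).det) := ((continuous_id.matrix_det).tendsto _).comp hM
  have hadj : Tendsto (fun lam => (expMatrix N a b (basePoint N a b) (mu N lam)).adjugate)
      largeRight (𝓝 (limitMatrix N).adjugate) := ((continuous_id.matrix_adjugate).tendsto _).comp hM
  have hne := det_limitMatrix_ne_zero N
  have hentry : ∀ i j, Tendsto (fun lam => ‖((expMatrix N a b (basePoint N a b) (mu N lam)).det)⁻¹ *
      (expMatrix N a b (basePoint N a b) (mu N lam)).adjugate i j‖) largeRight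
      (𝓝 ‖((limitMatrix N).det)⁻¹ * (limitMatrix N).adjugate i j‖) := fun i j =>
    ((hdet.inv₀ hne).mul (tendsto_pi_nhds.1 (tendsto_pi_nhds.1 hadj i) j)).norm
  set K := ∑ i, ∑ j, (‖((limitMatrix N).det)⁻¹ * (limitMatrix N).adjugate i j‖ + 1) with hK
  refine ⟨K, (hdet.eventually_ne hne).and (eventually_all.2 fun i => eventually_all.2 fun j => ?_)⟩
  filter_upwards [(hentry i j).eventually_lt_const (lt_add_one _)] with lam hlam
  refine hlam.le.trans ?_
  refine (Finset.single_le_sum (f := fun j => ‖((limitMatrix N).det)⁻¹ *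
    (limitMatrix N).adjugate i j‖ + 1) (fun _ _ => by positivity) (Finset.mem_univ j)).trans ?_
  exact Finset.single_le_sum (f := fun i => ∑ j, (‖((limitMatrix N).det)⁻¹ *
    (limitMatrix N).adjugate i j‖ + 1)) (fun _ _ => by positivity) (Finset.mem_univ i)

/-- For large parameters the solution is a combination of decaying exponentials with bounded
coefficients. -/
theorem eventually_sol_eq_expSum (hab : a < b) (d : Fin (2 * N) → ℂ) :
    ∃ K : ℝ, ∀ᶠ lam in largeRight, ∃ v : Fin N ⊕ Fin N → ℂ, (∀ j, ‖v j‖ ≤ K) ∧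
      ∀ l, ∀ x ∈ Ioo a b,
        sol N a b d lam l x = expSum (fun j => mu N lam * root N j) (basePoint N a b) v l x := by
  obtain ⟨K, hK⟩ := eventually_inverse_bound (N := N) hab
  refine ⟨∑ _j : Fin N ⊕ Fin N, K * ‖d‖, ?_⟩
  filter_upwards [hK, eventually_re_nonneg, (tendsto_norm_mu (N := N)).eventually_ge_atTop 1]
    with lam ⟨hdet, hlamK⟩ hre hmu
  set m := mu N lam with hm
  have hm0 : m ≠ 0 := fun h => by rw [h, norm_zero] at hmu; linarith
  set M := expMatrix N a b (basePoint N a b) m with hM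
  -- The rows of `expMatrix` omit the factor `m^k`, so the data are divided by it; `1 ≤ ‖m‖` keeps
  -- them bounded by `‖d‖`.
  set rhs : Fin N ⊕ Fin N → ℂ := Sum.elim (fun k => (m ^ (k : ℕ))⁻¹ * d ⟨k, by omega⟩)
    (fun k => (m ^ (k : ℕ))⁻¹ * d ⟨N + k, by omega⟩) with hrhs
  have hrhsb : ∀ r, ‖rhs r‖ ≤ ‖d‖ := by
    have hp : ∀ k : ℕ, ‖(m ^ k)⁻¹‖ ≤ 1 := fun k => by
      rw [norm_inv, norm_pow]; exact inv_le_one_of_one_le₀ (one_le_pow₀ hmu)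
    have hd : ∀ (k : ℕ) i, ‖(m ^ k)⁻¹ * d i‖ ≤ ‖d‖ := fun k i => by
      rw [norm_mul]
      calc _ ≤ 1 * ‖d‖ := mul_le_mul (hp k) (norm_le_pi_norm d i) (norm_nonneg _) zero_le_one
        _ = ‖d‖ := one_mul _
    rintro (k | k) <;> exact hd _ _
  set v : Fin N ⊕ Fin N → ℂ := fun j => ∑ r, (M.det⁻¹ * M.adjugate j r) * rhs r with hv
  have hMv : M.mulVec v = rhs := by
    have : v = M.det⁻¹ • M.adjugate.mulVec rhs := by
      ext j
      simp only [hv, Pi.smul_apply, Matrix.mulVec, dotProduct, smul_eq_mul, Finset.mul_sum,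
        mul_assoc]
    rw [this, Matrix.mulVec_smul, Matrix.mulVec_mulVec, Matrix.mul_adjugate, Matrix.smul_mulVec,
      Matrix.one_mulVec, smul_smul, inv_mul_cancel₀ hdet, one_smul]
  refine ⟨v, fun j => ?_, fun l x hx => ?_⟩
  · refine (norm_sum_le _ _).trans (Finset.sum_le_sum fun r _ => ?_)
    rw [norm_mul]
    exact mul_le_mul (hlamK j r) (hrhsb r) (norm_nonneg _) ((norm_nonneg _).trans (hlamK j r))
  · refine (expSum_eq_sol hab hre (basePoint N a b) v d (fun k => ?_) (fun k => ?_) l x hx).symm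
    · rw [← expMatrix_mulVec_inl (a := a) (b := b), ← hm, ← hM, hMv, hrhs]
      simp [hm0]
    · rw [← expMatrix_mulVec_inr (a := a) (b := b), ← hm, ← hM, hMv, hrhs]
      simp [hm0]

theorem pow_mul_exp_neg_le (n : ℕ) {c t : ℝ} (hc : 0 < c) (ht : 0 ≤ t) :
    t ^ n * Real.exp (-(c * t)) ≤ n.factorial / c ^ n := by
  have h := Real.pow_div_factorial_le_exp (c * t) (by positivity) n
  rw [Real.exp_neg, ← div_eq_mul_inv, div_le_div_iff₀ (Real.exp_pos _) (by positivity)]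
  rw [div_le_iff₀ (by positivity), mul_pow] at h
  linarith

/-- Interior decay of the solutions as `|λ| → ∞` in the right half-plane. -/
theorem exists_sol_bound (hab : a < b) (d : Fin (2 * N) → ℂ) (l : ℕ) {c e : ℝ} (hc : a < c)
    (he : e < b) : ∃ C : ℝ, 0 ≤ C ∧ ∀ lam : ℂ, 0 ≤ lam.re → ∀ x ∈ Icc c e,
      ‖sol N a b d lam l x‖ ≤ C * (1 + ‖lam‖ ^ 2)⁻¹ := by
  have hs := sectorSin_pos N (NeZero.pos N)
  obtain ⟨K, hK⟩ := eventually_sol_eq_expSum (N := N) hab d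
  set δ := min (c - a) (b - e) with hδdef
  have hδ : 0 < δ := lt_min (by linarith) (by linarith)
  have hsub : Icc c e ⊆ Ioo a b := fun x hx => ⟨hc.trans_le hx.1, hx.2.trans_lt he⟩
  set κ := sectorSin N * δ with hκdef
  have hκ : 0 < κ := mul_pos hs hδ
  rw [largeRight, eventually_inf_principal, eventually_comap] at hK
  obtain ⟨R, hR⟩ := eventually_atTop.1 hK
  -- At distance at least `δ` from both ends every exponential is at most `exp(-κ |μ|)`, which beats
  -- all powers; `|λ|²` costs `4N` powers of `|μ|` and the derivatives cost `l` more.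
  have hlarge : ∃ C : ℝ, ∀ lam : ℂ, 0 ≤ lam.re → max R 1 ≤ ‖lam‖ → ∀ x ∈ Icc c e,
      ‖sol N a b d lam l x‖ * (1 + ‖lam‖ ^ 2) ≤ C := by
    refine ⟨∑ _j : Fin N ⊕ Fin N, 2 * K * ((l + 4 * N).factorial / κ ^ (l + 4 * N)), ?_⟩
    intro lam hre hnorm x hx
    obtain ⟨v, hvK, hv⟩ := hR ‖lam‖ ((le_max_left _ _).trans hnorm) lam rfl hre
    have h1 : 1 + ‖lam‖ ^ 2 ≤ 2 * ‖mu N lam‖ ^ (4 * N) := by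
      have : ‖mu N lam‖ ^ (4 * N) = ‖lam‖ ^ 2 := by
        rw [← norm_mu_pow N (NeZero.pos N) lam, ← pow_mul]; congr 1; ring
      rw [this]
      nlinarith [(le_max_right R 1).trans hnorm]
    have hK0 : 0 ≤ K := (norm_nonneg _).trans (hvK (Sum.inl 0))
    rw [hv l x (hsub hx), expSum]
    refine (mul_le_mul_of_nonneg_right (norm_sum_le _ _) (by positivity)).trans ?_
    rw [Finset.sum_mul]
    refine Finset.sum_le_sum fun j _ => ?_
    have hexp : ‖Complex.exp (mu N lam * root N j * ((x : ℂ) - basePoint N a b j))‖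
        ≤ Real.exp (-(κ * ‖mu N lam‖)) := by
      rw [Complex.norm_exp, ← Complex.ofReal_sub, Complex.re_mul_ofReal, Real.exp_le_exp]
      have hq : 0 ≤ sectorSin N * ‖mu N lam‖ := by positivity
      rcases j with j | j
      · have h2 : δ ≤ x - a := (min_le_left _ _).trans (by linarith [hx.1])
        have h3 := mul_le_mul_of_nonneg_right (re_mu_mul_root_inl N hre j) (hδ.le.trans h2)
        have h4 := mul_le_mul_of_nonneg_left h2 hq
        simp only [basePoint, Sum.elim_inl, hκdef]
        nlinarith
      · have h2 : δ ≤ b - x := (min_le_right _ _).trans (by linarith [hx.2])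
        have h3 := mul_le_mul_of_nonneg_right (re_mu_mul_root_inr N hre j) (hδ.le.trans h2)
        have h4 := mul_le_mul_of_nonneg_left h2 hq
        simp only [basePoint, Sum.elim_inr, hκdef]
        nlinarith
    rw [norm_mul, norm_mul, norm_pow, norm_mul, norm_root, mul_one]
    calc ‖v j‖ * ‖mu N lam‖ ^ l *
          ‖Complex.exp (mu N lam * root N j * ((x : ℂ) - basePoint N a b j))‖ * (1 + ‖lam‖ ^ 2)
        ≤ K * ‖mu N lam‖ ^ l * Real.exp (-(κ * ‖mu N lam‖)) * (2 * ‖mu N lam‖ ^ (4 * N)) := by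
          gcongr
          exact hvK j
      _ = 2 * K * (‖mu N lam‖ ^ (l + 4 * N) * Real.exp (-(κ * ‖mu N lam‖))) := by
          rw [pow_add]; ring
      _ ≤ _ := by
          gcongr
          exact pow_mul_exp_neg_le _ hκ (norm_nonneg _)
  -- Bounded parameters and positions in `[c, e]` form a compact set, on which joint continuity
  -- gives the bound.
  have hsmall : ∃ C : ℝ, ∀ p ∈ ({z : ℂ | 0 ≤ z.re} ∩ Metric.closedBall 0 (max R 1)) ×ˢ Icc c e,
      ‖sol N a b d p.1 l p.2 * (1 + ‖p.1‖ ^ 2)‖ ≤ C := by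
    refine IsCompact.exists_bound_of_continuousOn
      (((isCompact_closedBall (0 : ℂ) _).inter_left
        (isClosed_le continuous_const Complex.continuous_re)).prod isCompact_Icc) ?_
    intro p hp
    refine (ContinuousAt.mul (continuousAt_sol (x := p.2) hab hp.1.1 d l) ?_).continuousWithinAt
    fun_prop
  obtain ⟨C₁, hC₁⟩ := hlarge
  obtain ⟨C₂, hC₂⟩ := hsmall
  refine ⟨max (max C₁ C₂) 0, le_max_right _ _, fun lam hre x hx => ?_⟩
  rw [← div_eq_mul_inv, le_div_iff₀ (by positivity)]
  refine le_trans ?_ (le_max_left _ _)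
  rcases le_total (max R 1) ‖lam‖ with h | h
  · exact (hC₁ lam hre h x hx).trans (le_max_left _ _)
  · have := hC₂ (lam, x) ⟨⟨hre, by simpa using h⟩, hx⟩
    rw [norm_mul] at this
    have h2 : ‖((1 : ℂ) + ‖lam‖ ^ 2)‖ = 1 + ‖lam‖ ^ 2 := by
      have : ((1 : ℂ) + ‖lam‖ ^ 2) = ((1 + ‖lam‖ ^ 2 : ℝ) : ℂ) := by push_cast; rfl
      rw [this, Complex.norm_real, Real.norm_of_nonneg (by positivity)]
    simp only [h2] at this
    exact this.trans (le_max_right _ _)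

end LargeParameter

/-! ### Laplace inversion along the imaginary axis. -/

section InverseLaplace

/-- `G` is holomorphic up to the boundary of the right half-plane and `O(|ζ|⁻²)` there. -/
structure HalfPlaneDecay (C : ℝ) (G : ℂ → ℂ) : Prop where
  diff : ∀ z : ℂ, 0 ≤ z.re → DifferentiableAt ℂ G z
  bound : ∀ z : ℂ, 0 ≤ z.re → ‖G z‖ ≤ C * (1 + ‖z‖ ^ 2)⁻¹

theorem HalfPlaneDecay.of_large {G : ℂ → ℂ} (hG : ∀ z : ℂ, 0 ≤ z.re → DifferentiableAt ℂ G z)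
    {C R : ℝ} (h : ∀ z : ℂ, 0 ≤ z.re → R ≤ ‖z‖ → ‖G z‖ ≤ C * (1 + ‖z‖ ^ 2)⁻¹) :
    ∃ C', HalfPlaneDecay C' G := by
  obtain ⟨C₂, hC₂⟩ : ∃ C₂ : ℝ, ∀ z ∈ {z : ℂ | 0 ≤ z.re} ∩ Metric.closedBall 0 R, ‖G z‖ ≤ C₂ := by
    refine IsCompact.exists_bound_of_continuousOn ((isCompact_closedBall (0 : ℂ) _).inter_left
      (isClosed_le continuous_const Complex.continuous_re)) fun z hz => ?_
    exact (hG z hz.1).continuousAt.continuousWithinAt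
  refine ⟨max C (C₂ * (1 + R ^ 2)), hG, fun z hz => ?_⟩
  rcases le_total R ‖z‖ with hR | hR
  · exact (h z hz hR).trans (by gcongr; exact le_max_left _ _)
  · have h1 := hC₂ z ⟨hz, by simpa using hR⟩
    rw [← div_eq_mul_inv, le_div_iff₀ (by positivity)]
    refine le_trans ?_ (le_max_right _ _)
    have h2 : (0 : ℝ) ≤ C₂ := (norm_nonneg _).trans h1
    gcongr

variable {C : ℝ} {G : ℂ → ℂ}

/-- The point `i s` of the imaginary axis. -/
def axis (s : ℝ) : ℂ := (s : ℂ) * Complex.I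

theorem axis_re (s : ℝ) : (axis s).re = 0 := by simp [axis]

theorem norm_axis (s : ℝ) : ‖axis s‖ = |s| := by simp [axis]

theorem continuous_axis : Continuous axis := by unfold axis; fun_prop

theorem HalfPlaneDecay.continuous_comp_axis (h : HalfPlaneDecay C G) :
    Continuous fun s : ℝ => G (axis s) :=
  continuous_iff_continuousAt.2 fun s => ContinuousAt.comp (f := axis)
    (h.diff _ (axis_re s).ge).continuousAt continuous_axis.continuousAt

theorem HalfPlaneDecay.bound_axis (h : HalfPlaneDecay C G) (s : ℝ) :
    ‖G (axis s)‖ ≤ C * (1 + s ^ 2)⁻¹ := by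
  simpa [norm_axis] using h.bound (axis s) (axis_re s).ge

theorem HalfPlaneDecay.integrable_axis (h : HalfPlaneDecay C G) :
    Integrable fun s : ℝ => G (axis s) :=
  (integrable_inv_one_add_sq.const_mul C).mono' h.continuous_comp_axis.aestronglyMeasurable
    (Eventually.of_forall h.bound_axis)

theorem HalfPlaneDecay.nonneg (h : HalfPlaneDecay C G) : 0 ≤ C := by
  have := (norm_nonneg _).trans (h.bound 0 le_rfl)
  simpa using this

/-- Cauchy's theorem on the rectangle `[0,R] × [-R,R]`: the three sides off the axis have total
length `4R`, and the integrand there is at most `C / R²`. -/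
theorem HalfPlaneDecay.integral_axis (h : HalfPlaneDecay C G) : ∫ s : ℝ, G (axis s) = 0 := by
  have hlim : Tendsto (fun R : ℝ => ∫ s in -R..R, G (axis s)) atTop (𝓝 (∫ s : ℝ, G (axis s))) :=
    intervalIntegral_tendsto_integral h.integrable_axis tendsto_neg_atTop_atBot tendsto_id
  refine tendsto_nhds_unique hlim ?_
  have hb : ∀ R : ℝ, 1 ≤ R → ‖∫ s in -R..R, G (axis s)‖ ≤ 4 * C / R := by
    intro R hR
    have hR0 : 0 < R := by linarith
    have hrect := Complex.integral_boundary_rect_eq_zero_of_differentiableOn G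
      (⟨0, -R⟩ : ℂ) (⟨R, R⟩ : ℂ) (fun z hz => by
        refine (h.diff z ?_).differentiableWithinAt
        have := hz.1
        simp only [uIcc_of_le hR0.le, mem_preimage, mem_Icc] at this
        exact this.1)
    simp only [] at hrect
    have hC := h.nonneg
    have hside : ∀ z : ℂ, 0 ≤ z.re → R ≤ ‖z‖ → ‖G z‖ ≤ C / R ^ 2 := by
      intro z hz hzR
      refine (h.bound z hz).trans ?_
      rw [← div_eq_mul_inv]
      gcongr
      nlinarith
    have h1 : ‖∫ x in (0 : ℝ)..R, G (x + ((-R : ℝ) : ℂ) * Complex.I)‖ ≤ C / R ^ 2 * |R - 0| := by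
      refine intervalIntegral.norm_integral_le_of_norm_le_const fun x hx => ?_
      rw [uIoc_of_le hR0.le] at hx
      refine hside _ (by simp [hx.1.le]) ?_
      have := Complex.abs_im_le_norm ((x : ℂ) + ((-R : ℝ) : ℂ) * Complex.I)
      simpa [abs_of_pos hR0] using this
    have h2 : ‖∫ x in (0 : ℝ)..R, G (x + (R : ℂ) * Complex.I)‖ ≤ C / R ^ 2 * |R - 0| := by
      refine intervalIntegral.norm_integral_le_of_norm_le_const fun x hx => ?_
      rw [uIoc_of_le hR0.le] at hx
      refine hside _ (by simp [hx.1.le]) ?_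
      have := Complex.abs_im_le_norm ((x : ℂ) + (R : ℂ) * Complex.I)
      simpa [abs_of_pos hR0] using this
    have h3 : ‖∫ y in -R..R, G ((R : ℂ) + (y : ℂ) * Complex.I)‖ ≤ C / R ^ 2 * |R - -R| := by
      refine intervalIntegral.norm_integral_le_of_norm_le_const fun y hy => ?_
      refine hside _ (by simp [hR0.le]) ?_
      have := Complex.abs_re_le_norm ((R : ℂ) + (y : ℂ) * Complex.I)
      simpa [abs_of_pos hR0] using this
    have h4 : ∫ s in -R..R, G (axis s) = ∫ y in -R..R, G (((0 : ℝ) : ℂ) + (y : ℂ) * Complex.I) := by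
      simp [axis]
    have h5 : ‖Complex.I • ∫ s in -R..R, G (axis s)‖ ≤ C / R ^ 2 * |R - 0| + C / R ^ 2 * |R - 0| +
        C / R ^ 2 * |R - -R| := by
      have h6 : Complex.I • ∫ s in -R..R, G (axis s) =
          (∫ x in (0 : ℝ)..R, G (x + ((-R : ℝ) : ℂ) * Complex.I))
          - (∫ x in (0 : ℝ)..R, G (x + (R : ℂ) * Complex.I))
          + Complex.I • ∫ y in -R..R, G ((R : ℂ) + (y : ℂ) * Complex.I) := by
        rw [h4]; linear_combination -hrect
      rw [h6]
      refine (norm_add_le _ _).trans (add_le_add ((norm_sub_le _ _).trans (add_le_add h1 h2)) ?_)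
      rw [norm_smul, Complex.norm_I, one_mul]; exact h3
    rw [norm_smul, Complex.norm_I, one_mul] at h5
    refine h5.trans (le_of_eq ?_)
    rw [sub_zero, sub_neg_eq_add, abs_of_pos hR0, abs_of_pos (by linarith : 0 < R + R)]
    field_simp; ring
  refine squeeze_zero_norm' (a := fun R : ℝ => 4 * C / R) ?_ (tendsto_const_nhds.div_atTop tendsto_id)
  filter_upwards [eventually_ge_atTop (1 : ℝ)] with R hR using hb R hR

theorem integral_two_mul_div_sq_add_sq {lam : ℝ} (hlam : 0 < lam) :
    ∫ s : ℝ, 2 * lam / (lam ^ 2 + s ^ 2) = 2 * Real.pi := by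
  have h1 := Measure.integral_comp_div (fun s : ℝ => (1 + s ^ 2)⁻¹) lam
  rw [integral_univ_inv_one_add_sq, abs_of_pos hlam, smul_eq_mul] at h1
  have h2 : (fun s : ℝ => 2 * lam / (lam ^ 2 + s ^ 2))
      = fun s => 2 / lam * (1 + (s / lam) ^ 2)⁻¹ := by
    ext s
    field_simp
  rw [h2, integral_const_mul, h1]
  field_simp

theorem lam_add_ne_zero {lam : ℝ} (hlam : 0 < lam) {z : ℂ} (hz : 0 ≤ z.re) : (lam : ℂ) + z ≠ 0 := by
  intro h
  have := congrArg Complex.re h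
  simp at this
  linarith

theorem le_norm_lam_add {lam : ℝ} {z : ℂ} (hz : 0 ≤ z.re) : lam ≤ ‖(lam : ℂ) + z‖ := by
  have := Complex.re_le_norm ((lam : ℂ) + z)
  simp at this
  linarith

theorem norm_le_norm_lam_add {lam : ℝ} (hlam : 0 < lam) {z : ℂ} (hz : 0 ≤ z.re) :
    ‖z‖ ≤ ‖(lam : ℂ) + z‖ := by
  rw [Complex.norm_def, Complex.norm_def]
  apply Real.sqrt_le_sqrt
  simp only [Complex.normSq_apply, Complex.add_re, Complex.add_im, Complex.ofReal_re,
    Complex.ofReal_im]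
  nlinarith

theorem differentiableAt_dslope (h : HalfPlaneDecay C G) {lam : ℝ} (hlam : 0 < lam) {z : ℂ}
    (hz : 0 ≤ z.re) : DifferentiableAt ℂ (dslope G lam) z := by
  by_cases hne : z = lam
  · have hU : {z : ℂ | 0 < z.re} ∈ 𝓝 (lam : ℂ) :=
      (isOpen_lt continuous_const Complex.continuous_re).mem_nhds (by simpa using hlam)
    have h1 : DifferentiableOn ℂ (dslope G lam) {z : ℂ | 0 < z.re} :=
      (Complex.differentiableOn_dslope hU).2 fun z hz => (h.diff z (le_of_lt hz)).differentiableWithinAt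
    rw [hne]
    exact h1.differentiableAt hU
  · exact (differentiableAt_dslope_of_ne hne).2 (h.diff z hz)

/-- Adding `1/(λ+z)` to the Cauchy kernel makes it the Poisson kernel `2λ/(λ²+s²)` on the axis, of
mass `2π`. Replacing `G z` by `G λ` against the Poisson kernel leaves `dslope G λ` times `2λ/(λ+z)`.
This term and `G z/(λ+z)` are holomorphic in the half-plane and `O(|z|⁻²)`, so both integrate to
zero, and no residue computation is needed. -/
theorem HalfPlaneDecay.cauchy (h : HalfPlaneDecay C G) {lam : ℝ} (hlam : 0 < lam) :
    ∫ s : ℝ, G (axis s) / (lam - axis s) = 2 * Real.pi * G lam := by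
  have hC := h.nonneg
  -- the part which is holomorphic in the right half-plane
  have h1 : HalfPlaneDecay (C / lam) fun z => G z / (lam + z) := by
    refine ⟨fun z hz => (h.diff z hz).div (by fun_prop) (lam_add_ne_zero hlam hz), fun z hz => ?_⟩
    rw [norm_div, div_le_iff₀ (norm_pos_iff.2 (lam_add_ne_zero hlam hz))]
    calc ‖G z‖ ≤ C * (1 + ‖z‖ ^ 2)⁻¹ := h.bound z hz
      _ = C / lam * (1 + ‖z‖ ^ 2)⁻¹ * lam := by field_simp
      _ ≤ _ := by gcongr; exact le_norm_lam_add hz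
  obtain ⟨C', h2⟩ : ∃ C', HalfPlaneDecay C' fun z => dslope G lam z * (2 * lam / (lam + z)) := by
    refine HalfPlaneDecay.of_large (C := (C + ‖G lam‖) * (16 * lam)) (R := 2 * lam + 1)
      (fun z hz => (differentiableAt_dslope h hlam hz).mul
        ((differentiableAt_const _).div (by fun_prop) (lam_add_ne_zero hlam hz))) ?_
    intro z hz hR
    have hz0 : 0 < ‖z‖ := by linarith
    have hne : z ≠ lam := by
      rintro rfl
      rw [Complex.norm_real, Real.norm_of_nonneg hlam.le] at hR; linarith
    have h3 : ‖z‖ / 2 ≤ ‖z - lam‖ := by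
      have := norm_sub_norm_le z lam
      rw [Complex.norm_real, Real.norm_of_nonneg hlam.le] at this; linarith
    have h4 : ‖G z‖ ≤ C := (h.bound z hz).trans
      (mul_le_of_le_one_right hC (inv_le_one_of_one_le₀ (by nlinarith [sq_nonneg ‖z‖])))
    rw [dslope_of_ne _ hne, slope_def_field, norm_mul, norm_div, norm_div, norm_mul,
      Complex.norm_real, Real.norm_of_nonneg hlam.le, Complex.norm_ofNat]
    calc ‖G z - G lam‖ / ‖z - lam‖ * (2 * lam / ‖(lam : ℂ) + z‖)
        ≤ (C + ‖G lam‖) / (‖z‖ / 2) * (2 * lam / ‖z‖) := by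
          gcongr
          · exact (norm_sub_le _ _).trans (by gcongr)
          · exact norm_le_norm_lam_add hlam hz
      _ = (C + ‖G lam‖) * (4 * lam) * (‖z‖ ^ 2)⁻¹ := by field_simp; ring
      _ ≤ (C + ‖G lam‖) * (4 * lam) * (4 * (1 + ‖z‖ ^ 2)⁻¹) := by
          gcongr
          rw [← div_eq_mul_inv, inv_eq_one_div, div_le_div_iff₀ (by positivity) (by positivity)]
          nlinarith
      _ = _ := by ring
  have hpoint : ∀ s : ℝ, G (axis s) / (lam - axis s) = G lam * ((2 * lam / (lam ^ 2 + s ^ 2) : ℝ) : ℂ)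
      - dslope G lam (axis s) * (2 * lam / (lam + axis s)) - G (axis s) / (lam + axis s) := by
    intro s
    have hne : axis s ≠ lam := by
      intro h'
      have := congrArg Complex.re h'
      rw [axis_re, Complex.ofReal_re] at this; linarith
    have h3 : axis s - lam ≠ 0 := sub_ne_zero.2 hne
    have h3' : (lam : ℂ) - axis s ≠ 0 := sub_ne_zero.2 hne.symm
    have h4 := lam_add_ne_zero hlam (axis_re s).ge
    have h5 : ((2 * lam / (lam ^ 2 + s ^ 2) : ℝ) : ℂ)
        = 2 * lam / ((lam - axis s) * (lam + axis s)) := by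
      have : (lam - axis s) * (lam + axis s) = ((lam ^ 2 + s ^ 2 : ℝ) : ℂ) := by
        simp only [axis]; push_cast
        linear_combination (-(s : ℂ) ^ 2) * Complex.I_sq
      rw [this]; push_cast; rfl
    rw [dslope_of_ne _ hne, slope_def_field, h5]
    field_simp
    ring
  have hpi := integral_two_mul_div_sq_add_sq hlam
  have hint : Integrable fun s : ℝ => ((2 * lam / (lam ^ 2 + s ^ 2) : ℝ) : ℂ) := by
    have : Integrable fun s : ℝ => 2 * lam / (lam ^ 2 + s ^ 2) :=
      Integrable.of_integral_ne_zero (by rw [hpi]; positivity)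
    exact this.ofReal
  have e1 := h1.integral_axis
  have e2 := h2.integral_axis
  have hint1 : Integrable fun s : ℝ => G lam * ((2 * lam / (lam ^ 2 + s ^ 2) : ℝ) : ℂ)
      - dslope G lam (axis s) * (2 * lam / (lam + axis s)) :=
    (hint.const_mul _).sub h2.integrable_axis
  simp only [hpoint]
  rw [integral_sub hint1 h1.integrable_axis,
    integral_sub (hint.const_mul _) h2.integrable_axis, e1, e2, integral_const_mul,
    integral_complex_ofReal, hpi]
  push_cast; ring

/-- The inverse Laplace transform along the imaginary axis. -/
def invLaplace (G : ℂ → ℂ) (t : ℝ) : ℂ :=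
  ((2 * Real.pi)⁻¹ : ℝ) * ∫ s : ℝ, Complex.exp (axis (s * t)) * G (axis s)

theorem norm_exp_axis (s : ℝ) : ‖Complex.exp (axis s)‖ = 1 := by
  rw [axis, Complex.norm_exp_ofReal_mul_I]

theorem continuous_exp_axis (t : ℝ) : Continuous fun s : ℝ => Complex.exp (axis (s * t)) :=
  Complex.continuous_exp.comp (continuous_axis.comp (by fun_prop))

theorem HalfPlaneDecay.norm_invLaplace_le (h : HalfPlaneDecay C G) (t : ℝ) :
    ‖invLaplace G t‖ ≤ C := by
  have hpi := Real.pi_pos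
  have h1 : ‖∫ s : ℝ, Complex.exp (axis (s * t)) * G (axis s)‖ ≤ ∫ s : ℝ, C * (1 + s ^ 2)⁻¹ := by
    refine norm_integral_le_of_norm_le (integrable_inv_one_add_sq.const_mul C)
      (Eventually.of_forall fun s => ?_)
    rw [norm_mul, norm_exp_axis, one_mul]
    exact h.bound_axis s
  rw [integral_const_mul, integral_univ_inv_one_add_sq] at h1
  rw [invLaplace, norm_mul, Complex.norm_real, Real.norm_of_nonneg (by positivity)]
  calc (2 * Real.pi)⁻¹ * ‖∫ s : ℝ, Complex.exp (axis (s * t)) * G (axis s)‖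
      ≤ (2 * Real.pi)⁻¹ * (C * Real.pi) := by gcongr
    _ = C / 2 := by field_simp
    _ ≤ C := by linarith [h.nonneg]

theorem HalfPlaneDecay.continuous_invLaplace (h : HalfPlaneDecay C G) :
    Continuous (invLaplace G) := by
  refine continuous_const.mul (continuous_of_dominated (bound := fun s => ‖G (axis s)‖) ?_ ?_
    h.integrable_axis.norm ?_)
  · exact fun t => ((continuous_exp_axis t).mul h.continuous_comp_axis).aestronglyMeasurable
  · exact fun t => Eventually.of_forall fun s => by rw [norm_mul, norm_exp_axis, one_mul]
  · refine Eventually.of_forall fun s => Continuous.mul ?_ continuous_const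
    exact Complex.continuous_exp.comp (continuous_axis.comp (by fun_prop))

/-- At time `0` the oscillating factor is `1` and Cauchy's theorem applies; this is where the zero
initial value comes from. -/
theorem HalfPlaneDecay.invLaplace_zero (h : HalfPlaneDecay C G) : invLaplace G 0 = 0 := by
  have := h.integral_axis
  simp [invLaplace, axis] at this ⊢
  exact this

theorem HalfPlaneDecay.hasDerivAt_invLaplace {C₁ : ℝ} {G₁ : ℂ → ℂ} (h : HalfPlaneDecay C G)
    (h₁ : HalfPlaneDecay C₁ G₁) (hG : ∀ s : ℝ, G₁ (axis s) = axis s * G (axis s)) (t : ℝ) :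
    HasDerivAt (invLaplace G) (invLaplace G₁ t) t := by
  refine HasDerivAt.const_mul _ ?_
  refine (hasDerivAt_integral_of_dominated_loc_of_deriv_le (bound := fun s => ‖G₁ (axis s)‖)
    (F' := fun t s => Complex.exp (axis (s * t)) * G₁ (axis s)) univ_mem
    (Eventually.of_forall fun t =>
      ((continuous_exp_axis t).mul h.continuous_comp_axis).aestronglyMeasurable) ?_
    ((continuous_exp_axis t).mul h₁.continuous_comp_axis).aestronglyMeasurable ?_
    h₁.integrable_axis.norm ?_).2
  · refine h.integrable_axis.norm.mono'
      ((continuous_exp_axis t).mul h.continuous_comp_axis).aestronglyMeasurable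
      (Eventually.of_forall fun s => ?_)
    simp [norm_exp_axis]
  · exact Eventually.of_forall fun s t _ => by rw [norm_mul, norm_exp_axis, one_mul]
  · refine Eventually.of_forall fun s t _ => ?_
    have h1 : HasDerivAt (fun t : ℝ => axis (s * t)) (axis s) t := by
      have := ((Complex.ofRealCLM.hasDerivAt (x := t)).const_mul (s : ℂ)).mul_const Complex.I
      simpa [axis] using this
    have h2 := h1.cexp.mul_const (G (axis s))
    convert! h2 using 1
    rw [hG]; ring

theorem HalfPlaneDecay.integrableOn_laplace (h : HalfPlaneDecay C G) {lam : ℝ} (hlam : 0 < lam) :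
    IntegrableOn (fun t : ℝ => (Real.exp (-lam * t) : ℂ) * invLaplace G t) (Ioi 0) := by
  refine Integrable.mono' ((exp_neg_integrableOn_Ioi 0 hlam).const_mul C) ?_ ?_
  · refine Continuous.aestronglyMeasurable ?_
    exact (Complex.continuous_ofReal.comp (by fun_prop)).mul h.continuous_invLaplace
  · refine Eventually.of_forall fun t => ?_
    rw [norm_mul, Complex.norm_real, Real.norm_of_nonneg (Real.exp_pos _).le, mul_comm]
    gcongr
    exact h.norm_invLaplace_le t

/-- After Fubini the time integral is `∫ e^{(is-λ)t} dt = 1/(λ-is)`, which leaves the Cauchy-type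
integral of `HalfPlaneDecay.cauchy`. -/
theorem HalfPlaneDecay.integral_laplace (h : HalfPlaneDecay C G) {lam : ℝ} (hlam : 0 < lam) :
    ∫ t in Ioi (0 : ℝ), (Real.exp (-lam * t) : ℂ) * invLaplace G t = G lam := by
  have hexp : Integrable (fun t : ℝ => Real.exp (-lam * t)) (volume.restrict (Ioi 0)) :=
    exp_neg_integrableOn_Ioi 0 hlam
  have hprod : Integrable (Function.uncurry fun (t s : ℝ) =>
      (Real.exp (-lam * t) : ℂ) * (Complex.exp (axis (s * t)) * G (axis s)))
      ((volume.restrict (Ioi 0)).prod volume) := by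
    refine Integrable.mono (hexp.mul_prod h.integrable_axis.norm) ?_ ?_
    · refine Continuous.aestronglyMeasurable ?_
      refine (Complex.continuous_ofReal.comp (by fun_prop)).mul (Continuous.mul ?_ ?_)
      · exact Complex.continuous_exp.comp (continuous_axis.comp (by fun_prop))
      · exact h.continuous_comp_axis.comp continuous_snd
    · refine Eventually.of_forall fun p => ?_
      simp only [Function.uncurry, norm_mul, norm_exp_axis, one_mul, Complex.norm_real, norm_norm]
      exact le_rfl
  have h1 : ∀ t : ℝ, (Real.exp (-lam * t) : ℂ) * invLaplace G t = ((2 * Real.pi)⁻¹ : ℝ) *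
      ∫ s : ℝ, (Real.exp (-lam * t) : ℂ) * (Complex.exp (axis (s * t)) * G (axis s)) := by
    intro t
    rw [invLaplace, integral_const_mul]; ring
  have h2 : ∀ s : ℝ, ∫ t in Ioi (0 : ℝ), (Real.exp (-lam * t) : ℂ) *
      (Complex.exp (axis (s * t)) * G (axis s)) = G (axis s) / (lam - axis s) := by
    intro s
    have h3 : ∀ t : ℝ, (Real.exp (-lam * t) : ℂ) * (Complex.exp (axis (s * t)) * G (axis s))
        = Complex.exp ((axis s - lam) * t) * G (axis s) := by
      intro t
      rw [← mul_assoc, Complex.ofReal_exp, ← Complex.exp_add]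
      congr 2
      simp only [axis]; push_cast; ring
    have hre : (axis s - lam).re < 0 := by simpa [axis_re] using hlam
    simp only [h3]
    rw [integral_mul_const, integral_exp_mul_complex_Ioi hre]
    have hne : axis s - lam ≠ 0 := fun h0 => by rw [h0] at hre; simp at hre
    have hne' : lam - axis s ≠ 0 := fun h0 => hne (by rw [← neg_sub, h0, neg_zero])
    simp only [Complex.ofReal_zero, mul_zero, Complex.exp_zero]
    field_simp
    ring
  simp only [h1]
  rw [integral_const_mul, integral_integral_swap hprod]
  simp only [h2]
  rw [h.cauchy hlam]
  have := Real.pi_pos.ne'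
  push_cast
  have : (Real.pi : ℂ) ≠ 0 := by exact_mod_cast this
  field_simp

end InverseLaplace

/-! ### Injectivity of the Laplace transform. -/

section LaplaceUniqueness

theorem integral_polynomial_exp_eq_zero {f : ℝ → ℝ} (hf : IntegrableOn f (Ioi 0))
    (h : ∀ n : ℕ, ∫ t in Ioi (0 : ℝ), Real.exp (-t) ^ n * f t = 0) (p : Polynomial ℝ) :
    ∫ t in Ioi (0 : ℝ), p.eval (Real.exp (-t)) * f t = 0 := by
  have hint : ∀ n : ℕ, Integrable (fun t => Real.exp (-t) ^ n * f t) (volume.restrict (Ioi 0)) := by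
    intro n
    refine Integrable.bdd_mul (c := 1) hf (by fun_prop) ?_
    filter_upwards [ae_restrict_mem measurableSet_Ioi] with t ht
    rw [norm_pow, Real.norm_of_nonneg (Real.exp_pos _).le]
    exact pow_le_one₀ (Real.exp_pos _).le (Real.exp_le_one_iff.2 (by simpa using ht.le))
  simp only [Polynomial.eval_eq_sum_range, Finset.sum_mul, mul_assoc]
  rw [integral_finsetSum _ fun n _ => (hint n).const_mul _]
  refine Finset.sum_eq_zero fun n _ => ?_
  rw [integral_const_mul, h, mul_zero]

/-- Weierstrass approximation in the variable `y = e^{-t} ∈ [0,1]`: the hypothesis says that all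
moments vanish. -/
theorem integral_continuous_exp_eq_zero {f : ℝ → ℝ} (hf : IntegrableOn f (Ioi 0))
    (h : ∀ n : ℕ, ∫ t in Ioi (0 : ℝ), Real.exp (-t) ^ n * f t = 0) {ψ : ℝ → ℝ}
    (hψ : ContinuousOn ψ (Icc 0 1))
    (hint : IntegrableOn (fun t => ψ (Real.exp (-t)) * f t) (Ioi 0)) :
    ∫ t in Ioi (0 : ℝ), ψ (Real.exp (-t)) * f t = 0 := by
  set K := ∫ t in Ioi (0 : ℝ), ‖f t‖ with hK
  have hK0 : 0 ≤ K := integral_nonneg fun _ => norm_nonneg _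
  refine abs_eq_zero.1 (le_antisymm (le_of_forall_pos_le_add fun ε hε => ?_) (abs_nonneg _))
  obtain ⟨p, hp⟩ := exists_polynomial_near_of_continuousOn 0 1 ψ hψ (ε / (K + 1)) (by positivity)
  have hmem : ∀ t ∈ Ioi (0 : ℝ), Real.exp (-t) ∈ Icc (0 : ℝ) 1 := fun t ht =>
    ⟨(Real.exp_pos _).le, Real.exp_le_one_iff.2 (by simpa using (mem_Ioi.1 ht).le)⟩
  have hpint : IntegrableOn (fun t => p.eval (Real.exp (-t)) * f t) (Ioi 0) := by
    obtain ⟨M, hM⟩ := isCompact_Icc.exists_bound_of_continuousOn (s := Icc (0 : ℝ) 1)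
      p.continuous.continuousOn
    refine Integrable.bdd_mul (c := M) hf ?_ ?_
    · exact (p.continuous.comp (by fun_prop)).aestronglyMeasurable
    · filter_upwards [ae_restrict_mem measurableSet_Ioi] with t ht using hM _ (hmem t ht)
  have h1 : ∫ t in Ioi (0 : ℝ), ψ (Real.exp (-t)) * f t
      = ∫ t in Ioi (0 : ℝ), (ψ (Real.exp (-t)) * f t - p.eval (Real.exp (-t)) * f t) := by
    rw [integral_sub hint hpint, integral_polynomial_exp_eq_zero hf h p, sub_zero]
  rw [h1, zero_add, ← Real.norm_eq_abs]
  calc _ ≤ ∫ t in Ioi (0 : ℝ), ε / (K + 1) * ‖f t‖ := by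
        refine norm_integral_le_of_norm_le (hf.norm.const_mul _) ?_
        filter_upwards [ae_restrict_mem measurableSet_Ioi] with t ht
        rw [← sub_mul, norm_mul, norm_sub_rev]
        gcongr
        exact (hp _ (hmem t ht)).le
    _ = ε * (K / (K + 1)) := by rw [integral_const_mul]; ring
    _ ≤ ε * 1 := by
        gcongr
        exact div_le_one_of_le₀ (by linarith) (by linarith)
    _ = ε := mul_one ε

/-- Injectivity of the Laplace transform. -/
theorem ae_eq_zero_of_laplace_eq_zero {g : ℝ → ℝ}
    (h : ∀ lam : ℝ, 0 < lam → IntegrableOn (fun t => Real.exp (-lam * t) * g t) (Ioi 0) ∧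
      ∫ t in Ioi (0 : ℝ), Real.exp (-lam * t) * g t = 0) :
    ∀ᵐ t ∂volume.restrict (Ioi (0 : ℝ)), g t = 0 := by
  -- The factor `e^{-t}` makes `f` integrable, and the transforms of `g` at `λ = n + 1` become the
  -- moments of `f` of order `n`.
  set f : ℝ → ℝ := fun t => Real.exp (-1 * t) * g t with hf
  have hfint : IntegrableOn f (Ioi 0) := (h 1 one_pos).1
  have hUo : IsOpen (Ioi (0 : ℝ)) := isOpen_Ioi
  have hloc : LocallyIntegrableOn f (Ioi 0) volume := IntegrableOn.locallyIntegrableOn hfint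
  have hn : ∀ n : ℕ, ∫ t in Ioi (0 : ℝ), Real.exp (-t) ^ n * f t = 0 := by
    intro n
    refine Eq.trans ?_ (h (n + 1) (by positivity)).2
    refine setIntegral_congr_fun measurableSet_Ioi fun t _ => ?_
    simp only [hf]
    rw [← mul_assoc, ← Real.exp_nat_mul, ← Real.exp_add]
    congr 2; ring
  have key : ∀ᵐ t : ℝ, t ∈ Ioi (0 : ℝ) → f t = 0 := by
    refine IsOpen.ae_eq_zero_of_integral_contDiff_smul_eq_zero (U := Ioi (0 : ℝ)) (f := f)
      (μ := volume) hUo hloc ?_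
    intro φ hφ hcs hsub
    have hφ0 : φ 0 = 0 := by
      by_contra h0
      exact lt_irrefl (0 : ℝ) (hsub (subset_tsupport _ h0))
    have hsupp : ∫ t, φ t • f t = ∫ t in Ioi (0 : ℝ), φ t • f t := by
      refine (setIntegral_eq_integral_of_forall_compl_eq_zero fun t ht => ?_).symm
      have : φ t = 0 := by
        by_contra h0
        exact ht (hsub (subset_tsupport _ h0))
      rw [this, zero_smul]
    obtain ⟨M, hM⟩ := hcs.isCompact.isBounded.subset_closedBall (0 : ℝ)
    -- Near `y = 0` this vanishes because the support of `φ` is bounded. At `y = 0` itself `Real.log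
    -- 0 = 0` gives the value `φ 0`, which is zero because the support lies in the open half-line,
    -- so `ψ` is continuous there too.
    set ψ : ℝ → ℝ := fun y => φ (-Real.log y) with hψ
    have hψe : ∀ t, ψ (Real.exp (-t)) = φ t := fun t => by simp [hψ]
    have hψc : ContinuousOn ψ (Icc 0 1) := by
      intro y _
      refine ContinuousAt.continuousWithinAt ?_
      by_cases hy : y = 0
      · have h1 : ψ =ᶠ[𝓝 y] fun _ => 0 := by
          rw [hy]
          have h2 : ∀ᶠ y in 𝓝[≠] (0 : ℝ), ψ y = 0 := by
            filter_upwards [Real.tendsto_log_nhdsNE_zero.eventually_lt_atBot (-|M|)] with y hy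
            by_contra h0
            have h3 := hM (subset_tsupport _ h0)
            rw [Metric.mem_closedBall, Real.dist_eq, sub_zero, abs_neg] at h3
            have h4 : |Real.log y| = -Real.log y := abs_of_neg (by linarith [abs_nonneg M])
            linarith [le_abs_self M]
          rw [eventually_nhdsWithin_iff] at h2
          filter_upwards [h2] with y hy
          by_cases hy0 : y = 0
          · simp [hψ, hy0, hφ0]
          · exact hy hy0
        exact continuousAt_const.congr h1.symm
      · exact hφ.continuous.continuousAt.comp (Real.continuousAt_log hy).neg
    have hint : IntegrableOn (fun t => ψ (Real.exp (-t)) * f t) (Ioi 0) := by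
      simp only [hψe]
      obtain ⟨B, hB⟩ := hcs.exists_bound_of_continuous hφ.continuous
      exact Integrable.bdd_mul (c := B) hfint hφ.continuous.aestronglyMeasurable
        (Eventually.of_forall hB)
    have := integral_continuous_exp_eq_zero hfint hn hψc hint
    simp only [hψe] at this
    rw [hsupp]
    exact this
  rw [ae_restrict_iff' measurableSet_Ioi]
  filter_upwards [key] with t ht h0
  have := ht h0
  simpa [hf, (Real.exp_pos _).ne'] using this

theorem ae_eq_of_laplace_eq {g f : ℝ → ℝ} {F : ℝ → ℂ} (hg : HasLaplaceTransform g F)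
    (hf : HasLaplaceTransform f F) : g =ᵐ[volume.restrict (Ioi 0)] f := by
  have h := ae_eq_zero_of_laplace_eq_zero (g := fun t => g t - f t) fun lam hlam => by
    have hi := (hg lam hlam).1.sub (hf lam hlam).1
    have he : (fun t => Real.exp (-lam * t) * (g t - f t))
        = (fun t => Real.exp (-lam * t) * g t) - fun t => Real.exp (-lam * t) * f t := by
      ext t; simp [mul_sub]
    rw [he]
    refine ⟨hi, ?_⟩
    have h3 := (hg lam hlam).2.trans (hf lam hlam).2.symm
    rw [Complex.ofReal_inj] at h3
    refine Eq.trans (integral_sub (hg lam hlam).1 (hf lam hlam).1) ?_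
    rw [h3, sub_self]
  filter_upwards [h] with t ht using sub_eq_zero.1 ht

end LaplaceUniqueness

/-! ### Sequences of successive derivatives. -/

section SmoothSequences

theorem iteratedDeriv_eq_of_hasDerivAt_seq {g : ℕ → ℝ → ℝ} {U : Set ℝ} (hU : IsOpen U)
    (hg : ∀ l, ∀ x ∈ U, HasDerivAt (g l) (g (l + 1) x) x) (l : ℕ) :
    ∀ x ∈ U, iteratedDeriv l (g 0) x = g l x := by
  induction l with
  | zero => intro x _; rw [iteratedDeriv_zero]
  | succ l ih =>
    intro x hx
    rw [iteratedDeriv_succ]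
    have : iteratedDeriv l (g 0) =ᶠ[𝓝 x] g l := by
      filter_upwards [hU.mem_nhds hx] with z hz using ih z hz
    rw [this.deriv_eq, (hg l x hx).deriv]

theorem contDiffOn_of_hasDerivAt_seq {g : ℕ → ℝ → ℝ} {U : Set ℝ} (hU : IsOpen U)
    (hg : ∀ l, ∀ x ∈ U, HasDerivAt (g l) (g (l + 1) x) x) (n l : ℕ) :
    ContDiffOn ℝ n (g l) U := by
  induction n generalizing l with
  | zero =>
    rw [Nat.cast_zero, contDiffOn_zero]
    exact fun x hx => (hg l x hx).continuousAt.continuousWithinAt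
  | succ n ih =>
    rw [Nat.cast_succ, contDiffOn_succ_iff_deriv_of_isOpen hU]
    refine ⟨fun x hx => (hg l x hx).differentiableAt.differentiableWithinAt, by simp, ?_⟩
    exact (ih (l + 1)).congr fun x hx => (hg l x hx).deriv

theorem hasDerivAt_iteratedDeriv_of_contDiffOn {U : Set ℝ} (hU : IsOpen U) {n l : ℕ} (hl : l < n)
    {f : ℝ → ℝ} (hf : ContDiffOn ℝ n f U) {x : ℝ} (hx : x ∈ U) :
    HasDerivAt (iteratedDeriv l f) (iteratedDeriv (l + 1) f x) x := by
  induction l generalizing n f with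
  | zero =>
    rw [iteratedDeriv_zero, zero_add, iteratedDeriv_one]
    exact (hf.differentiableOn (by exact_mod_cast (by omega : n ≠ 0)) |>.differentiableAt
      (hU.mem_nhds hx)).hasDerivAt
  | succ l ih =>
    obtain ⟨m, rfl⟩ : ∃ m, n = m + 1 := ⟨n - 1, by omega⟩
    rw [Nat.cast_succ, contDiffOn_succ_iff_deriv_of_isOpen hU] at hf
    rw [iteratedDeriv_succ', iteratedDeriv_succ' (n := l + 1)]
    exact ih (by omega) hf.2.2

end SmoothSequences

/-! ### The boundary value problem for the heat equation of order `2N`. -/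

section HeatSolution

variable {N : ℕ} [NeZero N] {a b : ℝ} {d : Fin (2 * N) → ℂ}

/-- The `l`-th space derivative of the solution of the heat equation of order `2N` whose Dirichlet
data are `d` times the Dirac mass at time `0`. -/
def heatSol (N : ℕ) [NeZero N] (a b : ℝ) (d : Fin (2 * N) → ℂ) (l : ℕ) (t x : ℝ) : ℝ :=
  (invLaplace (fun z => sol N a b d z l x) t).re

theorem exists_halfPlaneDecay_sol (hab : a < b) (d : Fin (2 * N) → ℂ) (l : ℕ) {c e : ℝ}
    (hc : a < c) (he : e < b) :
    ∃ C, ∀ x ∈ Icc c e, HalfPlaneDecay C fun z => sol N a b d z l x := by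
  obtain ⟨C, _, hC⟩ := exists_sol_bound hab d l hc he
  exact ⟨C, fun x hx => ⟨fun z hz => differentiableAt_sol hab hz d l x, fun z hz => hC z hz x hx⟩⟩

theorem exists_halfPlaneDecay_sol_of_mem (hab : a < b) (d : Fin (2 * N) → ℂ) (l : ℕ) {x : ℝ}
    (hx : x ∈ Ioo a b) : ∃ C, HalfPlaneDecay C fun z => sol N a b d z l x := by
  obtain ⟨C, hC⟩ := exists_halfPlaneDecay_sol hab d l hx.1 hx.2
  exact ⟨C, hC x ⟨le_rfl, le_rfl⟩⟩

theorem hasDerivAt_invLaplace_sol (hab : a < b) (d : Fin (2 * N) → ℂ) (l : ℕ) (t : ℝ) {x : ℝ}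
    (hx : x ∈ Ioo a b) : HasDerivAt (fun x => invLaplace (fun z => sol N a b d z l x) t)
      (invLaplace (fun z => sol N a b d z (l + 1) x) t) x := by
  obtain ⟨c, hac, hcx⟩ := exists_between hx.1
  obtain ⟨e, hxe, heb⟩ := exists_between hx.2
  obtain ⟨C, hC⟩ := exists_halfPlaneDecay_sol hab d l hac heb
  obtain ⟨C', hC'⟩ := exists_halfPlaneDecay_sol hab d (l + 1) hac heb
  have hxm : x ∈ Icc c e := ⟨hcx.le, hxe.le⟩
  have hnhds : Icc c e ∈ 𝓝 x := Icc_mem_nhds hcx hxe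
  have hmeas : ∀ l, ∀ x ∈ Icc c e, ∀ C, HalfPlaneDecay C (fun z => sol N a b d z l x) →
      AEStronglyMeasurable fun s : ℝ =>
        Complex.exp (axis (s * t)) * sol N a b d (axis s) l x :=
    fun l x _ C h => ((continuous_exp_axis t).mul h.continuous_comp_axis).aestronglyMeasurable
  refine HasDerivAt.const_mul _ ?_
  refine (hasDerivAt_integral_of_dominated_loc_of_deriv_le
    (bound := fun s => C' * (1 + s ^ 2)⁻¹)
    (F' := fun x s => Complex.exp (axis (s * t)) * sol N a b d (axis s) (l + 1) x) hnhds
    ?_ ?_ (hmeas _ x hxm _ (hC' x hxm)) ?_ (integrable_inv_one_add_sq.const_mul C') ?_).2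
  · filter_upwards [hnhds] with y hy using hmeas l y hy C (hC y hy)
  · refine (hC x hxm).integrable_axis.norm.mono' (hmeas l x hxm C (hC x hxm))
      (Eventually.of_forall fun s => ?_)
    rw [norm_mul, norm_exp_axis, one_mul]
  · refine Eventually.of_forall fun s y hy => ?_
    rw [norm_mul, norm_exp_axis, one_mul]
    exact (hC' y hy).bound_axis s
  · exact Eventually.of_forall fun s y _ => (hasDerivAt_sol a b d (axis s) l y).const_mul _

theorem hasDerivAt_heatSol (hab : a < b) (d : Fin (2 * N) → ℂ) (l : ℕ) (t : ℝ) {x : ℝ}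
    (hx : x ∈ Ioo a b) : HasDerivAt (heatSol N a b d l t) (heatSol N a b d (l + 1) t x) x :=
  Complex.reCLM.hasFDerivAt.comp_hasDerivAt x (hasDerivAt_invLaplace_sol hab d l t hx)

theorem iteratedDeriv_heatSol (hab : a < b) (d : Fin (2 * N) → ℂ) (l : ℕ) (t : ℝ) {x : ℝ}
    (hx : x ∈ Ioo a b) : iteratedDeriv l (heatSol N a b d 0 t) x = heatSol N a b d l t x :=
  iteratedDeriv_eq_of_hasDerivAt_seq (g := fun l => heatSol N a b d l t) isOpen_Ioo
    (fun l _ hx => hasDerivAt_heatSol hab d l t hx) l x hx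

theorem continuous_heatSol (hab : a < b) (d : Fin (2 * N) → ℂ) (l : ℕ) {x : ℝ}
    (hx : x ∈ Ioo a b) : Continuous fun t => heatSol N a b d l t x := by
  obtain ⟨C, hC⟩ := exists_halfPlaneDecay_sol_of_mem hab d l hx
  exact Complex.continuous_re.comp hC.continuous_invLaplace

theorem invLaplace_const_mul (c : ℂ) (G : ℂ → ℂ) (t : ℝ) :
    invLaplace (fun z => c * G z) t = c * invLaplace G t := by
  have : ∀ s : ℝ, Complex.exp (axis (s * t)) * (c * G (axis s))
      = c * (Complex.exp (axis (s * t)) * G (axis s)) := fun s => by ring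
  simp only [invLaplace, this]
  rw [integral_const_mul]; ring

theorem kappa_eq_ofReal (N : ℕ) : kappa N = (((-1) ^ (N - 1) : ℝ) : ℂ) := by simp [kappa]

/-- A time derivative multiplies the transform by `z`, and the two-point equation rewrites `z · sol`
as `κ_N ∂^{2N} sol` because `κ_N² = 1`. -/
theorem hasDerivAt_time_heatSol (hab : a < b) (d : Fin (2 * N) → ℂ) (t : ℝ) {x : ℝ}
    (hx : x ∈ Ioo a b) : HasDerivAt (fun t => heatSol N a b d 0 t x)
      ((-1) ^ (N - 1) * heatSol N a b d (2 * N) t x) t := by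
  obtain ⟨C, hC⟩ := exists_halfPlaneDecay_sol_of_mem hab d 0 hx
  obtain ⟨C', hC'⟩ := exists_halfPlaneDecay_sol_of_mem hab d (2 * N) hx
  have h1 : HalfPlaneDecay C' fun z => kappa N * sol N a b d z (2 * N) x :=
    ⟨fun z hz => (hC'.diff z hz).const_mul _, fun z hz => by
      rw [norm_mul, norm_kappa, one_mul]; exact hC'.bound z hz⟩
  have h2 := hC.hasDerivAt_invLaplace h1 (fun s => by
    rw [sol_two_mul, ← mul_assoc, ← mul_assoc, kappa_mul_self, one_mul]) t
  have h3 := Complex.reCLM.hasFDerivAt.comp_hasDerivAt t h2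
  rw [invLaplace_const_mul, kappa_eq_ofReal, Complex.reCLM_apply, Complex.re_ofReal_mul] at h3
  exact h3

theorem laplace_heatSol (hab : a < b) (d : Fin (2 * N) → ℂ) (l : ℕ) {x : ℝ}
    (hx : x ∈ Ioo a b) {lam : ℝ} (hlam : 0 < lam) :
    IntegrableOn (fun t => Real.exp (-lam * t) * heatSol N a b d l t x) (Ioi 0) ∧
    ∫ t in Ioi (0 : ℝ), Real.exp (-lam * t) * heatSol N a b d l t x
      = (sol N a b d lam l x).re := by
  obtain ⟨C, hC⟩ := exists_halfPlaneDecay_sol_of_mem hab d l hx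
  have he : ∀ t : ℝ, Real.exp (-lam * t) * heatSol N a b d l t x
      = ((Real.exp (-lam * t) : ℂ) * invLaplace (fun z => sol N a b d z l x) t).re := fun t => by
    rw [Complex.re_ofReal_mul]; rfl
  have hi := hC.integrableOn_laplace hlam
  simp only [he]
  refine ⟨hi.re, ?_⟩
  rw [← hC.integral_laplace hlam]
  exact integral_re hi

theorem hasLaplaceTransform_heatSol (hab : a < b) (hd : ∀ j, (starRingEnd ℂ) (d j) = d j) {x : ℝ}
    (hx : x ∈ Ioo a b) :
    HasLaplaceTransform (fun t => heatSol N a b d 0 t x) fun lam => sol N a b d lam 0 x := by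
  intro lam hlam
  obtain ⟨h1, h2⟩ := laplace_heatSol hab d 0 hx hlam
  exact ⟨h1, by rw [h2, sol_im_eq_zero hab hlam.le hd 0 (Nat.zero_le _) x hx]⟩

theorem isHeatBVPSolution_heatSol (hab : a < b) {A B : ℕ → ℝ}
    (hA : ∀ l (h : l < N), d ⟨l, by omega⟩ = A l) (hB : ∀ l (h : l < N), d ⟨N + l, by omega⟩ = B l) :
    IsHeatBVPSolution N a b A B (heatSol N a b d 0) where
  regular t _ := contDiffOn_of_hasDerivAt_seq (g := fun l => heatSol N a b d l t) isOpen_Ioo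
    (fun l _ hx => hasDerivAt_heatSol hab d l t hx) (2 * N) 0
  equation t _ x hx := by
    rw [iteratedDeriv_heatSol hab d _ t hx]
    exact hasDerivAt_time_heatSol hab d t hx
  bounded c e hc he l _ := by
    obtain ⟨C, hC⟩ := exists_halfPlaneDecay_sol hab d l hc he
    refine ⟨C, fun t _ x hx => ?_⟩
    rw [iteratedDeriv_heatSol hab d l t ⟨hc.trans_le hx.1, hx.2.trans_lt he⟩]
    exact (Complex.abs_re_le_norm _).trans ((hC x hx).norm_invLaplace_le t)
  initial x hx := by
    obtain ⟨C, hC⟩ := exists_halfPlaneDecay_sol_of_mem hab d 0 hx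
    have h0 : heatSol N a b d 0 0 x = 0 := by rw [heatSol, hC.invLaplace_zero, Complex.zero_re]
    have h1 := (continuous_heatSol hab d 0 hx).tendsto 0
    rw [h0] at h1
    exact h1.mono_left nhdsWithin_le_nhds
  left l hl lam hlam := by
    have h1 : Tendsto (fun x => (sol N a b d lam l x).re) (𝓝[>] a) (𝓝 (A l)) := by
      have h2 := sol_left (d := d) hab (lam := lam) (by simpa using hlam.le) l hl
      rw [hA l hl] at h2
      have h3 := ((Complex.continuous_re.comp (continuous_sol a b d lam l)).tendsto a).mono_left
        (nhdsWithin_le_nhds (s := Ioi a))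
      simpa [Function.comp_def, h2] using h3
    refine h1.congr' ?_
    filter_upwards [Ioo_mem_nhdsGT hab] with x hx
    rw [← (laplace_heatSol hab d l hx hlam).2]
    simp only [iteratedDeriv_heatSol hab d l _ hx]
  right l hl lam hlam := by
    have h1 : Tendsto (fun x => (sol N a b d lam l x).re) (𝓝[<] b) (𝓝 (B l)) := by
      have h2 := sol_right (d := d) hab (lam := lam) (by simpa using hlam.le) l hl
      rw [hB l hl] at h2
      have h3 := ((Complex.continuous_re.comp (continuous_sol a b d lam l)).tendsto b).mono_left
        (nhdsWithin_le_nhds (s := Iio b))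
      simpa [Function.comp_def, h2] using h3
    refine h1.congr' ?_
    filter_upwards [Ioo_mem_nhdsLT hab] with x hx
    rw [← (laplace_heatSol hab d l hx hlam).2]
    simp only [iteratedDeriv_heatSol hab d l _ hx]

variable {A B : ℕ → ℝ} {v : ℝ → ℝ → ℝ}

theorem IsHeatBVPSolution.hasDerivAt (h : IsHeatBVPSolution N a b A B v) {l : ℕ}
    (hl : l < 2 * N) {t : ℝ} (ht : 0 < t) {x : ℝ} (hx : x ∈ Ioo a b) :
    HasDerivAt (iteratedDeriv l (v t)) (iteratedDeriv (l + 1) (v t) x) x :=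
  hasDerivAt_iteratedDeriv_of_contDiffOn isOpen_Ioo hl (h.regular t ht) hx

theorem IsHeatBVPSolution.continuousOn (h : IsHeatBVPSolution N a b A B v) {x : ℝ}
    (hx : x ∈ Ioo a b) : ContinuousOn (fun t => v t x) (Ioi 0) := fun t ht =>
  (h.equation t ht x hx).continuousAt.continuousWithinAt

/-- The problem assumes no joint regularity in `(t, x)`, so measurability in time of the space
derivatives is obtained by induction, as a limit of difference quotients with increments that stay
inside the interval. -/
theorem IsHeatBVPSolution.aestronglyMeasurable (h : IsHeatBVPSolution N a b A B v) (l : ℕ)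
    (hl : l ≤ 2 * N) (x : ℝ) (hx : x ∈ Ioo a b) :
    AEStronglyMeasurable (fun t => iteratedDeriv l (v t) x) (volume.restrict (Ioi 0)) := by
  induction l generalizing x with
  | zero =>
    simp only [iteratedDeriv_zero]
    exact (h.continuousOn hx).aestronglyMeasurable measurableSet_Ioi
  | succ l ih =>
    set δ : ℕ → ℝ := fun n => (b - x) / (n + 2) with hδ
    have hbx : 0 < b - x := sub_pos.2 hx.2
    have hδpos : ∀ n, 0 < δ n := fun n => by positivity
    have hδlt : ∀ n, δ n < b - x := fun n => by
      rw [hδ]; simp only []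
      rw [div_lt_iff₀ (by positivity)]; nlinarith [(Nat.cast_nonneg n : (0 : ℝ) ≤ n)]
    have hδ0 : Tendsto δ atTop (𝓝 0) := by
      refine tendsto_const_nhds.div_atTop ?_
      exact tendsto_atTop_add_const_right _ _ tendsto_natCast_atTop_atTop
    have hδ1 : Tendsto δ atTop (𝓝[≠] 0) := tendsto_nhdsWithin_iff.2
      ⟨hδ0, Eventually.of_forall fun n => (hδpos n).ne'⟩
    refine aestronglyMeasurable_of_tendsto_ae (u := atTop)
      (f := fun n t => (δ n)⁻¹ • (iteratedDeriv l (v t) (x + δ n) - iteratedDeriv l (v t) x))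
      (fun n => ?_) ?_
    · have hxn : x + δ n ∈ Ioo a b := ⟨by linarith [hx.1, hδpos n], by linarith [hδlt n]⟩
      exact ((ih (by omega) _ hxn).sub (ih (by omega) x hx)).const_smul (δ n)⁻¹
    · filter_upwards [ae_restrict_mem measurableSet_Ioi] with t ht
      exact (h.hasDerivAt (by omega) ht hx).tendsto_slope_zero.comp hδ1

theorem IsHeatBVPSolution.integrableOn (h : IsHeatBVPSolution N a b A B v) {l : ℕ}
    (hl : l ≤ 2 * N) {x : ℝ} (hx : x ∈ Ioo a b) {lam : ℝ} (hlam : 0 < lam) :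
    IntegrableOn (fun t => Real.exp (-lam * t) * iteratedDeriv l (v t) x) (Ioi 0) := by
  obtain ⟨C, hC⟩ := h.bounded x x hx.1 hx.2 l hl
  have hexp : IntegrableOn (fun t => Real.exp (-lam * t)) (Ioi 0) := exp_neg_integrableOn_Ioi 0 hlam
  refine Integrable.mul_bdd (c := C) hexp (h.aestronglyMeasurable l hl x hx) ?_
  filter_upwards [ae_restrict_mem measurableSet_Ioi] with t ht using hC t ht x ⟨le_rfl, le_rfl⟩

theorem IsHeatBVPSolution.hasDerivAt_laplace (h : IsHeatBVPSolution N a b A B v) {l : ℕ}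
    (hl : l < 2 * N) {x : ℝ} (hx : x ∈ Ioo a b) {lam : ℝ} (hlam : 0 < lam) :
    HasDerivAt (fun x => ∫ t in Ioi (0 : ℝ), Real.exp (-lam * t) * iteratedDeriv l (v t) x)
      (∫ t in Ioi (0 : ℝ), Real.exp (-lam * t) * iteratedDeriv (l + 1) (v t) x) x := by
  obtain ⟨c, hac, hcx⟩ := exists_between hx.1
  obtain ⟨e, hxe, heb⟩ := exists_between hx.2
  obtain ⟨C, hC⟩ := h.bounded c e hac heb (l + 1) hl
  have hnhds : Icc c e ∈ 𝓝 x := Icc_mem_nhds hcx hxe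
  have hsub : ∀ y ∈ Icc c e, y ∈ Ioo a b := fun y hy => ⟨hac.trans_le hy.1, hy.2.trans_lt heb⟩
  refine (hasDerivAt_integral_of_dominated_loc_of_deriv_le
    (μ := volume.restrict (Ioi (0 : ℝ))) (bound := fun t => Real.exp (-lam * t) * C)
    (F := fun x t => Real.exp (-lam * t) * iteratedDeriv l (v t) x)
    (F' := fun x t => Real.exp (-lam * t) * iteratedDeriv (l + 1) (v t) x) hnhds
    ?_ (h.integrableOn hl.le hx hlam) (h.integrableOn hl hx hlam).aestronglyMeasurable ?_
    ((exp_neg_integrableOn_Ioi 0 hlam).mul_const C) ?_).2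
  · filter_upwards [hnhds] with y hy using
      (h.integrableOn hl.le (hsub y hy) hlam).aestronglyMeasurable
  · filter_upwards [ae_restrict_mem measurableSet_Ioi] with t ht y hy
    rw [norm_mul, Real.norm_of_nonneg (Real.exp_pos _).le]
    exact mul_le_mul_of_nonneg_left (hC t ht y hy) (Real.exp_pos _).le
  · filter_upwards [ae_restrict_mem measurableSet_Ioi] with t ht y hy
    exact (h.hasDerivAt hl ht (hsub y hy)).const_mul _

/-- Integration by parts in time: the boundary term at `0` vanishes by the initial condition, the
one at infinity by boundedness and the exponential weight. -/
theorem IsHeatBVPSolution.laplace_equation (h : IsHeatBVPSolution N a b A B v)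
    {x : ℝ} (hx : x ∈ Ioo a b) {lam : ℝ} (hlam : 0 < lam) :
    ∫ t in Ioi (0 : ℝ), Real.exp (-lam * t) * iteratedDeriv (2 * N) (v t) x
      = (-1) ^ (N - 1) * lam * ∫ t in Ioi (0 : ℝ), Real.exp (-lam * t) * iteratedDeriv 0 (v t) x := by
  obtain ⟨C, hC⟩ := h.bounded x x hx.1 hx.2 0 (Nat.zero_le _)
  have hsq : ((-1) ^ (N - 1) * (-1) ^ (N - 1) : ℝ) = 1 := by rw [← mul_pow]; norm_num
  have hexp : ∀ t : ℝ, HasDerivAt (fun t => Real.exp (-lam * t)) (-lam * Real.exp (-lam * t)) t := by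
    intro t
    have := ((hasDerivAt_id t).const_mul (-lam)).exp
    convert! this using 1
    simp [mul_comm]
  have hi := h.integrableOn le_rfl hx hlam
  have hi0 := h.integrableOn (Nat.zero_le _) hx hlam
  have he : Tendsto (fun t : ℝ => Real.exp (-lam * t)) (𝓝[>] 0) (𝓝 1) := by
    have : Continuous fun t : ℝ => Real.exp (-lam * t) := by fun_prop
    simpa using (this.tendsto 0).mono_left (nhdsWithin_le_nhds (s := Ioi 0))
  have h1 := integral_Ioi_mul_deriv_eq_deriv_mul (a := 0) (a' := 0) (b' := 0)
    (u := fun t => Real.exp (-lam * t)) (u' := fun t => -lam * Real.exp (-lam * t))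
    (v := fun t => v t x) (v' := fun t => (-1) ^ (N - 1) * iteratedDeriv (2 * N) (v t) x)
    (fun t _ => hexp t) (fun t ht => h.equation t ht x hx) ?_ ?_ ?_ ?_
  · have e1 : ∀ t, Real.exp (-lam * t) * ((-1) ^ (N - 1) * iteratedDeriv (2 * N) (v t) x)
        = (-1) ^ (N - 1) * (Real.exp (-lam * t) * iteratedDeriv (2 * N) (v t) x) := fun t => by ring
    have e2 : ∀ t, -lam * Real.exp (-lam * t) * v t x
        = -lam * (Real.exp (-lam * t) * iteratedDeriv 0 (v t) x) := fun t => by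
      rw [iteratedDeriv_zero]; ring
    simp only [e1, e2] at h1
    rw [integral_const_mul, integral_const_mul] at h1
    linear_combination (-1 : ℝ) ^ (N - 1) * h1 -
      (∫ t in Ioi (0 : ℝ), Real.exp (-lam * t) * iteratedDeriv (2 * N) (v t) x) * hsq
  · refine (hi.const_mul ((-1) ^ (N - 1))).congr (Eventually.of_forall fun t => ?_)
    simp only [Pi.mul_apply]; ring
  · refine (hi0.const_mul (-lam)).congr (Eventually.of_forall fun t => ?_)
    simp only [Pi.mul_apply, iteratedDeriv_zero]; ring
  · have := he.mul (h.initial x hx)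
    rw [mul_zero] at this
    exact this
  · have hlim : Tendsto (fun t : ℝ => Real.exp (-lam * t) * C) atTop (𝓝 0) := by
      have := (Real.tendsto_exp_atBot.comp
        ((tendsto_id (α := ℝ)).const_mul_atTop_of_neg (neg_lt_zero.2 hlam))).mul_const C
      simpa using this
    refine squeeze_zero_norm' ?_ hlim
    filter_upwards [eventually_gt_atTop (0 : ℝ)] with t ht
    rw [Pi.mul_apply, norm_mul, Real.norm_of_nonneg (Real.exp_pos _).le]
    refine mul_le_mul_of_nonneg_left ?_ (Real.exp_pos _).le
    simpa using hC t ht x ⟨le_rfl, le_rfl⟩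

/-- The transforms of the space derivatives of any solution form a chain of derivatives solving the
two-point problem with data `d`, so uniqueness there identifies them with `sol`. -/
theorem IsHeatBVPSolution.hasLaplaceTransform (hab : a < b) (h : IsHeatBVPSolution N a b A B v)
    (hA : ∀ l (h : l < N), d ⟨l, by omega⟩ = A l) (hB : ∀ l (h : l < N), d ⟨N + l, by omega⟩ = B l)
    {x : ℝ} (hx : x ∈ Ioo a b) :
    HasLaplaceTransform (fun t => v t x) fun lam => sol N a b d lam 0 x := by
  intro lam hlam
  refine ⟨by simpa using h.integrableOn (Nat.zero_le _) hx hlam, ?_⟩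
  have key := eq_sol_of_hasDerivAt (N := N) (d := d) (lam := lam) hab (by simpa using hlam.le)
    (g := fun l x =>
      ((∫ t in Ioi (0 : ℝ), Real.exp (-lam * t) * iteratedDeriv l (v t) x : ℝ) : ℂ))
    (fun l hl x hx => (h.hasDerivAt_laplace hl hx hlam).ofReal_comp)
    (fun x hx => by
      rw [h.laplace_equation hx hlam, kappa_eq_ofReal]; push_cast; ring)
    (fun l hl => by
      rw [hA l hl]
      exact (Complex.continuous_ofReal.tendsto _).comp (h.left l hl lam hlam))
    (fun l hl => by
      rw [hB l hl]
      exact (Complex.continuous_ofReal.tendsto _).comp (h.right l hl lam hlam))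
    0 (Nat.zero_le _) x hx
  simpa using key

/-- The boundary value problem characterizes `heatSol`. -/
theorem isCharacterizedByBVP_heatSol (hab : a < b)
    (hA : ∀ l (h : l < N), d ⟨l, by omega⟩ = A l)
    (hB : ∀ l (h : l < N), d ⟨N + l, by omega⟩ = B l) :
    IsCharacterizedByBVP N a b A B (heatSol N a b d 0) := by
  refine ⟨isHeatBVPSolution_heatSol hab hA hB, fun v hv t ht x hx => ?_⟩
  have h1 := hv.hasLaplaceTransform hab hA hB hx
  have h2 := (isHeatBVPSolution_heatSol hab hA hB).hasLaplaceTransform hab hA hB hx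
  -- Equality for almost every time becomes equality at every time, because both sides are
  -- continuous in `t`.
  exact Measure.eqOn_open_of_ae_eq (ae_eq_of_laplace_eq h1 h2) isOpen_Ioi (hv.continuousOn hx)
    (continuous_heatSol hab d 0 hx).continuousOn ht

theorem isCharacterizedByLaplace_heatSol (hab : a < b) (hd : ∀ j, (starRingEnd ℂ) (d j) = d j)
    {x : ℝ} (hx : x ∈ Ioo a b) {F : ℝ → ℂ} (hF : ∀ lam, 0 < lam → F lam = sol N a b d lam 0 x) :
    IsCharacterizedByLaplace (fun t => heatSol N a b d 0 t x) F := by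
  have h1 : HasLaplaceTransform (fun t => heatSol N a b d 0 t x) F := fun lam hlam => by
    rw [hF lam hlam]; exact hasLaplaceTransform_heatSol hab hd hx lam hlam
  exact ⟨h1, fun g hg => ae_eq_of_laplace_eq hg h1⟩

end HeatSolution

/-! ### Smoothness, integrability and tails of the heat kernel. -/

section HeatKernel

open scoped FourierTransform SchwartzMap

theorem iteratedDeriv_exp_neg_pow (c : ℝ) (m n : ℕ) : ∃ P : Polynomial ℝ,
    iteratedDeriv n (fun x : ℝ => Real.exp (-(c * x ^ m))) =
      fun x => P.eval x * Real.exp (-(c * x ^ m)) := by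
  induction n with
  | zero => exact ⟨1, by simp⟩
  | succ n ih =>
    obtain ⟨P, hP⟩ := ih
    refine ⟨P.derivative - P * (Polynomial.C (c * m) * Polynomial.X ^ (m - 1)), ?_⟩
    rw [iteratedDeriv_succ, hP]
    ext x
    have h1 : HasDerivAt (fun x : ℝ => Real.exp (-(c * x ^ m)))
        (Real.exp (-(c * x ^ m)) * (-(c * (m * x ^ (m - 1))))) x :=
      ((hasDerivAt_pow m x).const_mul c).neg.exp
    rw [((P.hasDerivAt x).fun_mul h1).deriv]
    simp only [Polynomial.eval_sub, Polynomial.eval_mul, Polynomial.eval_C, Polynomial.eval_pow,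
      Polynomial.eval_X]
    ring

theorem abs_pow_mul_exp_neg_le {c : ℝ} (hc : 0 < c) {N : ℕ} (hN : 0 < N) (k : ℕ) (x : ℝ) :
    |x| ^ k * Real.exp (-(c * x ^ (2 * N))) ≤ 1 + k.factorial / c ^ k := by
  have hx : x ^ (2 * N) = |x| ^ (2 * N) := by rw [pow_mul, pow_mul, sq_abs]
  have h1 : |x| ^ k ≤ 1 + (x ^ (2 * N)) ^ k := by
    rw [hx]
    rcases le_total |x| 1 with h | h
    · have := pow_le_one₀ (n := k) (abs_nonneg x) h
      have : 0 ≤ (|x| ^ (2 * N)) ^ k := by positivity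
      linarith
    · have := pow_le_pow_left₀ (abs_nonneg x) (le_self_pow₀ h (by omega : 2 * N ≠ 0)) k
      linarith
  have h2 := pow_mul_exp_neg_le k hc (by rw [hx]; positivity : 0 ≤ x ^ (2 * N))
  have h3 : Real.exp (-(c * x ^ (2 * N))) ≤ 1 := by
    rw [Real.exp_le_one_iff, hx]
    have : 0 ≤ c * |x| ^ (2 * N) := by positivity
    linarith
  nlinarith [mul_le_mul_of_nonneg_right h1 (Real.exp_pos (-(c * x ^ (2 * N)))).le]

theorem exists_bound_poly_mul_exp_neg {c : ℝ} (hc : 0 < c) {N : ℕ} (hN : 0 < N) (k : ℕ)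
    (P : Polynomial ℝ) : ∃ C : ℝ, ∀ x : ℝ,
      |x| ^ k * |P.eval x * Real.exp (-(c * x ^ (2 * N)))| ≤ C := by
  refine ⟨∑ i ∈ Finset.range (P.natDegree + 1), |P.coeff i| * (1 + (k + i).factorial / c ^ (k + i)),
    fun x => ?_⟩
  rw [abs_mul, abs_of_pos (Real.exp_pos _), Polynomial.eval_eq_sum_range]
  calc |x| ^ k * (|∑ i ∈ Finset.range (P.natDegree + 1), P.coeff i * x ^ i| *
        Real.exp (-(c * x ^ (2 * N))))
      ≤ |x| ^ k * ((∑ i ∈ Finset.range (P.natDegree + 1), |P.coeff i * x ^ i|) *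
        Real.exp (-(c * x ^ (2 * N)))) := by gcongr; exact Finset.abs_sum_le_sum_abs _ _
    _ = ∑ i ∈ Finset.range (P.natDegree + 1), |P.coeff i| *
        (|x| ^ (k + i) * Real.exp (-(c * x ^ (2 * N)))) := by
        rw [Finset.sum_mul, Finset.mul_sum]
        refine Finset.sum_congr rfl fun i _ => ?_
        rw [abs_mul, abs_pow, pow_add]; ring
    _ ≤ _ := Finset.sum_le_sum fun i _ =>
        mul_le_mul_of_nonneg_left (abs_pow_mul_exp_neg_le hc hN _ x) (abs_nonneg _)

/-- The Fourier multiplier of the heat semigroup of order `2N`. -/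
def heatSymbol (N : ℕ) (h ξ : ℝ) : ℝ := Real.exp (-h * (2 * Real.pi * ξ) ^ (2 * N))

theorem heatSymbol_pos (N : ℕ) (h ξ : ℝ) : 0 < heatSymbol N h ξ := Real.exp_pos _

theorem two_pi_mul_pow_nonneg (N : ℕ) (ξ : ℝ) : 0 ≤ (2 * Real.pi * ξ) ^ (2 * N) := by
  rw [pow_mul]; positivity

theorem heatSymbol_le_one {N : ℕ} {h : ℝ} (hh : 0 ≤ h) (ξ : ℝ) : heatSymbol N h ξ ≤ 1 := by
  rw [heatSymbol, Real.exp_le_one_iff]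
  nlinarith [mul_nonneg hh (two_pi_mul_pow_nonneg N ξ)]

theorem continuous_heatSymbol (N : ℕ) (h : ℝ) : Continuous (heatSymbol N h) := by
  unfold heatSymbol; fun_prop

theorem heatSymbol_neg (N : ℕ) (h ξ : ℝ) : heatSymbol N h (-ξ) = heatSymbol N h ξ := by
  unfold heatSymbol
  rw [mul_neg, (even_two_mul N).neg_pow]

/-- The Fourier multiplier of the heat semigroup as a Schwartz function. -/
def heatSchwartz (N : ℕ) (hN : 0 < N) (h : ℝ) (hh : 0 < h) : 𝓢(ℝ, ℂ) :=
  SchwartzMap.postcompCLM (𝕜 := ℝ) Complex.ofRealCLM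
    { toFun := heatSymbol N h
      smooth' := by
        unfold heatSymbol
        exact (contDiff_const.mul ((contDiff_const.mul contDiff_id).pow _)).exp
      decay' := by
        intro k n
        have he : heatSymbol N h = fun x =>
            Real.exp (-((h * (2 * Real.pi) ^ (2 * N)) * x ^ (2 * N))) := by
          ext x; rw [heatSymbol, mul_pow]; congr 1; ring
        obtain ⟨P, hP⟩ := iteratedDeriv_exp_neg_pow (h * (2 * Real.pi) ^ (2 * N)) (2 * N) n
        obtain ⟨C, hC⟩ := exists_bound_poly_mul_exp_neg
          (c := h * (2 * Real.pi) ^ (2 * N)) (by positivity) hN k P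
        refine ⟨C, fun x => ?_⟩
        rw [norm_iteratedFDeriv_eq_norm_iteratedDeriv, he, hP]
        exact hC x }

theorem integrable_heatSymbol {N : ℕ} (hN : 0 < N) {h : ℝ} (hh : 0 < h) :
    Integrable (heatSymbol N h) := by
  have := (heatSchwartz N hN h hh).integrable (μ := volume)
  exact this.re

theorem integrable_ofReal_heatSymbol {N : ℕ} (hN : 0 < N) {h : ℝ} (hh : 0 < h) :
    Integrable fun ξ => (heatSymbol N h ξ : ℂ) := (integrable_heatSymbol hN hh).ofReal

theorem heatKernel_neg (N : ℕ) (h x : ℝ) : heatKernel N h (-x) = heatKernel N h x := by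
  simp [heatKernel]

theorem fourier_heatSymbol {N : ℕ} (hN : 0 < N) {h : ℝ} (hh : 0 < h) (x : ℝ) :
    𝓕 (fun ξ => (heatSymbol N h ξ : ℂ)) x = heatKernel N h x := by
  have hint : Integrable fun ξ : ℝ =>
      Complex.exp (((-2 * Real.pi * ξ * x : ℝ) : ℂ) * Complex.I) * (heatSymbol N h ξ : ℂ) := by
    refine (integrable_ofReal_heatSymbol hN hh).bdd_mul (c := 1) ?_ ?_
    · exact (by fun_prop : Continuous fun ξ : ℝ =>
        Complex.exp (((-2 * Real.pi * ξ * x : ℝ) : ℂ) * Complex.I)).aestronglyMeasurable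
    · exact Eventually.of_forall fun ξ => by rw [Complex.norm_exp_ofReal_mul_I]
  have hF : 𝓕 (fun ξ => (heatSymbol N h ξ : ℂ)) x = ∫ ξ : ℝ,
      Complex.exp (((-2 * Real.pi * ξ * x : ℝ) : ℂ) * Complex.I) * (heatSymbol N h ξ : ℂ) := by
    rw [Real.fourier_real_eq_integral_exp_smul]; rfl
  have hconj : (starRingEnd ℂ) (𝓕 (fun ξ => (heatSymbol N h ξ : ℂ)) x)
      = 𝓕 (fun ξ => (heatSymbol N h ξ : ℂ)) x := by
    rw [hF, ← integral_conj, ← integral_neg_eq_self]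
    refine integral_congr_ae (Eventually.of_forall fun ξ => ?_)
    simp only [map_mul, Complex.conj_ofReal, heatSymbol_neg]
    rw [← Complex.exp_conj, map_mul, Complex.conj_ofReal, Complex.conj_I]
    congr 2
    push_cast
    ring
  rw [← Complex.conj_eq_iff_re.1 hconj, hF]
  congr 1
  have hre := integral_re hint
  simp only [RCLike.re_to_complex] at hre
  rw [← hre, heatKernel]
  have h2 := Measure.integral_comp_mul_left
    (fun u : ℝ => Real.cos (u * x) * Real.exp (-h * u ^ (2 * N))) (2 * Real.pi)
  rw [abs_of_pos (by positivity), smul_eq_mul] at h2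
  rw [← h2]
  refine integral_congr_ae (Eventually.of_forall fun ξ => ?_)
  simp only [Complex.re_mul_ofReal, Complex.exp_ofReal_mul_I_re, heatSymbol]
  congr 1
  rw [← Real.cos_neg]
  congr 1; ring

theorem heatKernel_eq_integral {N : ℕ} (hN : 0 < N) {h : ℝ} (hh : 0 < h) (x : ℝ) :
    (heatKernel N h x : ℂ) = ∫ ξ : ℝ,
      Complex.exp (((2 * Real.pi * ξ * x : ℝ) : ℂ) * Complex.I) * (heatSymbol N h ξ : ℂ) := by
  rw [← heatKernel_neg, ← fourier_heatSymbol hN hh, Real.fourier_real_eq_integral_exp_smul]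
  refine integral_congr_ae (Eventually.of_forall fun ξ => ?_)
  simp only [smul_eq_mul]
  congr 4; ring

theorem fourier_heatSchwartz (N : ℕ) (hN : 0 < N) (h : ℝ) (hh : 0 < h) (x : ℝ) :
    (𝓕 (heatSchwartz N hN h hh)) x = (heatKernel N h x : ℂ) := fourier_heatSymbol hN hh x

theorem continuous_heatKernel {N : ℕ} (hN : 0 < N) {h : ℝ} (hh : 0 < h) :
    Continuous (heatKernel N h) := by
  have := Complex.continuous_re.comp (𝓕 (heatSchwartz N hN h hh)).continuous
  exact this.congr fun x => by
    rw [Function.comp_apply, fourier_heatSchwartz, Complex.ofReal_re]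

theorem integrable_heatKernel {N : ℕ} (hN : 0 < N) {h : ℝ} (hh : 0 < h) :
    Integrable (heatKernel N h) := by
  have := ((𝓕 (heatSchwartz N hN h hh)).integrable (μ := volume)).re
  refine this.congr (Eventually.of_forall fun x => ?_)
  simp only []
  rw [fourier_heatSchwartz]; exact Complex.ofReal_re _

theorem integrable_heatKernel_sub {N : ℕ} (hN : 0 < N) {h : ℝ} (hh : 0 < h) (x : ℝ) :
    Integrable fun y => heatKernel N h (x - y) := (integrable_heatKernel hN hh).comp_sub_left x

theorem heatKernel_scale {N : ℕ} {r : ℝ} (hr : 0 < r) (x : ℝ) :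
    heatKernel N (r ^ (2 * N)) x = r⁻¹ * heatKernel N 1 (x / r) := by
  have h := Measure.integral_comp_mul_left
    (fun u : ℝ => Real.cos (u * (x / r)) * Real.exp (-1 * u ^ (2 * N))) r
  rw [abs_of_pos (by positivity), smul_eq_mul] at h
  rw [heatKernel, heatKernel, mul_left_comm, ← h]
  congr 2
  ext u
  congr 2
  · field_simp
  · rw [mul_pow]; ring

/-- Self-similarity with `r = h^{1/(2N)}` reduces to `h = 1`, where the kernel is a Schwartz
function. Decay of order `4N + 1`, against the normalising factor `r⁻¹`, leaves `r^{4N} = h²`; away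
from the origin the remaining power of `|y|` is dominated by an integrable weight. -/
theorem exists_heatKernel_bound {N : ℕ} (hN : 0 < N) {δ : ℝ} (hδ : 0 < δ) :
    ∃ C : ℝ, 0 ≤ C ∧ ∀ h, 0 < h → ∀ y, δ ≤ |y| → |heatKernel N h y| ≤ C * h ^ 2 * (1 + y ^ 2)⁻¹ := by
  obtain ⟨C, hC⟩ := (𝓕 (heatSchwartz N hN 1 one_pos)).decay (4 * N + 1) 0
  obtain ⟨hC0, hC⟩ := hC
  have hdec : ∀ y : ℝ, |y| ^ (4 * N + 1) * |heatKernel N 1 y| ≤ C := fun y => by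
    have := hC y
    rw [norm_iteratedFDeriv_zero, fourier_heatSchwartz, Complex.norm_real] at this
    exact this
  refine ⟨C * (δ⁻¹ ^ (4 * N - 1) * (1 + δ⁻¹ ^ 2)), by positivity, fun h hh y hy => ?_⟩
  have hy0 : 0 < |y| := hδ.trans_le hy
  set r : ℝ := h ^ (1 / (2 * N) : ℝ) with hr
  have hr0 : 0 < r := by positivity
  have hrh : r ^ (2 * N) = h := by
    rw [hr, ← Real.rpow_natCast, ← Real.rpow_mul hh.le]
    have : (N : ℝ) ≠ 0 := by exact_mod_cast hN.ne'
    push_cast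
    rw [show (1 / (2 * (N : ℝ)) * (2 * N)) = 1 by field_simp, Real.rpow_one]
  have h1 : |heatKernel N h y| ≤ C * h ^ 2 * |y|⁻¹ ^ (4 * N + 1) := by
    rw [← hrh, heatKernel_scale hr0, abs_mul, abs_of_pos (inv_pos.2 hr0)]
    have h2 := hdec (y / r)
    rw [abs_div, abs_of_pos hr0, div_pow, div_mul_eq_mul_div, div_le_iff₀ (by positivity)] at h2
    rw [inv_pow, ← div_eq_mul_inv, le_div_iff₀ (by positivity)]
    calc r⁻¹ * |heatKernel N 1 (y / r)| * |y| ^ (4 * N + 1)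
        = r⁻¹ * (|y| ^ (4 * N + 1) * |heatKernel N 1 (y / r)|) := by ring
      _ ≤ r⁻¹ * (C * r ^ (4 * N + 1)) := by gcongr
      _ = C * (r ^ (2 * N)) ^ 2 := by
        rw [← pow_mul, pow_succ, show 2 * N * 2 = 4 * N by ring]; field_simp
  have hyinv : |y|⁻¹ ≤ δ⁻¹ := inv_anti₀ hδ hy
  have h3 : |y|⁻¹ ^ (4 * N + 1) ≤ δ⁻¹ ^ (4 * N - 1) * (1 + δ⁻¹ ^ 2) * (1 + y ^ 2)⁻¹ := by
    have h4 : |y|⁻¹ ^ (4 * N + 1) = |y|⁻¹ ^ (4 * N - 1) * (|y|⁻¹ ^ 2) := by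
      rw [← pow_add]; congr 1; omega
    have h5 : |y|⁻¹ ^ 2 ≤ (1 + δ⁻¹ ^ 2) * (1 + y ^ 2)⁻¹ := by
      rw [← div_eq_mul_inv, le_div_iff₀ (by positivity)]
      have h6 : |y|⁻¹ ^ 2 * y ^ 2 = 1 := by
        rw [← sq_abs y, ← mul_pow, inv_mul_cancel₀ hy0.ne', one_pow]
      have h7 : |y|⁻¹ ^ 2 ≤ δ⁻¹ ^ 2 := pow_le_pow_left₀ (by positivity) hyinv 2
      nlinarith
    rw [h4, mul_assoc]
    exact mul_le_mul (pow_le_pow_left₀ (by positivity) hyinv _) h5 (by positivity) (by positivity)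
  calc |heatKernel N h y| ≤ C * h ^ 2 * |y|⁻¹ ^ (4 * N + 1) := h1
    _ ≤ C * h ^ 2 * (δ⁻¹ ^ (4 * N - 1) * (1 + δ⁻¹ ^ 2) * (1 + y ^ 2)⁻¹) := by gcongr
    _ = _ := by ring

end HeatKernel

/-! ### First-step analysis of the exit expectations. -/

section ExitExpectation

/-- The heat operator of order `2N` at time `h`: convolution with the heat kernel. -/
def heatOp (N : ℕ) (h : ℝ) (f : ℝ → ℝ) (x : ℝ) : ℝ := ∫ y, heatKernel N h (x - y) * f y

theorem integrable_heatKernel_sub_mul {N : ℕ} (hN : 0 < N) {h : ℝ} (hh : 0 < h) {f : ℝ → ℝ}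
    (hf : Measurable f) {M : ℝ} (hM : ∀ x, |f x| ≤ M) (x : ℝ) :
    Integrable fun y => heatKernel N h (x - y) * f y := by
  refine (integrable_heatKernel_sub hN hh x).mul_bdd (c := M) hf.aestronglyMeasurable ?_
  exact Eventually.of_forall hM

theorem integral_abs_heatKernel_sub (N : ℕ) (h x : ℝ) :
    ∫ y, |heatKernel N h (x - y)| = ∫ y, |heatKernel N h y| :=
  integral_sub_left_eq_self (fun y => |heatKernel N h y|) volume x

theorem abs_heatOp_le {N : ℕ} (hN : 0 < N) {h : ℝ} (hh : 0 < h) {f : ℝ → ℝ}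
    {M : ℝ} (hM : ∀ x, |f x| ≤ M) (x : ℝ) :
    |heatOp N h f x| ≤ M * ∫ y, |heatKernel N h y| := by
  rw [← integral_abs_heatKernel_sub N h x, ← integral_const_mul, heatOp, ← Real.norm_eq_abs]
  refine norm_integral_le_of_norm_le ((integrable_heatKernel_sub hN hh x).abs.const_mul M)
    (Eventually.of_forall fun y => ?_)
  rw [Real.norm_eq_abs, abs_mul, mul_comm]
  exact mul_le_mul_of_nonneg_right (hM y) (abs_nonneg _)

theorem measurable_heatOp {N : ℕ} (hN : 0 < N) {h : ℝ} (hh : 0 < h) {f : ℝ → ℝ}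
    (hf : Measurable f) : Measurable (heatOp N h f) := by
  refine (StronglyMeasurable.integral_prod_right (f := fun x y => heatKernel N h (x - y) * f y)
    (ν := volume) ?_).measurable
  refine Measurable.stronglyMeasurable ?_
  exact ((continuous_heatKernel hN hh).measurable.comp (measurable_fst.sub measurable_snd)).mul
    (hf.comp measurable_snd)

theorem volume_real_univ_fin_zero : (volume : Measure (Fin 0 → ℝ)).real univ = 1 := by
  rw [measureReal_def, volume_pi, Measure.pi_of_empty, Measure.dirac_apply_of_mem (mem_univ _)]
  rfl

variable {N : ℕ} {a b h : ℝ} {φ : ℝ → ℝ}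

/-- The Markov property at the level of densities: exit at step `m + 1` means starting inside and
exiting at step `m` from the next position. -/
theorem exitIntegrand_succ (x : ℝ) (m : ℕ) (y0 : ℝ) (y : Fin m → ℝ) :
    exitIntegrand N a b h φ x (m + 1) (Fin.cons y0 y) =
      (Ioo a b).indicator 1 x * (heatKernel N h (x - y0) * exitIntegrand N a b h φ y0 m y) := by
  have hiff : ExitsAtLast a b x (Fin.cons y0 y : Fin (m + 1) → ℝ) ↔
      x ∈ Ioo a b ∧ ExitsAtLast a b y0 y := by
    simp only [ExitsAtLast, Fin.forall_fin_succ, path, Fin.castSucc_zero, Fin.cons_zero,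
      ← Fin.succ_castSucc, Fin.cons_succ, ← Fin.succ_last, and_assoc]
  have hden : chainDensity N h x (Fin.cons y0 y : Fin (m + 1) → ℝ) =
      heatKernel N h (x - y0) * chainDensity N h y0 y := by
    simp only [chainDensity, Fin.prod_univ_succ, path, Fin.castSucc_zero, Fin.cons_zero,
      ← Fin.succ_castSucc, Fin.cons_succ]
  have hlast : path x (Fin.cons y0 y : Fin (m + 1) → ℝ) (Fin.last (m + 1)) =
      path y0 y (Fin.last m) := by
    simp only [path, ← Fin.succ_last, Fin.cons_succ]
  unfold exitIntegrand
  rw [hden, hlast]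
  by_cases hx : x ∈ Ioo a b
  · by_cases hy : ExitsAtLast a b y0 y
    · rw [if_pos (hiff.2 ⟨hx, hy⟩), if_pos hy, indicator_of_mem hx, Pi.one_apply]; ring
    · rw [if_neg fun H => hy (hiff.1 H).2, if_neg hy]; ring
  · rw [if_neg fun H => hx (hiff.1 H).1, indicator_of_notMem hx]; ring

theorem measurable_exitIntegrand (hN : 0 < N) (hh : 0 < h) (hφ : Measurable φ) (m : ℕ) :
    Measurable fun p : ℝ × (Fin m → ℝ) => exitIntegrand N a b h φ p.1 m p.2 := by
  have hpath : ∀ j : Fin (m + 1), Measurable fun p : ℝ × (Fin m → ℝ) => path p.1 p.2 j := by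
    intro j
    refine Fin.cases ?_ (fun i => ?_) j
    · simpa only [path, Fin.cons_zero] using measurable_fst
    · simpa only [path, Fin.cons_succ, Function.comp_def] using
        (measurable_pi_apply i).comp measurable_snd
  unfold exitIntegrand
  refine Measurable.ite ?_ ?_ measurable_const
  · refine MeasurableSet.inter (s₁ := {p : ℝ × (Fin m → ℝ) | ∀ j : Fin m,
      path p.1 p.2 j.castSucc ∈ Ioo a b}) ?_ ?_
    · rw [ofPred_forall]
      exact MeasurableSet.iInter fun j => hpath _ measurableSet_Ioo
    · exact (hpath _ measurableSet_Ioo).compl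
  · refine (hφ.comp (hpath _)).mul ?_
    unfold chainDensity
    exact Finset.measurable_prod _ fun j _ =>
      (continuous_heatKernel hN hh).measurable.comp ((hpath _).sub (hpath _))

/-- Each step costs the `L¹` norm of the kernel. That norm may exceed `1` because the kernel is
signed, so this gives absolute convergence of each expectation but not of the series over `m`; the
series requires the `L²` bound of `exists_abs_exitExpectation_le`. -/
theorem integrable_exitIntegrand (hN : 0 < N) (hh : 0 < h) (hφ : Measurable φ) {M : ℝ}
    (hM : ∀ x, |φ x| ≤ M) (m : ℕ) : ∀ x, Integrable (exitIntegrand N a b h φ x m) ∧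
      ∫ y, |exitIntegrand N a b h φ x m y| ≤ M * (∫ y, |heatKernel N h y|) ^ m := by
  have hM0 : 0 ≤ M := (abs_nonneg _).trans (hM 0)
  induction m with
  | zero =>
    intro x
    refine ⟨Integrable.of_finite, ?_⟩
    rw [integral_unique, volume_real_univ_fin_zero, one_smul, pow_zero, mul_one]
    unfold exitIntegrand
    split_ifs
    · simpa [chainDensity] using hM _
    · simpa using hM0
  | succ m ih =>
    intro x
    have hmp := (volume_preserving_piFinSuccAbove (fun _ : Fin (m + 1) => ℝ) 0).symm
    set e := (MeasurableEquiv.piFinSuccAbove (fun _ : Fin (m + 1) => ℝ) 0).symm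
    have he : ∀ p : ℝ × (Fin m → ℝ), exitIntegrand N a b h φ x (m + 1) (e p) =
        (Ioo a b).indicator 1 x *
          (heatKernel N h (x - p.1) * exitIntegrand N a b h φ p.1 m p.2) := by
      intro p
      rw [← exitIntegrand_succ]
      congr 1
      simp [e, MeasurableEquiv.piFinSuccAbove_symm_apply, Fin.insertNthEquiv]
    have hind : |(Ioo a b).indicator (1 : ℝ → ℝ) x| ≤ 1 := by
      by_cases hx : x ∈ Ioo a b <;> simp [hx]
    have hbound : Integrable fun y0 => |heatKernel N h (x - y0)| *
        (M * (∫ y, |heatKernel N h y|) ^ m) :=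
      (integrable_heatKernel_sub hN hh x).abs.mul_const _
    have hmeas : Measurable fun p : ℝ × (Fin m → ℝ) =>
        heatKernel N h (x - p.1) * exitIntegrand N a b h φ p.1 m p.2 :=
      ((continuous_heatKernel hN hh).measurable.comp (measurable_const.sub measurable_fst)).mul
        (measurable_exitIntegrand hN hh hφ m)
    have hnorm : ∀ y0, ∫ y, |heatKernel N h (x - y0) * exitIntegrand N a b h φ y0 m y| =
        |heatKernel N h (x - y0)| * ∫ y, |exitIntegrand N a b h φ y0 m y| := by
      intro y0
      simp_rw [abs_mul]
      rw [integral_const_mul]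
    have hprod : Integrable fun p : ℝ × (Fin m → ℝ) =>
        heatKernel N h (x - p.1) * exitIntegrand N a b h φ p.1 m p.2 := by
      refine (integrable_prod_iff hmeas.aestronglyMeasurable).2 ⟨?_, ?_⟩
      · exact Eventually.of_forall fun y0 => (ih y0).1.const_mul (heatKernel N h (x - y0))
      · refine hbound.mono' ?_ (Eventually.of_forall fun y0 => ?_)
        · exact hmeas.norm.stronglyMeasurable.integral_prod_right'.aestronglyMeasurable
        · simp only [Real.norm_eq_abs]
          rw [hnorm, abs_of_nonneg (by positivity)]
          exact mul_le_mul_of_nonneg_left (ih y0).2 (abs_nonneg _)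
    constructor
    · rw [← hmp.integrable_comp_emb e.measurableEmbedding]
      exact (hprod.const_mul ((Ioo a b).indicator 1 x)).congr
        (Eventually.of_forall fun p => (he p).symm)
    · rw [← hmp.integral_comp e.measurableEmbedding]
      simp_rw [he, abs_mul ((Ioo a b).indicator (1 : ℝ → ℝ) x)]
      rw [integral_const_mul]
      calc _ ≤ 1 * ∫ p : ℝ × (Fin m → ℝ),
              |heatKernel N h (x - p.1) * exitIntegrand N a b h φ p.1 m p.2| :=
            mul_le_mul_of_nonneg_right hind (integral_nonneg fun _ => abs_nonneg _)
        _ = ∫ y0, |heatKernel N h (x - y0)| * ∫ y, |exitIntegrand N a b h φ y0 m y| := by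
            rw [one_mul, Measure.volume_eq_prod, integral_prod _ hprod.abs]
            simp_rw [hnorm]
        _ ≤ ∫ y0, |heatKernel N h (x - y0)| * (M * (∫ y, |heatKernel N h y|) ^ m) := by
            refine integral_mono_of_nonneg (Eventually.of_forall fun y0 => ?_) hbound
              (Eventually.of_forall fun y0 => ?_)
            · positivity
            · exact mul_le_mul_of_nonneg_left (ih y0).2 (abs_nonneg _)
        _ = _ := by
            rw [integral_mul_const, integral_abs_heatKernel_sub]; ring

theorem exitExpectation_zero (x : ℝ) :
    exitExpectation N a b h φ x 0 = (Ioo a b)ᶜ.indicator φ x := by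
  rw [exitExpectation, integral_unique, volume_real_univ_fin_zero, one_smul]
  unfold exitIntegrand
  have : ∀ y : Fin 0 → ℝ, ExitsAtLast a b x y ↔ x ∈ (Ioo a b)ᶜ := fun y => by
    simp [ExitsAtLast, path, Fin.last]
  split_ifs with H
  · rw [indicator_of_mem ((this _).1 H)]
    simp [chainDensity, path, Fin.last]
  · rw [indicator_of_notMem fun hx => H ((this _).2 hx)]

theorem exitExpectation_succ (hN : 0 < N) (hh : 0 < h) (hφ : Measurable φ) {M : ℝ}
    (hM : ∀ x, |φ x| ≤ M) (m : ℕ) (x : ℝ) : exitExpectation N a b h φ x (m + 1) =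
      (Ioo a b).indicator (heatOp N h fun y => exitExpectation N a b h φ y m) x := by
  have hmp := (volume_preserving_piFinSuccAbove (fun _ : Fin (m + 1) => ℝ) 0).symm
  have hint := (integrable_exitIntegrand (a := a) (b := b) hN hh hφ hM (m + 1) x).1
  rw [exitExpectation]
  set e := (MeasurableEquiv.piFinSuccAbove (fun _ : Fin (m + 1) => ℝ) 0).symm
  have he : ∀ p : ℝ × (Fin m → ℝ), exitIntegrand N a b h φ x (m + 1) (e p) =
      (Ioo a b).indicator 1 x *
        (heatKernel N h (x - p.1) * exitIntegrand N a b h φ p.1 m p.2) := by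
    intro p
    rw [← exitIntegrand_succ]
    congr 1
    simp [e, MeasurableEquiv.piFinSuccAbove_symm_apply, Fin.insertNthEquiv]
  rw [← hmp.integrable_comp_emb e.measurableEmbedding] at hint
  rw [← hmp.integral_comp e.measurableEmbedding, Measure.volume_eq_prod,
    integral_prod _ (by exact hint)]
  simp_rw [he, integral_const_mul]
  by_cases hx : x ∈ Ioo a b
  · simp only [indicator_of_mem hx, Pi.one_apply, one_mul]; rfl
  · simp [indicator_of_notMem hx]

theorem measurable_exitExpectation (hN : 0 < N) (hh : 0 < h) (hφ : Measurable φ) (m : ℕ) :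
    Measurable fun x => exitExpectation N a b h φ x m :=
  (measurable_exitIntegrand hN hh hφ m).stronglyMeasurable.integral_prod_right'.measurable

theorem abs_exitExpectation_le (hN : 0 < N) (hh : 0 < h) (hφ : Measurable φ) {M : ℝ}
    (hM : ∀ x, |φ x| ≤ M) (m : ℕ) (x : ℝ) :
    |exitExpectation N a b h φ x m| ≤ M * (∫ y, |heatKernel N h y|) ^ m :=
  (abs_integral_le_integral_abs).trans (integrable_exitIntegrand hN hh hφ hM m x).2

end ExitExpectation

/-! ### Plancherel, the energy defect and `L²` estimates for the heat operator. -/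

section FourierL2

open scoped FourierTransform SchwartzMap ComplexConjugate

/-- Bounded measurable functions on the line that vanish outside a bounded set. -/
structure IsBddSupp (f : ℝ → ℝ) : Prop where
  measurable : Measurable f
  bounded : ∃ M, ∀ x, |f x| ≤ M
  support : ∃ r, ∀ x, r < |x| → f x = 0

namespace IsBddSupp

variable {f k : ℝ → ℝ}

theorem integrable (hf : IsBddSupp f) : Integrable f := by
  obtain ⟨M, hM⟩ := hf.bounded
  obtain ⟨r, hr⟩ := hf.support
  have h1 : IntegrableOn f (Icc (-r) r) :=
    Measure.integrableOn_of_bounded (M := M) measure_Icc_lt_top.ne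
      hf.measurable.aestronglyMeasurable (Eventually.of_forall hM)
  refine (integrableOn_iff_integrable_of_support_subset fun x hx => ?_).1 h1
  by_contra hx'
  refine hx (hr x ?_)
  rwa [mem_Icc, ← abs_le, not_le] at hx'

theorem sub (hf : IsBddSupp f) (hk : IsBddSupp k) : IsBddSupp fun x => f x - k x := by
  obtain ⟨M, hM⟩ := hf.bounded
  obtain ⟨M', hM'⟩ := hk.bounded
  obtain ⟨r, hr⟩ := hf.support
  obtain ⟨r', hr'⟩ := hk.support
  exact ⟨hf.measurable.sub hk.measurable, ⟨M + M', fun x => (abs_sub _ _).trans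
    (add_le_add (hM x) (hM' x))⟩, ⟨max r r', fun x hx => by
      rw [hr x ((le_max_left _ _).trans_lt hx), hr' x ((le_max_right _ _).trans_lt hx), sub_zero]⟩⟩

theorem mul (hf : IsBddSupp f) (hk : IsBddSupp k) : IsBddSupp fun x => f x * k x := by
  obtain ⟨M, hM⟩ := hf.bounded
  obtain ⟨M', hM'⟩ := hk.bounded
  obtain ⟨r, hr⟩ := hf.support
  exact ⟨hf.measurable.mul hk.measurable, ⟨M * M', fun x => by
    rw [abs_mul]
    exact mul_le_mul (hM x) (hM' x) (abs_nonneg _) ((abs_nonneg _).trans (hM x))⟩,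
    ⟨r, fun x hx => by rw [hr x hx, zero_mul]⟩⟩

theorem comp_sub_right (hf : IsBddSupp f) (s : ℝ) : IsBddSupp fun x => f (x - s) := by
  obtain ⟨M, hM⟩ := hf.bounded
  obtain ⟨r, hr⟩ := hf.support
  refine ⟨hf.measurable.comp (measurable_id.sub_const s), ⟨M, fun x => hM _⟩,
    ⟨r + |s|, fun x hx => hr _ ?_⟩⟩
  have := abs_sub_abs_le_abs_sub x s
  linarith

theorem of_indicator_Ioo {a b M : ℝ} {g : ℝ → ℝ} (hg : Measurable g)
    (hM : ∀ x ∈ Ioo a b, |g x| ≤ M) : IsBddSupp ((Ioo a b).indicator g) := by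
  refine ⟨hg.indicator measurableSet_Ioo, ⟨|M|, fun x => ?_⟩, ⟨max |a| |b|, fun x hx => ?_⟩⟩
  · by_cases hx : x ∈ Ioo a b
    · rw [indicator_of_mem hx]; exact (hM x hx).trans (le_abs_self _)
    · rw [indicator_of_notMem hx, abs_zero]; exact abs_nonneg _
  · refine indicator_of_notMem (fun hx' => ?_) _
    have h1 := abs_le_max_abs_abs hx'.1.le hx'.2.le
    exact absurd h1 (not_le.2 hx)

theorem of_indicator_Icc {a b : ℝ} {g : ℝ → ℝ} (hg : Continuous g) :
    IsBddSupp ((Icc a b).indicator g) := by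
  obtain ⟨M, hM⟩ := isCompact_Icc.exists_bound_of_continuousOn (hg.continuousOn (s := Icc a b))
  refine ⟨hg.measurable.indicator measurableSet_Icc, ⟨|M|, fun x => ?_⟩,
    ⟨max |a| |b|, fun x hx => ?_⟩⟩
  · by_cases hx : x ∈ Icc a b
    · rw [indicator_of_mem hx]; exact (hM x hx).trans (le_abs_self _)
    · rw [indicator_of_notMem hx, abs_zero]; exact abs_nonneg _
  · refine indicator_of_notMem (fun hx' => ?_) _
    have h1 := abs_le_max_abs_abs hx'.1 hx'.2
    exact absurd h1 (not_le.2 hx)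

end IsBddSupp

/-- The Fourier transform of a real function. -/
def realFourier (f : ℝ → ℝ) : ℝ → ℂ := 𝓕 (fun x => (f x : ℂ))

theorem realFourier_eq (f : ℝ → ℝ) (ξ : ℝ) :
    realFourier f ξ = ∫ x, Complex.exp (((-2 * Real.pi * x * ξ : ℝ) : ℂ) * Complex.I) * f x := by
  rw [realFourier, Real.fourier_real_eq_integral_exp_smul]; rfl

theorem integrable_exp_mul {F : ℝ → ℂ} (hF : Integrable F) (c : ℝ) :
    Integrable fun x : ℝ => Complex.exp (((c * x : ℝ) : ℂ) * Complex.I) * F x := by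
  refine hF.bdd_mul (c := 1) ?_ ?_
  · exact (by fun_prop : Continuous fun x : ℝ =>
      Complex.exp (((c * x : ℝ) : ℂ) * Complex.I)).aestronglyMeasurable
  · exact Eventually.of_forall fun ξ => by rw [Complex.norm_exp_ofReal_mul_I]

theorem integral_fourier_mul {F G : ℝ → ℂ} (hF : Integrable F) (hG : Integrable G) :
    ∫ ξ, 𝓕 F ξ * G ξ = ∫ x, F x * 𝓕 G x := by
  simpa using! VectorFourier.integral_fourierIntegral_smul_eq_flip (L := innerₗ ℝ)
    Real.continuous_fourierChar continuous_inner hF hG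

theorem continuous_realFourier {f : ℝ → ℝ} (hf : Integrable f) : Continuous (realFourier f) :=
  VectorFourier.fourierIntegral_continuous Real.continuous_fourierChar
    (by exact continuous_inner) hf.ofReal

theorem norm_realFourier_le {f : ℝ → ℝ} (ξ : ℝ) : ‖realFourier f ξ‖ ≤ ∫ x, |f x| := by
  rw [realFourier_eq]
  refine (norm_integral_le_integral_norm _).trans (le_of_eq ?_)
  congr 1
  ext x
  rw [norm_mul, Complex.norm_exp_ofReal_mul_I, one_mul, Complex.norm_real, Real.norm_eq_abs]

variable {f k : ℝ → ℝ}

theorem IsBddSupp.memLp (hf : IsBddSupp f) : MemLp (fun x => (f x : ℂ)) 2 := by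
  refine (memLp_two_iff_integrable_sq_norm hf.integrable.ofReal.aestronglyMeasurable).2 ?_
  refine (hf.mul hf).integrable.congr (Eventually.of_forall fun x => ?_)
  simp only [Complex.norm_real, Real.norm_eq_abs, sq_abs]
  ring

/-- The `L²` Fourier transform and the Fourier integral have the same pairing with every smooth
compactly supported function, by the multiplication formula. This makes Plancherel available for the
explicit integral. -/
theorem fourier_toLp_ae_eq (hf : IsBddSupp f) :
    (𝓕 (hf.memLp.toLp) : Lp ℂ 2 (volume : Measure ℝ)) =ᵐ[volume] realFourier f := by
  refine ae_eq_of_integral_contDiff_smul_eq ?_ ?_ fun g hg hgc => ?_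
  · exact (Lp.memLp _).locallyIntegrable (by norm_num)
  · exact (continuous_realFourier hf.integrable).locallyIntegrable
  have hg₁ : HasCompactSupport (Complex.ofRealCLM ∘ g) := hgc.comp_left rfl
  have hg₂ : ContDiff ℝ ∞ (Complex.ofRealCLM ∘ g) := by fun_prop
  set G : 𝓢(ℝ, ℂ) := hg₁.toSchwartzMap hg₂ with hG
  have hGx : ∀ x, G x = (g x : ℂ) := fun x => rfl
  have h1 := congrArg (fun T => T G) (Lp.fourier_toTemperedDistribution_eq hf.memLp.toLp)
  simp only [TemperedDistribution.fourier_apply, Lp.toTemperedDistribution_apply] at h1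
  have h2 : ∫ x, (𝓕 G) x • (hf.memLp.toLp : Lp ℂ 2 (volume : Measure ℝ)) x =
      ∫ x, (𝓕 (G : ℝ → ℂ)) x * (f x : ℂ) := by
    refine integral_congr_ae ?_
    filter_upwards [hf.memLp.coeFn_toLp] with x hx
    rw [hx, smul_eq_mul, SchwartzMap.fourier_coe]
  rw [h2, integral_fourier_mul (G := fun x => (f x : ℂ)) (G.integrable (μ := volume))
    hf.integrable.ofReal] at h1
  simp only [Complex.real_smul, ← hGx, ← smul_eq_mul]
  rw [← h1]; rfl

theorem memLp_realFourier (hf : IsBddSupp f) : MemLp (realFourier f) 2 :=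
  (memLp_congr_ae (fourier_toLp_ae_eq hf)).1 (Lp.memLp _)

theorem integrable_sq_realFourier (hf : IsBddSupp f) :
    Integrable fun ξ => ‖realFourier f ξ‖ ^ 2 :=
  (memLp_two_iff_integrable_sq_norm
    (continuous_realFourier hf.integrable).aestronglyMeasurable).1 (memLp_realFourier hf)

theorem integrable_realFourier_mul_conj (hf : IsBddSupp f) (hk : IsBddSupp k) :
    Integrable fun ξ => realFourier f ξ * conj (realFourier k ξ) := by
  refine ((integrable_sq_realFourier hf).add (integrable_sq_realFourier hk)).mono' ?_
    (Eventually.of_forall fun ξ => ?_)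
  · exact ((continuous_realFourier hf.integrable).mul (Complex.continuous_conj.comp
      (continuous_realFourier hk.integrable))).aestronglyMeasurable
  · rw [norm_mul, RCLike.norm_conj, Pi.add_apply]
    nlinarith [sq_nonneg (‖realFourier f ξ‖ - ‖realFourier k ξ‖), sq_nonneg ‖realFourier f ξ‖,
      sq_nonneg ‖realFourier k ξ‖]

theorem integral_mul_eq_realFourier (hf : IsBddSupp f) (hk : IsBddSupp k) :
    ((∫ x, f x * k x : ℝ) : ℂ) = ∫ ξ, realFourier f ξ * conj (realFourier k ξ) := by
  have h := Lp.inner_fourier_eq (hk.memLp.toLp) (hf.memLp.toLp)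
  rw [L2.inner_def, L2.inner_def] at h
  have h1 : ∫ x, inner ℂ ((hk.memLp.toLp : Lp ℂ 2 (volume : Measure ℝ)) x)
      ((hf.memLp.toLp : Lp ℂ 2 (volume : Measure ℝ)) x) = ((∫ x, f x * k x : ℝ) : ℂ) := by
    rw [← integral_complex_ofReal]
    refine integral_congr_ae ?_
    filter_upwards [hf.memLp.coeFn_toLp, hk.memLp.coeFn_toLp] with x hx hx'
    rw [hx, hx', RCLike.inner_apply, Complex.conj_ofReal]
    push_cast; rfl
  rw [← h1, ← h]
  refine integral_congr_ae ?_
  filter_upwards [fourier_toLp_ae_eq hf, fourier_toLp_ae_eq hk] with x hx hx'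
  rw [hx, hx', RCLike.inner_apply]

theorem integral_sq_eq_realFourier (hf : IsBddSupp f) :
    ∫ x, f x ^ 2 = ∫ ξ, ‖realFourier f ξ‖ ^ 2 := by
  have h := integral_mul_eq_realFourier hf hf
  simp only [Complex.mul_conj, Complex.normSq_eq_norm_sq] at h
  rw [integral_complex_ofReal] at h
  simpa only [sq] using Complex.ofReal_injective h

variable {N : ℕ} {h : ℝ}

theorem integrable_heatSymbol_mul_realFourier (hN : 0 < N) (hh : 0 < h) (hf : IsBddSupp f) :
    Integrable fun ξ => (heatSymbol N h ξ : ℂ) * realFourier f ξ :=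
  (integrable_ofReal_heatSymbol hN hh).mul_bdd
    (continuous_realFourier hf.integrable).aestronglyMeasurable
    (Eventually.of_forall norm_realFourier_le)

theorem heatOp_eq_realFourier (hN : 0 < N) (hh : 0 < h) (hf : IsBddSupp f) (x : ℝ) :
    (heatOp N h f x : ℂ) = ∫ ξ : ℝ, Complex.exp (((2 * Real.pi * x * ξ : ℝ) : ℂ) * Complex.I) *
      ((heatSymbol N h ξ : ℂ) * realFourier f ξ) := by
  have h1 := integral_fourier_mul (G := fun x => (f x : ℂ))
    (integrable_exp_mul (integrable_ofReal_heatSymbol hN hh) (2 * Real.pi * x))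
    hf.integrable.ofReal
  simp only [mul_assoc] at h1 ⊢
  rw [realFourier, ← h1, heatOp, ← integral_complex_ofReal]
  congr 1
  ext y
  rw [Complex.ofReal_mul, heatKernel_eq_integral hN hh, Real.fourier_real_eq_integral_exp_smul]
  congr 1
  refine integral_congr_ae (Eventually.of_forall fun ξ => ?_)
  simp only [smul_eq_mul]
  rw [← mul_assoc, ← Complex.exp_add]
  congr 2
  push_cast; ring

theorem abs_heatOp_le_integral (hN : 0 < N) (hh : 0 < h) (hf : IsBddSupp f) (x : ℝ) :
    |heatOp N h f x| ≤ ∫ ξ, heatSymbol N h ξ * ‖realFourier f ξ‖ := by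
  rw [← Real.norm_eq_abs, ← Complex.norm_real, heatOp_eq_realFourier hN hh hf]
  refine (norm_integral_le_integral_norm _).trans (le_of_eq ?_)
  congr 1
  ext ξ
  rw [norm_mul, Complex.norm_exp_ofReal_mul_I, one_mul, norm_mul, Complex.norm_real,
    Real.norm_eq_abs, abs_of_pos (heatSymbol_pos _ _ _)]

theorem integral_heatOp_mul (hN : 0 < N) (hh : 0 < h) (hf : IsBddSupp f) (hk : IsBddSupp k) :
    ((∫ x, heatOp N h f x * k x : ℝ) : ℂ) =
      ∫ ξ, (heatSymbol N h ξ : ℂ) * (realFourier f ξ * conj (realFourier k ξ)) := by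
  -- The conjugate of the transform of the real function `k` is the transform of its reflection, so
  -- the multiplication formula applies to the reflection.
  have hk' : Integrable fun x => (k (-x) : ℂ) := hk.integrable.comp_neg.ofReal
  have h1 := integral_fourier_mul (integrable_heatSymbol_mul_realFourier hN hh hf) hk'
  have h2 : ∀ ξ, 𝓕 (fun x => (k (-x) : ℂ)) ξ = conj (realFourier k ξ) := by
    intro ξ
    rw [realFourier_eq, ← integral_conj, ← integral_neg_eq_self,
      Real.fourier_real_eq_integral_exp_smul]
    refine integral_congr_ae (Eventually.of_forall fun y => ?_)
    simp only [map_mul, ← Complex.exp_conj, Complex.conj_ofReal, Complex.conj_I, smul_eq_mul]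
    congr 2
    push_cast; ring
  simp only [h2, mul_assoc] at h1
  rw [← h1, ← integral_complex_ofReal, ← integral_neg_eq_self]
  refine integral_congr_ae (Eventually.of_forall fun x => ?_)
  simp only
  rw [Complex.ofReal_mul, heatOp_eq_realFourier hN hh hf, Real.fourier_real_eq_integral_exp_smul]
  congr 1
  refine integral_congr_ae (Eventually.of_forall fun ξ => ?_)
  simp only [smul_eq_mul]
  congr 4; ring

/-- The energy lost by `f` under the heat semigroup up to time `h`. -/
def heatDefect (N : ℕ) (h : ℝ) (f : ℝ → ℝ) : ℝ :=
  ∫ ξ, (1 - heatSymbol N h ξ) * ‖realFourier f ξ‖ ^ 2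

theorem abs_one_sub_heatSymbol_le (hh : 0 ≤ h) (ξ : ℝ) : |1 - heatSymbol N h ξ| ≤ 1 := by
  rw [abs_le]
  constructor <;> linarith [heatSymbol_pos N h ξ, heatSymbol_le_one (N := N) hh ξ]

theorem integrable_heatDefect (hh : 0 ≤ h) (hf : IsBddSupp f) :
    Integrable fun ξ => (1 - heatSymbol N h ξ) * ‖realFourier f ξ‖ ^ 2 :=
  (integrable_sq_realFourier hf).bdd_mul (c := 1)
    (continuous_const.sub (continuous_heatSymbol N h)).aestronglyMeasurable
    (Eventually.of_forall fun ξ => abs_one_sub_heatSymbol_le hh ξ)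

theorem heatDefect_nonneg (hh : 0 ≤ h) (f : ℝ → ℝ) : 0 ≤ heatDefect N h f :=
  integral_nonneg fun ξ => mul_nonneg (sub_nonneg.2 (heatSymbol_le_one hh ξ)) (sq_nonneg _)

theorem integral_mul_sub_integral_heatOp_mul (hN : 0 < N) (hh : 0 < h) (hf : IsBddSupp f)
    (hk : IsBddSupp k) : ((∫ x, f x * k x) - ∫ x, heatOp N h f x * k x : ℝ) =
      ∫ ξ, ((1 - heatSymbol N h ξ : ℝ) : ℂ) * (realFourier f ξ * conj (realFourier k ξ)) := by
  have hint := integrable_realFourier_mul_conj hf hk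
  have hint2 : Integrable fun ξ => (heatSymbol N h ξ : ℂ) *
      (realFourier f ξ * conj (realFourier k ξ)) := by
    refine hint.bdd_mul (c := 1) (Complex.continuous_ofReal.comp
      (continuous_heatSymbol N h)).aestronglyMeasurable (Eventually.of_forall fun ξ => ?_)
    rw [Complex.norm_real, Real.norm_eq_abs, abs_of_pos (heatSymbol_pos _ _ _)]
    exact heatSymbol_le_one hh.le ξ
  rw [Complex.ofReal_sub, integral_mul_eq_realFourier hf hk, integral_heatOp_mul hN hh hf hk,
    ← integral_sub hint hint2]
  congr 1
  ext ξ
  push_cast; ring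

theorem integral_heatOp_mul_self (hN : 0 < N) (hh : 0 < h) (hf : IsBddSupp f) :
    ∫ x, heatOp N h f x * f x = (∫ x, f x ^ 2) - heatDefect N h f := by
  have h1 := integral_mul_sub_integral_heatOp_mul hN hh hf hf
  simp only [Complex.mul_conj, Complex.normSq_eq_norm_sq, ← Complex.ofReal_mul] at h1
  rw [integral_complex_ofReal] at h1
  have h2 := Complex.ofReal_injective h1
  simp only [sq (f _)]
  rw [heatDefect]; linarith

/-- The form `⟨(1 - T_h) f, k⟩` has a nonnegative symbol, so `xy ≤ x² + y²/4` applies frequency by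
frequency. The small weight on `k` is what later allows its defect to be absorbed. -/
theorem abs_integral_mul_sub_integral_heatOp_mul_le (hN : 0 < N) (hh : 0 < h) (hf : IsBddSupp f)
    (hk : IsBddSupp k) : |(∫ x, f x * k x) - ∫ x, heatOp N h f x * k x| ≤
      heatDefect N h f + heatDefect N h k / 4 := by
  rw [← Real.norm_eq_abs, ← Complex.norm_real, integral_mul_sub_integral_heatOp_mul hN hh hf hk,
    heatDefect, heatDefect, ← integral_div, ← integral_add (integrable_heatDefect hh.le hf)
      ((integrable_heatDefect hh.le hk).div_const 4)]
  refine norm_integral_le_of_norm_le ((integrable_heatDefect hh.le hf).add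
    ((integrable_heatDefect hh.le hk).div_const 4)) (Eventually.of_forall fun ξ => ?_)
  have h1 : 0 ≤ 1 - heatSymbol N h ξ := sub_nonneg.2 (heatSymbol_le_one hh.le ξ)
  rw [norm_mul, norm_mul, RCLike.norm_conj, Complex.norm_real, Real.norm_eq_abs, abs_of_nonneg h1]
  nlinarith [mul_nonneg h1 (sq_nonneg (‖realFourier f ξ‖ - ‖realFourier k ξ‖ / 2))]

/-- The symbol lies in `(0,1]`, so a heat step contracts `L²`, and so does truncation to the
interval. This is the stability of the killed walk. -/
theorem integral_indicator_heatOp_sq_le (hN : 0 < N) (hh : 0 < h) (hf : IsBddSupp f) (a b : ℝ) :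
    ∫ x, (Ioo a b).indicator (heatOp N h f) x ^ 2 ≤ ∫ x, f x ^ 2 := by
  obtain ⟨M, hM⟩ := hf.bounded
  have hk : IsBddSupp ((Ioo a b).indicator (heatOp N h f)) :=
    .of_indicator_Ioo (measurable_heatOp hN hh hf.measurable) fun x _ => abs_heatOp_le hN hh hM x
  set k := (Ioo a b).indicator (heatOp N h f) with hkdef
  have h1 : ∫ x, k x ^ 2 = ∫ x, heatOp N h f x * k x := by
    congr 1
    ext x
    by_cases hx : x ∈ Ioo a b
    · rw [hkdef, indicator_of_mem hx, sq]
    · rw [hkdef, indicator_of_notMem hx]; ring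
  have h2 := integral_heatOp_mul hN hh hf hk
  have h3 : |∫ x, heatOp N h f x * k x| ≤ ((∫ x, f x ^ 2) + ∫ x, k x ^ 2) / 2 := by
    rw [← Real.norm_eq_abs, ← Complex.norm_real, h2, integral_sq_eq_realFourier hf,
      integral_sq_eq_realFourier hk, ← integral_add (integrable_sq_realFourier hf)
      (integrable_sq_realFourier hk), ← integral_div]
    refine norm_integral_le_of_norm_le (((integrable_sq_realFourier hf).add
      (integrable_sq_realFourier hk)).div_const 2) (Eventually.of_forall fun ξ => ?_)
    rw [norm_mul, norm_mul, RCLike.norm_conj, Complex.norm_real, Real.norm_eq_abs,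
      abs_of_pos (heatSymbol_pos _ _ _)]
    have h4 := heatSymbol_le_one (N := N) hh.le ξ
    have h5 : heatSymbol N h ξ * (‖realFourier f ξ‖ * ‖realFourier k ξ‖) ≤
        ‖realFourier f ξ‖ * ‖realFourier k ξ‖ := mul_le_of_le_one_left (by positivity) h4
    nlinarith [sq_nonneg (‖realFourier f ξ‖ - ‖realFourier k ξ‖)]
  have h6 := le_abs_self (∫ x, heatOp N h f x * k x)
  linarith

theorem integrable_heatSymbol_sq (hN : 0 < N) (hh : 0 < h) :
    Integrable fun ξ => heatSymbol N h ξ ^ 2 := by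
  refine (integrable_heatSymbol hN hh).mono'
    ((continuous_heatSymbol N h).pow 2).aestronglyMeasurable (Eventually.of_forall fun ξ => ?_)
  rw [Real.norm_eq_abs, abs_of_nonneg (sq_nonneg _)]
  nlinarith [heatSymbol_pos N h ξ, heatSymbol_le_one (N := N) hh.le ξ]

theorem abs_heatOp_le_integral_sq (hN : 0 < N) (hh : 0 < h) (hf : IsBddSupp f) (x : ℝ) :
    |heatOp N h f x| ≤ ((∫ ξ, heatSymbol N h ξ ^ 2) + ∫ y, f y ^ 2) / 2 := by
  refine (abs_heatOp_le_integral hN hh hf x).trans ?_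
  rw [integral_sq_eq_realFourier hf, ← integral_add (integrable_heatSymbol_sq hN hh)
    (integrable_sq_realFourier hf), ← integral_div]
  refine integral_mono_of_nonneg (Eventually.of_forall fun ξ => ?_)
    (((integrable_heatSymbol_sq hN hh).add (integrable_sq_realFourier hf)).div_const 2)
    (Eventually.of_forall fun ξ => ?_)
  · exact mul_nonneg (heatSymbol_pos _ _ _).le (norm_nonneg _)
  · simp only
    nlinarith [sq_nonneg (heatSymbol N h ξ - ‖realFourier f ξ‖)]

/-- Put `y = (2πξ)^{2N}`. Then `ξ² ≤ 1 + y`, and `e^{hy} ≥ 1 + hy` gives `y e^{-hy} ≤ (1 -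
e^{-hy})/h`: one weighted derivative of `T_h f` costs only the defect per unit time. -/
theorem one_add_sq_mul_heatSymbol_sq_le (hN : 0 < N) (hh : 0 < h) (ξ : ℝ) :
    (1 + ξ ^ 2) * heatSymbol N h ξ ^ 2 ≤ 2 + (1 - heatSymbol N h ξ) / h := by
  set y := (2 * Real.pi * ξ) ^ (2 * N) with hy
  have hy0 : 0 ≤ y := two_pi_mul_pow_nonneg N ξ
  have hg := heatSymbol_pos N h ξ
  have hg1 := heatSymbol_le_one (N := N) hh.le ξ
  have h1 : ξ ^ 2 ≤ 1 + y := by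
    have h2 : ξ ^ 2 ≤ (2 * Real.pi * ξ) ^ 2 := by
      have := Real.pi_gt_three
      rw [mul_pow]
      nlinarith [mul_nonneg (by nlinarith : 0 ≤ (2 * Real.pi) ^ 2 - 1) (sq_nonneg ξ)]
    rw [hy, pow_mul]
    rcases le_total ((2 * Real.pi * ξ) ^ 2) 1 with h3 | h3
    · have : 0 ≤ ((2 * Real.pi * ξ) ^ 2) ^ N := by positivity
      linarith
    · have := le_self_pow₀ h3 hN.ne'
      linarith
  have h2 : y * heatSymbol N h ξ ≤ (1 - heatSymbol N h ξ) / h := by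
    rw [le_div_iff₀ hh]
    have h3 := Real.add_one_le_exp (h * y)
    have h4 : heatSymbol N h ξ * Real.exp (h * y) = 1 := by
      rw [heatSymbol, ← Real.exp_add, ← hy]; simp
    nlinarith
  calc (1 + ξ ^ 2) * heatSymbol N h ξ ^ 2 ≤ (2 + y) * heatSymbol N h ξ ^ 2 :=
        mul_le_mul_of_nonneg_right (by linarith) (sq_nonneg _)
    _ ≤ (2 + y) * heatSymbol N h ξ := by
        gcongr; rw [sq]; exact mul_le_of_le_one_left hg.le hg1
    _ ≤ _ := by nlinarith

/-- A Sobolev embedding uniform in `h`: the Fourier integral of `T_h f` is split by weighted AM–GM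
between the integrable weight `(1+ξ²)⁻¹` and the energy. The free parameter `r` balances the two. -/
theorem abs_heatOp_le_of_energy (hN : 0 < N) (hh : 0 < h) (hf : IsBddSupp f) {r : ℝ} (hr : 0 < r)
    (x : ℝ) : |heatOp N h f x| ≤
      (r * Real.pi + r⁻¹ * (2 * (∫ y, f y ^ 2) + heatDefect N h f / h)) / 2 := by
  refine (abs_heatOp_le_integral hN hh hf x).trans ?_
  have i1 : Integrable fun ξ : ℝ => r * (1 + ξ ^ 2)⁻¹ := integrable_inv_one_add_sq.const_mul r
  have i2 := (integrable_sq_realFourier hf).const_mul 2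
  have i3 := (integrable_heatDefect (N := N) hh.le hf).div_const h
  have i4 : Integrable fun ξ => r⁻¹ * (2 * ‖realFourier f ξ‖ ^ 2 +
      (1 - heatSymbol N h ξ) * ‖realFourier f ξ‖ ^ 2 / h) := (i2.add i3).const_mul r⁻¹
  rw [integral_sq_eq_realFourier hf, ← integral_univ_inv_one_add_sq, heatDefect, ← integral_div,
    ← integral_const_mul 2, ← integral_const_mul r, ← integral_add i2 i3,
    ← integral_const_mul r⁻¹, ← integral_add i1 i4, ← integral_div]
  refine integral_mono_of_nonneg (Eventually.of_forall fun ξ => ?_)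
    ((i1.add i4).div_const 2) (Eventually.of_forall fun ξ => ?_)
  · exact mul_nonneg (heatSymbol_pos _ _ _).le (norm_nonneg _)
  · simp only
    set F := ‖realFourier f ξ‖
    set g := heatSymbol N h ξ
    have hp : 0 < 1 + ξ ^ 2 := by positivity
    have h1 := mul_le_mul_of_nonneg_right (one_add_sq_mul_heatSymbol_sq_le hN hh ξ) (sq_nonneg F)
    have h2 : g * F ≤ (r * (1 + ξ ^ 2)⁻¹ + r⁻¹ * ((1 + ξ ^ 2) * g ^ 2 * F ^ 2)) / 2 := by
      have h3 : r * (1 + ξ ^ 2)⁻¹ + r⁻¹ * ((1 + ξ ^ 2) * g ^ 2 * F ^ 2) - 2 * (g * F) =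
          r * (1 + ξ ^ 2)⁻¹ * (1 - r⁻¹ * (1 + ξ ^ 2) * (g * F)) ^ 2 := by
        field_simp; ring
      have h4 : 0 ≤ r * (1 + ξ ^ 2)⁻¹ * (1 - r⁻¹ * (1 + ξ ^ 2) * (g * F)) ^ 2 := by positivity
      linarith
    have h5 : r⁻¹ * ((1 + ξ ^ 2) * g ^ 2 * F ^ 2) ≤ r⁻¹ * ((2 + (1 - g) / h) * F ^ 2) :=
      mul_le_mul_of_nonneg_left h1 (by positivity)
    have h6 : (2 + (1 - g) / h) * F ^ 2 = 2 * F ^ 2 + (1 - g) * F ^ 2 / h := by ring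
    rw [h6] at h5
    linarith

end FourierL2

/-! ### Summation over the exit step and the discrete equation. -/

section KilledValue

variable {N : ℕ} {a b h q : ℝ} {φ : ℝ → ℝ}

theorem isBddSupp_exitExpectation_succ (hN : 0 < N) (hh : 0 < h) (hφ : Measurable φ) {M : ℝ}
    (hM : ∀ x, |φ x| ≤ M) (m : ℕ) :
    IsBddSupp fun x => exitExpectation N a b h φ x (m + 1) := by
  rw [funext fun x => exitExpectation_succ hN hh hφ hM m x]
  exact .of_indicator_Ioo (measurable_heatOp hN hh (measurable_exitExpectation hN hh hφ m))
    fun x _ => abs_heatOp_le hN hh (abs_exitExpectation_le hN hh hφ hM m) x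

/-- From step `1` on, the expectations vanish off `(a,b)` and their `L²` norms do not increase; one
further heat step turns the `L²` bound into a uniform one. Steps `0` and `1` are treated apart,
since `φ` need not be square integrable. -/
theorem exists_abs_exitExpectation_le (hN : 0 < N) (hh : 0 < h) (hφ : Measurable φ) {M : ℝ}
    (hM : ∀ x, |φ x| ≤ M) : ∃ C, ∀ m x, |exitExpectation N a b h φ x m| ≤ C := by
  set E := ∫ x, exitExpectation N a b h φ x 1 ^ 2 with hE
  set C := ((∫ ξ, heatSymbol N h ξ ^ 2) + E) / 2 with hC
  have hE0 : 0 ≤ E := integral_nonneg fun x => sq_nonneg _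
  have hC0 : 0 ≤ C :=
    div_nonneg (add_nonneg (integral_nonneg fun ξ => sq_nonneg _) hE0) zero_le_two
  have hsq : ∀ m, ∫ x, exitExpectation N a b h φ x (m + 1) ^ 2 ≤ E := by
    intro m
    induction m with
    | zero => exact le_rfl
    | succ m ih =>
      refine le_trans ?_ ih
      simp_rw [exitExpectation_succ hN hh hφ hM (m + 1)]
      exact integral_indicator_heatOp_sq_le hN hh
        (isBddSupp_exitExpectation_succ hN hh hφ hM m) a b
  refine ⟨max C (max (M * (∫ y, |heatKernel N h y|) ^ 0) (M * (∫ y, |heatKernel N h y|) ^ 1)),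
    fun m x => ?_⟩
  match m with
  | 0 =>
    exact (abs_exitExpectation_le hN hh hφ hM 0 x).trans
      ((le_max_left _ _).trans (le_max_right _ _))
  | 1 =>
    exact (abs_exitExpectation_le hN hh hφ hM 1 x).trans
      ((le_max_right _ _).trans (le_max_right _ _))
  | m + 2 =>
    refine le_trans ?_ (le_max_left _ _)
    rw [exitExpectation_succ hN hh hφ hM]
    by_cases hx : x ∈ Ioo a b
    · rw [indicator_of_mem hx]
      refine (abs_heatOp_le_integral_sq hN hh
        (isBddSupp_exitExpectation_succ hN hh hφ hM m) x).trans ?_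
      rw [hC]; linarith [hsq m]
    · rw [indicator_of_notMem hx, abs_zero]; exact hC0

theorem summable_exitExpectation (hN : 0 < N) (hh : 0 < h) (hφ : Measurable φ) {M : ℝ}
    (hM : ∀ x, |φ x| ≤ M) (hq : 0 < q) (hq1 : q < 1) (x : ℝ) :
    Summable fun m => q ^ m * exitExpectation N a b h φ x m := by
  obtain ⟨C, hC⟩ := exists_abs_exitExpectation_le (a := a) (b := b) hN hh hφ hM
  refine Summable.of_norm_bounded ((summable_geometric_of_lt_one hq.le hq1).mul_right C)
    fun m => ?_
  rw [norm_mul, norm_pow, Real.norm_eq_abs, abs_of_pos hq]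
  exact mul_le_mul_of_nonneg_left (hC m x) (by positivity)

/-- The value of the payoff `φ` at the exit from `(a,b)` of the walk with steps of duration `h`,
discounted by the factor `q` at every step. -/
def exitValue (N : ℕ) (a b h q : ℝ) (φ : ℝ → ℝ) (x : ℝ) : ℝ :=
  ∑' m, q ^ m * exitExpectation N a b h φ x m

theorem exitValue_of_notMem (hN : 0 < N) (hh : 0 < h) (hφ : Measurable φ) {M : ℝ}
    (hM : ∀ x, |φ x| ≤ M) {x : ℝ} (hx : x ∉ Ioo a b) : exitValue N a b h q φ x = φ x := by
  rw [exitValue, tsum_eq_single 0]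
  · rw [exitExpectation_zero, indicator_of_mem hx]; simp
  · intro m hm
    obtain ⟨m, rfl⟩ := Nat.exists_eq_succ_of_ne_zero hm
    rw [exitExpectation_succ hN hh hφ hM, indicator_of_notMem hx, mul_zero]

theorem exists_abs_exitValue_le (hN : 0 < N) (hh : 0 < h) (hφ : Measurable φ) {M : ℝ}
    (hM : ∀ x, |φ x| ≤ M) (hq : 0 < q) (hq1 : q < 1) :
    ∃ C, ∀ x, |exitValue N a b h q φ x| ≤ C := by
  obtain ⟨C, hC⟩ := exists_abs_exitExpectation_le (a := a) (b := b) hN hh hφ hM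
  refine ⟨(1 - q)⁻¹ * C, fun x => tsum_of_norm_bounded (E := ℝ)
    ((hasSum_geometric_of_lt_one hq.le hq1).mul_right C) fun m => ?_⟩
  rw [norm_mul, norm_pow, Real.norm_eq_abs, abs_of_pos hq]
  exact mul_le_mul_of_nonneg_left (hC m x) (by positivity)

theorem measurable_exitValue (hN : 0 < N) (hh : 0 < h) (hφ : Measurable φ) {M : ℝ}
    (hM : ∀ x, |φ x| ≤ M) (hq : 0 < q) (hq1 : q < 1) : Measurable (exitValue N a b h q φ) := by
  refine measurable_of_tendsto_metrizable (f := fun n x => ∑ m ∈ Finset.range n,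
    q ^ m * exitExpectation N a b h φ x m) (fun n => ?_) (tendsto_pi_nhds.2 fun x => ?_)
  · exact Finset.measurable_fun_sum _ fun m _ =>
      (measurable_exitExpectation hN hh hφ m).const_mul _
  · exact (summable_exitExpectation hN hh hφ hM hq hq1 x).hasSum.tendsto_sum_nat

theorem exitValue_of_mem (hN : 0 < N) (hh : 0 < h) (hφ : Measurable φ) {M : ℝ}
    (hM : ∀ x, |φ x| ≤ M) (hq : 0 < q) (hq1 : q < 1) {x : ℝ} (hx : x ∈ Ioo a b) :
    exitValue N a b h q φ x = q * heatOp N h (exitValue N a b h q φ) x := by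
  obtain ⟨C, hC⟩ := exists_abs_exitExpectation_le (a := a) (b := b) hN hh hφ hM
  have hint : ∀ m, Integrable fun y =>
      heatKernel N h (x - y) * (q ^ m * exitExpectation N a b h φ y m) := fun m => by
    have := (integrable_heatKernel_sub_mul hN hh (measurable_exitExpectation (a := a) (b := b)
      hN hh hφ m) (hC m) x).const_mul (q ^ m)
    exact this.congr (Eventually.of_forall fun y => by simp only; ring)
  have hsum : Summable fun m => ∫ y,
      ‖heatKernel N h (x - y) * (q ^ m * exitExpectation N a b h φ y m)‖ := by
    refine Summable.of_nonneg_of_le (fun m => integral_nonneg fun y => norm_nonneg _)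
      (fun m => ?_) ((summable_geometric_of_lt_one hq.le hq1).mul_right
        (C * ∫ y, |heatKernel N h (x - y)|))
    rw [← mul_assoc, ← integral_const_mul]
    refine integral_mono (hint m).norm
      ((integrable_heatKernel_sub hN hh x).abs.const_mul _) fun y => ?_
    simp only [norm_mul, norm_pow, Real.norm_eq_abs, abs_of_pos hq]
    rw [mul_comm]
    exact mul_le_mul_of_nonneg_right (mul_le_mul_of_nonneg_left (hC m y) (by positivity))
      (abs_nonneg _)
  have h1 := hasSum_integral_of_summable_integral_norm hint hsum
  simp_rw [tsum_mul_left] at h1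
  rw [exitValue, (summable_exitExpectation hN hh hφ hM hq hq1 x).tsum_eq_zero_add,
    exitExpectation_zero, indicator_of_notMem (not_not.2 hx), mul_zero, zero_add, heatOp]
  simp only [exitValue]
  rw [← h1.tsum_eq, ← tsum_mul_left]
  congr 1
  ext m
  rw [exitExpectation_succ hN hh hφ hM, indicator_of_mem hx, heatOp, ← integral_const_mul,
    ← integral_const_mul]
  congr 1
  ext y
  ring

end KilledValue

/-! ### Consistency of a heat step with the differential operator. -/

section Consistency

open scoped FourierTransform SchwartzMap ComplexConjugate

variable {N : ℕ} {h : ℝ}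

/-- Only the tail of the kernel reaches the support of `f`, and that tail is `O(h²)` uniformly in
`x`. -/
theorem exists_abs_heatOp_le_of_eq_zero (hN : 0 < N) {δ : ℝ} (hδ : 0 < δ) :
    ∃ K : ℝ, 0 ≤ K ∧ ∀ h, 0 < h → ∀ (f : ℝ → ℝ) (M x : ℝ), (∀ y, |f y| ≤ M) →
      (∀ y, |x - y| < δ → f y = 0) → |heatOp N h f x| ≤ K * h ^ 2 * M := by
  obtain ⟨C, hC0, hC⟩ := exists_heatKernel_bound hN hδ
  refine ⟨C * Real.pi, by positivity, fun h hh f M x hM hf => ?_⟩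
  have hM0 : 0 ≤ M := (abs_nonneg _).trans (hM 0)
  have hint : Integrable fun y : ℝ => C * h ^ 2 * M * (1 + (x - y) ^ 2)⁻¹ :=
    (integrable_inv_one_add_sq.comp_sub_left x).const_mul _
  have h1 : ∫ y : ℝ, C * h ^ 2 * M * (1 + (x - y) ^ 2)⁻¹ = C * Real.pi * h ^ 2 * M := by
    rw [integral_const_mul, integral_sub_left_eq_self (fun y : ℝ => (1 + y ^ 2)⁻¹) volume x,
      integral_univ_inv_one_add_sq]
    ring
  rw [← h1, heatOp, ← Real.norm_eq_abs]
  refine norm_integral_le_of_norm_le hint (Eventually.of_forall fun y => ?_)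
  rw [Real.norm_eq_abs, abs_mul]
  rcases lt_or_ge |x - y| δ with hy | hy
  · rw [hf y hy, abs_zero, mul_zero]; positivity
  · calc |heatKernel N h (x - y)| * |f y| ≤ C * h ^ 2 * (1 + (x - y) ^ 2)⁻¹ * M :=
        mul_le_mul (hC h hh _ hy) (hM y) (abs_nonneg _) (by positivity)
      _ = _ := by ring

theorem realFourier_indicator_Icc {c e : ℝ} (hce : c ≤ e) (s : ℝ → ℝ) (ξ : ℝ) :
    realFourier ((Icc c e).indicator s) ξ =
      ∫ x in c..e, Complex.exp (((-2 * Real.pi * x * ξ : ℝ) : ℂ) * Complex.I) * s x := by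
  rw [realFourier_eq, intervalIntegral.integral_of_le hce, ← integral_Icc_eq_integral_Ioc,
    ← integral_indicator measurableSet_Icc]
  congr 1
  ext x
  by_cases hx : x ∈ Icc c e
  · simp only [indicator_of_mem hx]
  · simp only [indicator_of_notMem hx, Complex.ofReal_zero, mul_zero]

theorem realFourier_indicator_deriv {c e : ℝ} (hce : c ≤ e) {s s' : ℝ → ℝ}
    (hs : ∀ x, HasDerivAt s (s' x) x) (hs' : Continuous s') (hc : s c = 0) (he : s e = 0) (ξ : ℝ) :
    realFourier ((Icc c e).indicator s') ξ =
      2 * Real.pi * Complex.I * ξ * realFourier ((Icc c e).indicator s) ξ := by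
  rw [realFourier_indicator_Icc hce, realFourier_indicator_Icc hce]
  have h1 : ∀ x : ℝ, HasDerivAt
      (fun x : ℝ => Complex.exp (((-2 * Real.pi * x * ξ : ℝ) : ℂ) * Complex.I))
      (-(2 * Real.pi * Complex.I * ξ) *
        Complex.exp (((-2 * Real.pi * x * ξ : ℝ) : ℂ) * Complex.I)) x := by
    intro x
    have h2 : HasDerivAt (fun x : ℝ => ((-2 * Real.pi * x * ξ : ℝ) : ℂ) * Complex.I)
        (((-2 * Real.pi * 1 * ξ : ℝ) : ℂ) * Complex.I) x :=
      ((((hasDerivAt_id x).const_mul (-2 * Real.pi)).mul_const ξ).ofReal_comp).mul_const _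
    refine h2.cexp.congr_deriv ?_
    push_cast; ring
  have h3 := intervalIntegral.integral_mul_deriv_eq_deriv_mul (a := c) (b := e)
    (fun x _ => h1 x) (fun x _ => (hs x).ofReal_comp)
    (by exact (by fun_prop : Continuous fun x : ℝ => -(2 * Real.pi * Complex.I * ξ) *
        Complex.exp (((-2 * Real.pi * x * ξ : ℝ) : ℂ) * Complex.I)).intervalIntegrable _ _)
    ((Complex.continuous_ofReal.comp hs').intervalIntegrable _ _)
  rw [h3, hc, he]
  simp only [mul_assoc, neg_mul]
  rw [intervalIntegral.integral_neg, intervalIntegral.integral_const_mul]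
  simp only [intervalIntegral.integral_const_mul]
  simp

/-- Contact of order `n` with zero at both ends removes all boundary terms, so cutting off does not
destroy the first `n` derivatives in `L²`. -/
theorem realFourier_indicator_iteratedDeriv {c e : ℝ} (hce : c ≤ e) {s : ℝ → ℝ}
    (hs : ContDiff ℝ ∞ s) (n : ℕ) (hc : ∀ j < n, iteratedDeriv j s c = 0)
    (he : ∀ j < n, iteratedDeriv j s e = 0) (ξ : ℝ) :
    realFourier ((Icc c e).indicator (iteratedDeriv n s)) ξ =
      (2 * Real.pi * Complex.I * ξ) ^ n * realFourier ((Icc c e).indicator s) ξ := by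
  induction n with
  | zero => simp
  | succ n ih =>
    have hd : Differentiable ℝ (iteratedDeriv n s) :=
      hs.differentiable_iteratedDeriv n (by exact_mod_cast ENat.natCast_lt_top n)
    rw [realFourier_indicator_deriv hce (s := iteratedDeriv n s)
      (fun x => by rw [iteratedDeriv_succ]; exact (hd x).hasDerivAt)
      (hs.continuous_iteratedDeriv _ (by exact_mod_cast le_top)) (hc n n.lt_succ_self)
      (he n n.lt_succ_self), ih (fun j hj => hc j (hj.trans n.lt_succ_self))
      (fun j hj => he j (hj.trans n.lt_succ_self))]
    ring

theorem realFourier_comp_sub_right (f : ℝ → ℝ) (σ ξ : ℝ) :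
    realFourier (fun x => f (x - σ)) ξ =
      Complex.exp (((-2 * Real.pi * σ * ξ : ℝ) : ℂ) * Complex.I) * realFourier f ξ := by
  rw [realFourier_eq, realFourier_eq, ← integral_const_mul,
    ← integral_add_right_eq_self _ σ]
  congr 1
  ext x
  rw [add_sub_cancel_right, ← mul_assoc, ← Complex.exp_add]
  congr 2
  push_cast; ring

theorem realFourier_sub {f k : ℝ → ℝ} (hf : Integrable f) (hk : Integrable k) (ξ : ℝ) :
    realFourier (fun x => f x - k x) ξ = realFourier f ξ - realFourier k ξ := by
  have hint : ∀ {f : ℝ → ℝ}, Integrable f → Integrable fun x : ℝ =>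
      Complex.exp (((-2 * Real.pi * x * ξ : ℝ) : ℂ) * Complex.I) * (f x : ℂ) := fun hf => by
    have := integrable_exp_mul hf.ofReal (-2 * Real.pi * ξ)
    refine this.congr (Eventually.of_forall fun x => ?_)
    simp only
    congr 3
    push_cast; ring
  rw [realFourier_eq, realFourier_eq, realFourier_eq, ← integral_sub (hint hf) (hint hk)]
  congr 1
  ext x
  push_cast; ring

/-- Continuity of translations in `L²`, read on the Fourier side, where it is dominated convergence.
-/
theorem tendsto_integral_shift {F : ℝ → ℂ} (hF : Continuous F)
    (hF2 : Integrable fun ξ => ‖F ξ‖ ^ 2) :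
    Tendsto (fun σ : ℝ => ∫ ξ : ℝ,
      ‖(1 - Complex.exp (((-2 * Real.pi * σ * ξ : ℝ) : ℂ) * Complex.I)) * F ξ‖ ^ 2)
      (𝓝 0) (𝓝 0) := by
  have h0 : ∫ ξ : ℝ, ‖(1 - Complex.exp (((-2 * Real.pi * 0 * ξ : ℝ) : ℂ) * Complex.I)) * F ξ‖ ^ 2
      = 0 := by simp
  conv => rhs; rw [← h0]
  refine tendsto_integral_filter_of_dominated_convergence (fun ξ => 4 * ‖F ξ‖ ^ 2)
    (Eventually.of_forall fun σ => ?_) (Eventually.of_forall fun σ =>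
      Eventually.of_forall fun ξ => ?_) (hF2.const_mul 4) (Eventually.of_forall fun ξ => ?_)
  · exact (by fun_prop : Continuous fun ξ : ℝ => ‖(1 - Complex.exp
      (((-2 * Real.pi * σ * ξ : ℝ) : ℂ) * Complex.I)) * F ξ‖ ^ 2).aestronglyMeasurable
  · rw [Real.norm_eq_abs, abs_of_nonneg (sq_nonneg _), norm_mul, mul_pow]
    have h1 : ‖1 - Complex.exp (((-2 * Real.pi * σ * ξ : ℝ) : ℂ) * Complex.I)‖ ≤ 2 := by
      refine (norm_sub_le _ _).trans ?_
      rw [Complex.norm_exp_ofReal_mul_I, norm_one]; norm_num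
    have h2 := pow_le_pow_left₀ (norm_nonneg _) h1 2
    exact mul_le_mul_of_nonneg_right (by linarith) (sq_nonneg _)
  · exact (by fun_prop : Continuous fun σ : ℝ => ‖(1 - Complex.exp
      (((-2 * Real.pi * σ * ξ : ℝ) : ℂ) * Complex.I)) * F ξ‖ ^ 2).tendsto 0

theorem one_sub_heatSymbol_le (ξ : ℝ) :
    1 - heatSymbol N h ξ ≤ h * (2 * Real.pi * ξ) ^ (2 * N) := by
  have := Real.add_one_le_exp (-h * (2 * Real.pi * ξ) ^ (2 * N))
  rw [heatSymbol]; linarith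

theorem norm_two_pi_mul_I_mul_pow (n : ℕ) (ξ : ℝ) :
    ‖(2 * Real.pi * Complex.I * ξ) ^ n‖ = |2 * Real.pi * ξ| ^ n := by
  rw [norm_pow]
  simp [abs_mul]

/-- From `1 - e^{-y} ≤ y`, the defect is at most `h` times the squared `L²` norm of the `N`-th
derivative, here represented by `Z'`. -/
theorem heatDefect_sub_shift_le (hh : 0 ≤ h) {Z Z' : ℝ → ℝ} (hZ : IsBddSupp Z)
    (hZ' : IsBddSupp Z')
    (hF : ∀ ξ : ℝ, realFourier Z' ξ = (2 * Real.pi * Complex.I * ξ) ^ N * realFourier Z ξ)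
    (σ : ℝ) : heatDefect N h (fun x => Z x - Z (x - σ)) ≤ h * ∫ ξ : ℝ,
      ‖(1 - Complex.exp (((-2 * Real.pi * σ * ξ : ℝ) : ℂ) * Complex.I)) * realFourier Z' ξ‖ ^ 2 := by
  have hint : Integrable fun ξ : ℝ => ‖(1 - Complex.exp (((-2 * Real.pi * σ * ξ : ℝ) : ℂ) *
      Complex.I)) * realFourier Z' ξ‖ ^ 2 := by
    have h1 := integrable_sq_realFourier (hZ'.sub (hZ'.comp_sub_right σ))
    refine h1.congr (Eventually.of_forall fun ξ => ?_)
    simp only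
    rw [realFourier_sub hZ'.integrable (hZ'.comp_sub_right σ).integrable,
      realFourier_comp_sub_right]
    congr 2
    ring
  rw [heatDefect, ← integral_const_mul]
  refine integral_mono_of_nonneg (Eventually.of_forall fun ξ => ?_) (hint.const_mul h)
    (Eventually.of_forall fun ξ => ?_)
  · exact mul_nonneg (sub_nonneg.2 (heatSymbol_le_one hh ξ)) (sq_nonneg _)
  · simp only
    rw [realFourier_sub hZ.integrable (hZ.comp_sub_right σ).integrable,
      realFourier_comp_sub_right, hF]
    have h1 : ‖(2 * Real.pi * Complex.I * ξ) ^ N‖ ^ 2 = (2 * Real.pi * ξ) ^ (2 * N) := by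
      rw [norm_two_pi_mul_I_mul_pow, ← pow_mul, mul_comm N 2, (even_two_mul N).pow_abs]
    set E := Complex.exp (((-2 * Real.pi * σ * ξ : ℝ) : ℂ) * Complex.I)
    set F := realFourier Z ξ
    have h2 : ‖F - E * F‖ ^ 2 = ‖(1 - E) * F‖ ^ 2 := by congr 2; ring
    have h3 : ‖(1 - E) * ((2 * Real.pi * Complex.I * ξ) ^ N * F)‖ ^ 2 =
        (2 * Real.pi * ξ) ^ (2 * N) * ‖(1 - E) * F‖ ^ 2 := by
      rw [← h1, ← mul_pow, ← norm_mul]; congr 2; ring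
    rw [h2, h3, ← mul_assoc]
    exact mul_le_mul_of_nonneg_right (one_sub_heatSymbol_le ξ) (sq_nonneg _)

theorem abs_integral_mul_le {f k : ℝ → ℝ} (hk : Integrable k) {C : ℝ}
    (hf : ∀ x, k x ≠ 0 → |f x| ≤ C) : |∫ x, f x * k x| ≤ C * ∫ x, |k x| := by
  rw [← integral_const_mul, ← Real.norm_eq_abs]
  refine norm_integral_le_of_norm_le (hk.abs.const_mul C) (Eventually.of_forall fun x => ?_)
  rw [Real.norm_eq_abs, abs_mul]
  by_cases hx : k x = 0
  · rw [hx, abs_zero, mul_zero, mul_zero]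
  · exact mul_le_mul_of_nonneg_right (hf x hx) (abs_nonneg _)

theorem heatOp_sub (hN : 0 < N) (hh : 0 < h) {f k : ℝ → ℝ} (hf : Measurable f) {M : ℝ}
    (hM : ∀ x, |f x| ≤ M) (hk : Measurable k) {M' : ℝ} (hM' : ∀ x, |k x| ≤ M') (x : ℝ) :
    heatOp N h (fun y => f y - k y) x = heatOp N h f x - heatOp N h k x := by
  rw [heatOp, heatOp, heatOp, ← integral_sub (integrable_heatKernel_sub_mul hN hh hf hM x)
    (integrable_heatKernel_sub_mul hN hh hk hM' x)]
  congr 1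
  ext y
  ring

theorem heatOp_add (hN : 0 < N) (hh : 0 < h) {f k : ℝ → ℝ} (hf : Measurable f) {M : ℝ}
    (hM : ∀ x, |f x| ≤ M) (hk : Measurable k) {M' : ℝ} (hM' : ∀ x, |k x| ≤ M') (x : ℝ) :
    heatOp N h (fun y => f y + k y) x = heatOp N h f x + heatOp N h k x := by
  rw [heatOp, heatOp, heatOp, ← integral_add (integrable_heatKernel_sub_mul hN hh hf hM x)
    (integrable_heatKernel_sub_mul hN hh hk hM' x)]
  congr 1
  ext y
  ring

theorem integrable_heatOp_mul (hN : 0 < N) (hh : 0 < h) {f k : ℝ → ℝ} (hf : Measurable f) {M : ℝ}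
    (hM : ∀ x, |f x| ≤ M) (hk : Integrable k) : Integrable fun x => heatOp N h f x * k x :=
  hk.bdd_mul (measurable_heatOp hN hh hf).aestronglyMeasurable
    (Eventually.of_forall fun x => abs_heatOp_le hN hh hM x)

/-- Pairing of the heat flow of `Z` with functions supported in `(a,b)`, when `Z` vanishes on
`(a,b)`, has `N` square integrable derivatives, and moves away from `(a,b)` under the shifts by
`τ σ`, `σ > 0`. -/
theorem exists_abs_integral_heatOp_mul_le (hN : 0 < N) {a b τ : ℝ} {Z Z' : ℝ → ℝ}
    (hZ : IsBddSupp Z) (hZ' : IsBddSupp Z')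
    (hF : ∀ ξ : ℝ, realFourier Z' ξ = (2 * Real.pi * Complex.I * ξ) ^ N * realFourier Z ξ)
    (hZ0 : ∀ x ∈ Ioo a b, Z x = 0)
    (hfar : ∀ σ, 0 < σ → ∀ x ∈ Ioo a b, ∀ y, |x - y| < σ → Z (y - τ * σ) = 0)
    {η : ℝ} (hη : 0 < η) : ∃ K, 0 ≤ K ∧ ∀ h, 0 < h → ∀ k, IsBddSupp k → (∀ x ∉ Ioo a b, k x = 0) →
      |∫ x, heatOp N h Z x * k x| ≤
        η * h + heatDefect N h k / 4 + K * h ^ 2 * ∫ x, |k x| := by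
  have hlim : Tendsto (fun σ : ℝ => ∫ ξ : ℝ, ‖(1 - Complex.exp
      (((-2 * Real.pi * (τ * σ) * ξ : ℝ) : ℂ) * Complex.I)) * realFourier Z' ξ‖ ^ 2)
      (𝓝[>] 0) (𝓝 0) := by
    refine (tendsto_integral_shift (continuous_realFourier hZ'.integrable)
      (integrable_sq_realFourier hZ')).comp ?_
    have : Tendsto (fun σ : ℝ => τ * σ) (𝓝 0) (𝓝 (τ * 0)) := (continuous_const_mul τ).tendsto 0
    rw [mul_zero] at this
    exact this.mono_left nhdsWithin_le_nhds
  -- The shift is fixed before `h`: small enough that `Z` and its translate differ by less than `η`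
  -- in the squared norm of their `N`-th derivatives, while the translate keeps distance `σ` from
  -- `(a,b)`.
  obtain ⟨σ, hσ1, hσ⟩ := ((hlim.eventually (gt_mem_nhds hη)).and self_mem_nhdsWithin).exists
  have hσ : 0 < σ := hσ
  obtain ⟨M, hM⟩ := hZ.bounded
  obtain ⟨K, hK0, hK⟩ := exists_abs_heatOp_le_of_eq_zero hN hσ
  have hM0 : 0 ≤ M := (abs_nonneg _).trans (hM 0)
  refine ⟨K * M, by positivity, fun h hh k hk hk0 => ?_⟩
  have hZs := hZ.comp_sub_right (τ * σ)
  have hMs : ∀ x, |Z (x - τ * σ)| ≤ M := fun x => hM _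
  have hsub := hZ.sub hZs
  obtain ⟨M', hM'⟩ := hsub.bounded
  have h1 : ∫ x, heatOp N h Z x * k x =
      (∫ x, heatOp N h (fun y => Z y - Z (y - τ * σ)) x * k x) +
        ∫ x, heatOp N h (fun y => Z (y - τ * σ)) x * k x := by
    rw [← integral_add (integrable_heatOp_mul hN hh hsub.measurable hM' hk.integrable)
      (integrable_heatOp_mul hN hh hZs.measurable hMs hk.integrable)]
    congr 1
    ext x
    rw [heatOp_sub hN hh hZ.measurable hM hZs.measurable hMs]
    ring
  have h2 : |∫ x, heatOp N h (fun y => Z (y - τ * σ)) x * k x| ≤ K * M * h ^ 2 * ∫ x, |k x| := by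
    refine abs_integral_mul_le hk.integrable fun x hx => ?_
    have hxD : x ∈ Ioo a b := by
      by_contra H
      exact hx (hk0 x H)
    refine (hK h hh _ M x hMs fun y hy => hfar σ hσ x hxD y hy).trans (le_of_eq ?_)
    ring
  -- Both functions vanish where `k` lives, so pairing `k` with the heat flow of the difference
  -- involves only `1 - T_h` and is bounded by defects.
  have h3 : ∫ x, (Z x - Z (x - τ * σ)) * k x = 0 := by
    rw [← integral_zero ℝ ℝ]
    congr 1
    ext x
    by_cases hx : x ∈ Ioo a b
    · rw [hZ0 x hx, hfar σ hσ x hx x (by simpa using hσ)]; simp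
    · rw [hk0 x hx, mul_zero]
  have h4 := abs_integral_mul_sub_integral_heatOp_mul_le hN hh hsub hk
  rw [h3, zero_sub, abs_neg] at h4
  have h5 := heatDefect_sub_shift_le hh.le hZ hZ' hF (τ * σ)
  have h6 : h * ∫ ξ : ℝ, ‖(1 - Complex.exp
      (((-2 * Real.pi * (τ * σ) * ξ : ℝ) : ℂ) * Complex.I)) * realFourier Z' ξ‖ ^ 2 ≤ h * η :=
    mul_le_mul_of_nonneg_left hσ1.le hh.le
  rw [h1]
  refine (abs_add_le _ _).trans ?_
  linarith

theorem iteratedDeriv_eq_zero_of_lt_abs {w : ℝ → ℝ} {r : ℝ} (hw0 : ∀ x, r < |x| → w x = 0) (n : ℕ)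
    {x : ℝ} (hx : r < |x|) : iteratedDeriv n w x = 0 := by
  have h1 : w =ᶠ[𝓝 x] fun _ => 0 := by
    filter_upwards [(continuous_abs.isOpen_preimage _ isOpen_Ioi).mem_nhds hx] with y hy
    exact hw0 y hy
  rw [h1.iteratedDeriv_eq]
  simp

theorem isBddSupp_of_contDiff {w : ℝ → ℝ} (hw : ContDiff ℝ ∞ w) {r : ℝ}
    (hw0 : ∀ x, r < |x| → w x = 0) : IsBddSupp w := by
  have hcs : HasCompactSupport w := .of_support_subset_isCompact (isCompact_Icc (a := -r) (b := r))
    fun x hx => by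
      by_contra hx'
      rw [mem_Icc, ← abs_le, not_le] at hx'
      exact hx (hw0 x hx')
  obtain ⟨C, hC⟩ := hcs.exists_bound_of_continuous hw.continuous
  exact ⟨hw.continuous.measurable, ⟨C, hC⟩, ⟨r, hw0⟩⟩

theorem integrable_realFourier_and_inversion {w : ℝ → ℝ} (hw : ContDiff ℝ ∞ w) {r : ℝ}
    (hw0 : ∀ x, r < |x| → w x = 0) : Integrable (realFourier w) ∧ ∀ x, (w x : ℂ) =
      ∫ ξ : ℝ, Complex.exp (((2 * Real.pi * x * ξ : ℝ) : ℂ) * Complex.I) * realFourier w ξ := by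
  have hcs : HasCompactSupport w := .of_support_subset_isCompact (isCompact_Icc (a := -r) (b := r))
    fun x hx => by
      by_contra hx'
      rw [mem_Icc, ← abs_le, not_le] at hx'
      exact hx (hw0 x hx')
  have h1 : HasCompactSupport (Complex.ofRealCLM ∘ w) := hcs.comp_left rfl
  have h2 : ContDiff ℝ ∞ (Complex.ofRealCLM ∘ w) := by fun_prop
  have hint : Integrable (realFourier w) := (𝓕 (h1.toSchwartzMap h2)).integrable (μ := volume)
  refine ⟨hint, fun x => ?_⟩
  have h3 := congrFun (Continuous.fourierInv_fourier_eq (f := fun x => (w x : ℂ)) h2.continuous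
    (isBddSupp_of_contDiff hw hw0).integrable.ofReal hint) x
  rw [Real.fourierInv_eq'] at h3
  rw [← h3]
  refine integral_congr_ae (Eventually.of_forall fun ξ => ?_)
  simp only [smul_eq_mul]
  rw [realFourier]
  congr 4
  simp
  ring

theorem realFourier_iteratedDeriv {w : ℝ → ℝ} (hw : ContDiff ℝ ∞ w) {r : ℝ} (hr : 0 ≤ r)
    (hw0 : ∀ x, r < |x| → w x = 0) (n : ℕ) (ξ : ℝ) :
    realFourier (iteratedDeriv n w) ξ = (2 * Real.pi * Complex.I * ξ) ^ n * realFourier w ξ := by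
  have hind : ∀ j, (Icc (-(r + 1)) (r + 1)).indicator (iteratedDeriv j w) = iteratedDeriv j w := by
    intro j
    refine indicator_eq_self.2 fun x hx => ?_
    by_contra hx'
    rw [mem_Icc, ← abs_le, not_le] at hx'
    exact hx (iteratedDeriv_eq_zero_of_lt_abs hw0 j (by linarith))
  have h1 := realFourier_indicator_iteratedDeriv (c := -(r + 1)) (e := r + 1) (by linarith) hw n
    (fun j _ => iteratedDeriv_eq_zero_of_lt_abs hw0 j (by rw [abs_neg, abs_of_pos] <;> linarith))
    (fun j _ => iteratedDeriv_eq_zero_of_lt_abs hw0 j (by rw [abs_of_pos] <;> linarith)) ξ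
  have h2 := hind 0
  rw [iteratedDeriv_zero] at h2
  rwa [hind, h2] at h1

theorem abs_exp_neg_sub_one_add_le {y : ℝ} (hy : 0 ≤ y) : |Real.exp (-y) - 1 + y| ≤ y ^ 2 := by
  have h1 := Real.add_one_le_exp (-y)
  have h2 : Real.exp (-y) ≤ 1 - y + y ^ 2 := by
    have h3 := Real.add_one_le_exp y
    have h4 : Real.exp (-y) * Real.exp y = 1 := by rw [← Real.exp_add]; simp
    have h5 := Real.exp_pos (-y)
    have h6 : Real.exp (-y) * (1 + y) ≤ 1 := by nlinarith
    have h7 : Real.exp (-y) * (1 + y) ≤ (1 - y + y ^ 2) * (1 + y) := by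
      have : 0 ≤ y ^ 3 := by positivity
      nlinarith
    exact le_of_mul_le_mul_right h7 (by linarith)
  rw [abs_le]
  constructor <;> nlinarith

/-- Second order consistency of the heat operator with its generator on smooth compactly supported
functions. -/
theorem exists_abs_heatOp_sub_le (hN : 0 < N) {w : ℝ → ℝ} (hw : ContDiff ℝ ∞ w) {r : ℝ}
    (hr : 0 ≤ r) (hw0 : ∀ x, r < |x| → w x = 0) : ∃ K, 0 ≤ K ∧ ∀ h, 0 < h → ∀ x,
      |heatOp N h w x - w x - h * ((-1) ^ (N - 1) * iteratedDeriv (2 * N) w x)| ≤ K * h ^ 2 := by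
  have hwj : ∀ j, ContDiff ℝ ∞ (iteratedDeriv j w) := fun j => by
    rw [iteratedDeriv_eq_iterate]; exact hw.iterate_deriv j
  have hz : ∀ j x, r < |x| → iteratedDeriv j w x = 0 := fun j x hx =>
    iteratedDeriv_eq_zero_of_lt_abs hw0 j hx
  obtain ⟨i0, e0⟩ := integrable_realFourier_and_inversion hw hw0
  obtain ⟨i2, e2⟩ := integrable_realFourier_and_inversion (hwj (2 * N)) (hz (2 * N))
  -- The Taylor remainder of the symbol is at most the square of `h (2πξ)^{2N}`, so the constant is
  -- the `L¹` norm of the transform of the derivative of order `4N`.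
  obtain ⟨i4, -⟩ := integrable_realFourier_and_inversion (hwj (4 * N)) (hz (4 * N))
  refine ⟨∫ ξ, ‖realFourier (iteratedDeriv (4 * N) w) ξ‖, integral_nonneg fun _ => norm_nonneg _,
    fun h hh x => ?_⟩
  have hb := isBddSupp_of_contDiff hw hw0
  have hg := integrable_heatSymbol_mul_realFourier hN hh hb
  have j0 := integrable_exp_mul i0 (2 * Real.pi * x)
  have j2 := integrable_exp_mul i2 (2 * Real.pi * x)
  have jg := integrable_exp_mul hg (2 * Real.pi * x)
  have key : ((heatOp N h w x - w x - h * ((-1) ^ (N - 1) * iteratedDeriv (2 * N) w x) : ℝ) : ℂ) =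
      ∫ ξ : ℝ, Complex.exp (((2 * Real.pi * x * ξ : ℝ) : ℂ) * Complex.I) *
        (((heatSymbol N h ξ - 1 + h * (2 * Real.pi * ξ) ^ (2 * N) : ℝ) : ℂ) * realFourier w ξ) := by
    have h1 : (h : ℂ) * ((-1) ^ (N - 1) * ((iteratedDeriv (2 * N) w x : ℝ) : ℂ)) =
        ∫ ξ : ℝ, (h : ℂ) * (-1) ^ (N - 1) *
          (Complex.exp (((2 * Real.pi * x * ξ : ℝ) : ℂ) * Complex.I) *
            realFourier (iteratedDeriv (2 * N) w) ξ) := by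
      rw [integral_const_mul, ← e2]; ring
    push_cast
    rw [h1, heatOp_eq_realFourier hN hh hb, e0]
    push_cast at j0 j2 jg ⊢
    have js : Integrable fun ξ : ℝ => Complex.exp (2 * Real.pi * x * ξ * Complex.I) *
        ((heatSymbol N h ξ : ℂ) * realFourier w ξ) -
        Complex.exp (2 * Real.pi * x * ξ * Complex.I) * realFourier w ξ := jg.sub j0
    rw [← integral_sub jg j0, ← integral_sub js (j2.const_mul _)]
    congr 1
    ext ξ
    rw [realFourier_iteratedDeriv hw hr hw0]
    have h2 : (-1 : ℂ) ^ (N - 1) * (2 * Real.pi * Complex.I * ξ) ^ (2 * N) =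
        -(2 * Real.pi * ξ) ^ (2 * N) := by
      obtain ⟨n, rfl⟩ := Nat.exists_eq_succ_of_ne_zero hN.ne'
      rw [show (2 * (Real.pi : ℂ) * Complex.I * ξ) = Complex.I * (2 * Real.pi * ξ) by ring,
        mul_pow, pow_mul Complex.I, Complex.I_sq, Nat.succ_eq_add_one, Nat.add_sub_cancel,
        pow_succ (-1 : ℂ)]
      have h3 : (-1 : ℂ) ^ n * (-1) ^ n = 1 := by rw [← mul_pow]; simp
      linear_combination (-(2 * (Real.pi : ℂ) * ξ) ^ (2 * (n + 1))) * h3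
    linear_combination (-(h : ℂ) * Complex.exp (2 * Real.pi * x * ξ * Complex.I) *
      realFourier w ξ) * h2
  rw [← Real.norm_eq_abs, ← Complex.norm_real, key,
    mul_comm (∫ ξ, ‖realFourier (iteratedDeriv (4 * N) w) ξ‖), ← integral_const_mul]
  refine norm_integral_le_of_norm_le (i4.norm.const_mul _) (Eventually.of_forall fun ξ => ?_)
  rw [norm_mul, Complex.norm_exp_ofReal_mul_I, one_mul, norm_mul, Complex.norm_real,
    Real.norm_eq_abs, realFourier_iteratedDeriv hw hr hw0, norm_mul]
  have h1 := abs_exp_neg_sub_one_add_le (mul_nonneg hh.le (two_pi_mul_pow_nonneg N ξ))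
  have h2 : ‖(2 * Real.pi * Complex.I * ξ) ^ (4 * N)‖ = ((2 * Real.pi * ξ) ^ (2 * N)) ^ 2 := by
    rw [norm_two_pi_mul_I_mul_pow, ← pow_mul, show 2 * N * 2 = 4 * N by ring,
      Even.pow_abs ⟨2 * N, by ring⟩]
  rw [h2, ← mul_assoc, ← mul_pow]
  refine mul_le_mul_of_nonneg_right ?_ (norm_nonneg _)
  rw [heatSymbol, neg_mul]
  exact h1

end Consistency

/-! ### Convergence of the discrete exit values. -/

section ExitLimit

variable {N : ℕ} {a b lam : ℝ} {φ u : ℝ → ℝ}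

/-- Splitting of the function equal to `u` on `(a,b)` and to `φ` elsewhere: a smooth compactly
supported extension `w` of `u`, a smooth `s` with the boundary contact of `φ - u`, and a part `f`
away from `[a,b]`. -/
theorem exists_cutoff_splitting (hab : a < b) (hφ : ContDiff ℝ ∞ φ) {M : ℝ} (hM : ∀ x, |φ x| ≤ M)
    (hu : ContDiff ℝ ∞ u) (hua : ∀ j < N, iteratedDeriv j u a = iteratedDeriv j φ a)
    (hub : ∀ j < N, iteratedDeriv j u b = iteratedDeriv j φ b) :
    ∃ w s f : ℝ → ℝ, ContDiff ℝ ∞ w ∧ (∃ r, 0 ≤ r ∧ ∀ x, r < |x| → w x = 0) ∧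
      (∀ x ∈ Ioo a b, w =ᶠ[𝓝 x] u) ∧ ContDiff ℝ ∞ s ∧
      (∀ j < N, iteratedDeriv j s a = 0) ∧ (∀ j < N, iteratedDeriv j s b = 0) ∧
      (∀ x ∉ Ioo (a - 2) (b + 2), s x = 0) ∧ Measurable f ∧ (∃ M, ∀ x, |f x| ≤ M) ∧
      (∀ x ∈ Ioo (a - 1) (b + 1), f x = 0) ∧ ∀ x, φ x = w x + s x + f x := by
  set c := (a + b) / 2 with hc
  let χ : ContDiffBump c := ⟨(b - a) / 2 + 1, (b - a) / 2 + 2, by linarith, by linarith⟩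
  have hχ : ContDiff ℝ ∞ (χ : ℝ → ℝ) := χ.contDiff
  have hball : ∀ ρ, Metric.ball c ((b - a) / 2 + ρ) = Ioo (a - ρ) (b + ρ) := fun ρ => by
    rw [Real.ball_eq_Ioo, hc]; congr 1 <;> ring
  have hone : ∀ x ∈ Ioo (a - 1) (b + 1), (χ : ℝ → ℝ) =ᶠ[𝓝 x] 1 := fun x hx =>
    χ.eventuallyEq_one_of_mem_ball (by rw [hball]; exact hx)
  have hzero : ∀ x ∉ Ioo (a - 2) (b + 2), χ x = 0 := fun x hx => by
    rw [← hball, Metric.mem_ball, not_lt] at hx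
    exact χ.zero_of_le_dist hx
  have hs : ContDiff ℝ ∞ fun x => χ x * (φ x - u x) := hχ.mul (hφ.sub hu)
  have hflat : ∀ x ∈ Ioo (a - 1) (b + 1), ∀ j, iteratedDeriv j u x = iteratedDeriv j φ x →
      iteratedDeriv j (fun x => χ x * (φ x - u x)) x = 0 := by
    intro x hx j hj
    have h1 : (fun x => χ x * (φ x - u x)) =ᶠ[𝓝 x] φ - u := by
      filter_upwards [hone x hx] with y hy
      rw [hy, Pi.one_apply, one_mul, Pi.sub_apply]
    rw [h1.iteratedDeriv_eq, iteratedDeriv_sub (hφ.contDiffAt.of_le (by exact_mod_cast le_top))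
      (hu.contDiffAt.of_le (by exact_mod_cast le_top)), hj, sub_self]
  refine ⟨fun x => χ x * u x, fun x => χ x * (φ x - u x), fun x => (1 - χ x) * φ x, hχ.mul hu,
    ⟨max |a - 2| |b + 2|, by positivity, fun x hx => ?_⟩, fun x hx => ?_, hs,
    fun j hj => hflat a ⟨by linarith, by linarith⟩ j (hua j hj),
    fun j hj => hflat b ⟨by linarith, by linarith⟩ j (hub j hj), fun x hx => ?_, ?_, ?_, ?_, ?_⟩
  · simp only
    rw [hzero x fun H => absurd (abs_le_max_abs_abs H.1.le H.2.le) (not_le.2 hx), zero_mul]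
  · filter_upwards [hone x ⟨by linarith [hx.1], by linarith [hx.2]⟩] with y hy
    rw [hy, Pi.one_apply, one_mul]
  · simp only
    rw [hzero x hx, zero_mul]
  · exact ((continuous_const.sub hχ.continuous).mul hφ.continuous).measurable
  · refine ⟨M, fun x => ?_⟩
    rw [abs_mul]
    refine (mul_le_of_le_one_left (abs_nonneg _) ?_).trans (hM x)
    rw [abs_le]
    constructor <;> linarith [χ.nonneg' x, χ.le_one (x := x)]
  · intro x hx
    simp only
    rw [(hone x hx).eq_of_nhds, Pi.one_apply, sub_self, zero_mul]
  · intro x; ring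

theorem abs_exp_neg_mul_one_add_sub_one_le {t : ℝ} (ht : 0 ≤ t) :
    |Real.exp (-t) * (1 + t) - 1| ≤ t ^ 2 := by
  have h1 := Real.add_one_le_exp (-t)
  have h3 := Real.add_one_le_exp t
  have h4 : Real.exp (-t) * Real.exp t = 1 := by rw [← Real.exp_add]; simp
  have h5 := Real.exp_pos (-t)
  rw [abs_le]
  constructor <;> nlinarith

/-- On `(a,b)` the generator multiplies `w` by `λ`, and the discount compensates this up to second
order: `e^{-λh}(1 + λh) = 1 + O(h²)`. -/
theorem exists_abs_discounted_heatOp_sub_le (hN : 0 < N) (hlam : 0 < lam) {w : ℝ → ℝ}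
    (hw : ContDiff ℝ ∞ w) {r : ℝ} (hr : 0 ≤ r) (hw0 : ∀ x, r < |x| → w x = 0)
    (hD : ∀ x ∈ Ioo a b, iteratedDeriv (2 * N) w x = (-1) ^ (N - 1) * (lam * w x)) :
    ∃ K, 0 ≤ K ∧ ∀ h, 0 < h → ∀ x ∈ Ioo a b,
      |Real.exp (-lam * h) * heatOp N h w x - w x| ≤ K * h ^ 2 := by
  obtain ⟨K, hK0, hK⟩ := exists_abs_heatOp_sub_le hN hw hr hw0
  obtain ⟨M, hM⟩ := (isBddSupp_of_contDiff hw hw0).bounded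
  have hM0 : 0 ≤ M := (abs_nonneg _).trans (hM 0)
  refine ⟨K + lam ^ 2 * M, by positivity, fun h hh x hx => ?_⟩
  have h1 := hK h hh x
  rw [hD x hx, ← mul_assoc ((-1 : ℝ) ^ (N - 1)), ← mul_pow] at h1
  norm_num at h1
  have h2 := abs_exp_neg_mul_one_add_sub_one_le (mul_nonneg hlam.le hh.le)
  have hq1 : Real.exp (-lam * h) ≤ 1 := Real.exp_le_one_iff.2 (by nlinarith)
  rw [← neg_mul] at h2
  set q := Real.exp (-lam * h)
  have hq : 0 < q := Real.exp_pos _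
  calc |q * heatOp N h w x - w x|
      = |(q * (1 + lam * h) - 1) * w x + q * (heatOp N h w x - w x - h * (lam * w x))| := by
        congr 1; ring
    _ ≤ |q * (1 + lam * h) - 1| * |w x| + q * |heatOp N h w x - w x - h * (lam * w x)| := by
        refine (abs_add_le _ _).trans ?_
        rw [abs_mul, abs_mul, abs_of_pos hq]
    _ ≤ (lam * h) ^ 2 * M + 1 * (K * h ^ 2) :=
        add_le_add (mul_le_mul h2 (hM x) (abs_nonneg _) (by positivity))
          (mul_le_mul hq1 h1 (abs_nonneg _) zero_le_one)
    _ = _ := by ring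

/-- The function equal to `u` on `(a,b)` and to `φ` elsewhere. -/
def glue (a b : ℝ) (u φ : ℝ → ℝ) (x : ℝ) : ℝ :=
  (Ioo a b).indicator u x + (Ioo a b)ᶜ.indicator φ x

theorem glue_of_mem {x : ℝ} (hx : x ∈ Ioo a b) : glue a b u φ x = u x := by
  rw [glue, indicator_of_mem hx, indicator_of_notMem (not_not.2 hx), add_zero]

theorem glue_of_notMem {x : ℝ} (hx : x ∉ Ioo a b) : glue a b u φ x = φ x := by
  rw [glue, indicator_of_notMem hx, indicator_of_mem (by exact hx), zero_add]

theorem measurable_glue (hu : Continuous u) (hφ : Continuous φ) : Measurable (glue a b u φ) :=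
  (hu.measurable.indicator measurableSet_Ioo).add
    (hφ.measurable.indicator measurableSet_Ioo.compl)

theorem exists_abs_glue_le (hu : Continuous u) {M : ℝ} (hM : ∀ x, |φ x| ≤ M) :
    ∃ C, ∀ x, |glue a b u φ x| ≤ C := by
  obtain ⟨C, hC⟩ := isCompact_Icc.exists_bound_of_continuousOn (hu.continuousOn (s := Icc a b))
  refine ⟨max C M, fun x => ?_⟩
  by_cases hx : x ∈ Ioo a b
  · rw [glue_of_mem hx]; exact (hC x (Ioo_subset_Icc_self hx)).trans (le_max_left _ _)
  · rw [glue_of_notMem hx]; exact (hM x).trans (le_max_right _ _)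

/-- Near a fixed interior point the glued function coincides with a smooth compactly supported one,
and the difference is seen only through the kernel's tail. The constant depends on the distance of
`x` to the ends, so the energy argument needs the integrated form below. -/
theorem exists_abs_residual_le (hN : 0 < N) (hab : a < b) (hlam : 0 < lam)
    (hφ : ContDiff ℝ ∞ φ) {M : ℝ} (hM : ∀ x, |φ x| ≤ M) (hu : ContDiff ℝ ∞ u)
    (hua : ∀ j < N, iteratedDeriv j u a = iteratedDeriv j φ a)
    (hub : ∀ j < N, iteratedDeriv j u b = iteratedDeriv j φ b)
    (hD : ∀ x ∈ Ioo a b, iteratedDeriv (2 * N) u x = (-1) ^ (N - 1) * (lam * u x))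
    {x : ℝ} (hx : x ∈ Ioo a b) : ∃ K, 0 ≤ K ∧ ∀ h, 0 < h →
    |Real.exp (-lam * h) * heatOp N h (glue a b u φ) x - u x| ≤ K * h ^ 2 := by
  obtain ⟨w, s, f, hw, ⟨r, hr, hw0⟩, hwu, -⟩ :=
    exists_cutoff_splitting (N := N) hab hφ hM hu hua hub
  obtain ⟨K, hK0, hK⟩ := exists_abs_discounted_heatOp_sub_le (a := a) (b := b) hN hlam hw hr hw0
    fun x hx => by rw [(hwu x hx).iteratedDeriv_eq, (hwu x hx).eq_of_nhds, hD x hx]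
  obtain ⟨Mw, hMw⟩ := (isBddSupp_of_contDiff hw hw0).bounded
  obtain ⟨Mv, hMv⟩ := exists_abs_glue_le (a := a) (b := b) hu.continuous hM
  have hv := measurable_glue (a := a) (b := b) hu.continuous hφ.continuous
  obtain ⟨K', hK0', hK'⟩ := exists_abs_heatOp_le_of_eq_zero hN
    (lt_min (sub_pos.2 hx.1) (sub_pos.2 hx.2))
  have hMg : ∀ y, |glue a b u φ y - w y| ≤ Mv + Mw := fun y =>
    (abs_sub _ _).trans (add_le_add (hMv y) (hMw y))
  have hM0 : 0 ≤ Mv + Mw := (abs_nonneg _).trans (hMg 0)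
  refine ⟨K + K' * (Mv + Mw), by positivity, fun h hh => ?_⟩
  have h1 := hK h hh x hx
  have h2 := hK' h hh (fun y => glue a b u φ y - w y) _ x hMg fun y hy => by
    have h3 := abs_lt.1 (hy.trans_le (min_le_left _ _))
    have h4 := abs_lt.1 (hy.trans_le (min_le_right _ _))
    have hyD : y ∈ Ioo a b := ⟨by linarith, by linarith⟩
    rw [glue_of_mem hyD, (hwu y hyD).eq_of_nhds, sub_self]
  rw [heatOp_sub hN hh hv hMv hw.continuous.measurable hMw] at h2
  rw [(hwu x hx).eq_of_nhds] at h1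
  have hq1 : Real.exp (-lam * h) ≤ 1 := Real.exp_le_one_iff.2 (by nlinarith)
  set q := Real.exp (-lam * h)
  have hq : 0 < q := Real.exp_pos _
  calc |q * heatOp N h (glue a b u φ) x - u x|
      = |(q * heatOp N h w x - u x) + q * (heatOp N h (glue a b u φ) x - heatOp N h w x)| := by
        congr 1; ring
    _ ≤ |q * heatOp N h w x - u x| + q * |heatOp N h (glue a b u φ) x - heatOp N h w x| := by
        refine (abs_add_le _ _).trans ?_
        rw [abs_mul q, abs_of_pos hq]
    _ ≤ K * h ^ 2 + 1 * (K' * h ^ 2 * (Mv + Mw)) :=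
        add_le_add h1 (mul_le_mul hq1 h2 (abs_nonneg _) zero_le_one)
    _ = _ := by ring

/-- The smooth part and the distant part have residual `O(h²)` uniformly on `(a,b)`. The two
one-sided parts are handled only weakly, by moving them outwards; each contributes `η h` and a
quarter of the defect of `k`. -/
theorem exists_abs_integral_residual_mul_le (hN : 0 < N) (hab : a < b) (hlam : 0 < lam)
    (hφ : ContDiff ℝ ∞ φ) {M : ℝ} (hM : ∀ x, |φ x| ≤ M) (hu : ContDiff ℝ ∞ u)
    (hua : ∀ j < N, iteratedDeriv j u a = iteratedDeriv j φ a)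
    (hub : ∀ j < N, iteratedDeriv j u b = iteratedDeriv j φ b)
    (hD : ∀ x ∈ Ioo a b, iteratedDeriv (2 * N) u x = (-1) ^ (N - 1) * (lam * u x))
    {η : ℝ} (hη : 0 < η) :
    ∃ K, 0 ≤ K ∧ ∀ h, 0 < h → ∀ k, IsBddSupp k → (∀ x ∉ Ioo a b, k x = 0) →
      |∫ x, (Real.exp (-lam * h) * heatOp N h (glue a b u φ) x - u x) * k x| ≤
        2 * η * h + heatDefect N h k / 2 + K * h ^ 2 * ∫ x, |k x| := by
  obtain ⟨w, s, f, hw, ⟨r, hr, hw0⟩, hwu, hs, hsa, hsb, hs0, hf, ⟨Mf, hMf⟩, hf0, hsum⟩ :=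
    exists_cutoff_splitting (N := N) hab hφ hM hu hua hub
  have hsnear : ∀ x ∉ Icc (a - 2) (b + 2), ∀ j, iteratedDeriv j s x = 0 := by
    intro x hx j
    have h1 : s =ᶠ[𝓝 x] fun _ => 0 := by
      filter_upwards [isClosed_Icc.isOpen_compl.mem_nhds hx] with y hy
      exact hs0 y fun H => hy (Ioo_subset_Icc_self H)
    rw [h1.iteratedDeriv_eq]; simp
  obtain ⟨K₁, hK₁, hw1⟩ := exists_abs_discounted_heatOp_sub_le (a := a) (b := b) hN hlam hw hr hw0
    fun x hx => by rw [(hwu x hx).iteratedDeriv_eq, (hwu x hx).eq_of_nhds, hD x hx]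
  obtain ⟨K₂, hK₂, hf1⟩ := exists_abs_heatOp_le_of_eq_zero hN one_pos
  have hMf0 : 0 ≤ Mf := (abs_nonneg _).trans (hMf 0)
  have hsN : Continuous (iteratedDeriv N s) :=
    hs.continuous_iteratedDeriv _ (by exact_mod_cast le_top)
  -- The outer endpoint `b + 3` lies beyond the support of `s`, which ends by `b + 2`, so all
  -- derivatives of `s` vanish there; at `b` they vanish below order `N`. The left piece is
  -- symmetric.
  have hR := IsBddSupp.of_indicator_Icc (a := b) (b := b + 3) hs.continuous
  have hL := IsBddSupp.of_indicator_Icc (a := a - 3) (b := a) hs.continuous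
  obtain ⟨K₃, hK₃, hR1⟩ := exists_abs_integral_heatOp_mul_le (a := a) (b := b) (τ := 1) hN hR
    (IsBddSupp.of_indicator_Icc (a := b) (b := b + 3) hsN)
    (realFourier_indicator_iteratedDeriv (by linarith) hs N hsb fun j _ =>
      hsnear _ (fun H => by linarith [H.2]) j)
    (fun x hx => indicator_of_notMem (fun H => by linarith [H.1, hx.2]) _)
    (fun σ hσ x hx y hy => indicator_of_notMem (fun H => by
      linarith [H.1, hx.2, (abs_lt.1 hy).1]) _) hη
  obtain ⟨K₄, hK₄, hL1⟩ := exists_abs_integral_heatOp_mul_le (a := a) (b := b) (τ := -1) hN hL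
    (IsBddSupp.of_indicator_Icc (a := a - 3) (b := a) hsN)
    (realFourier_indicator_iteratedDeriv (by linarith) hs N (fun j _ =>
      hsnear _ (fun H => by linarith [H.1]) j) hsa)
    (fun x hx => indicator_of_notMem (fun H => by linarith [H.2, hx.1]) _)
    (fun σ hσ x hx y hy => indicator_of_notMem (fun H => by
      linarith [H.2, hx.1, (abs_lt.1 hy).2]) _) hη
  refine ⟨K₁ + K₂ * Mf + K₃ + K₄, by positivity, fun h hh k hk hk0 => ?_⟩
  have hq1 : Real.exp (-lam * h) ≤ 1 := Real.exp_le_one_iff.2 (by nlinarith)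
  set q := Real.exp (-lam * h)
  have hq : 0 < q := Real.exp_pos _
  set zR := (Icc b (b + 3)).indicator s with hzR
  set zL := (Icc (a - 3) a).indicator s with hzL
  have hglue : glue a b u φ = fun x => ((w x + f x) + zL x) + zR x := by
    ext x
    by_cases hx : x ∈ Ioo a b
    · rw [glue_of_mem hx, (hwu x hx).eq_of_nhds, hf0 x ⟨by linarith [hx.1], by linarith [hx.2]⟩,
        hzR, hzL, indicator_of_notMem (fun H => by linarith [H.2, hx.1]),
        indicator_of_notMem (fun H => by linarith [H.1, hx.2])]
      ring
    · rw [glue_of_notMem hx, hsum x]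
      rcases le_or_gt x a with hxa | hxa
      · have h1 : zR x = 0 := indicator_of_notMem (fun H => by linarith [H.1]) _
        have h2 : zL x = s x := by
          by_cases hx3 : a - 3 ≤ x
          · exact indicator_of_mem (mem_Icc.2 ⟨hx3, hxa⟩) _
          · rw [hs0 x fun H => by linarith [H.1]]
            exact indicator_of_notMem (fun H => hx3 H.1) _
        rw [h1, h2]; ring
      · have hxb : b ≤ x := by
          by_contra H
          exact hx ⟨hxa, not_le.1 H⟩
        have h1 : zL x = 0 := indicator_of_notMem (fun H => by linarith [H.2]) _
        have h2 : zR x = s x := by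
          by_cases hx3 : x ≤ b + 3
          · exact indicator_of_mem (mem_Icc.2 ⟨hxb, hx3⟩) _
          · rw [hs0 x fun H => by linarith [H.2]]
            exact indicator_of_notMem (fun H => hx3 H.2) _
        rw [h1, h2]; ring
  obtain ⟨Mw, hMw⟩ := (isBddSupp_of_contDiff hw hw0).bounded
  obtain ⟨ML, hML⟩ := hL.bounded
  obtain ⟨MR, hMR⟩ := hR.bounded
  have hwm := hw.continuous.measurable
  have b1 : ∀ x, |w x + f x| ≤ Mw + Mf := fun x =>
    (abs_add_le _ _).trans (add_le_add (hMw x) (hMf x))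
  have b2 : ∀ x, |w x + f x + zL x| ≤ Mw + Mf + ML := fun x =>
    (abs_add_le _ _).trans (add_le_add (b1 x) (hML x))
  have hT : ∀ x, heatOp N h (glue a b u φ) x =
      heatOp N h w x + heatOp N h f x + heatOp N h zL x + heatOp N h zR x := by
    intro x
    rw [hglue, heatOp_add hN hh (f := fun x => w x + f x + zL x) ((hwm.add hf).add hL.measurable)
        b2 hR.measurable hMR, heatOp_add hN hh (f := fun x => w x + f x) (hwm.add hf) b1
        hL.measurable hML, heatOp_add hN hh hwm hMw hf hMf]
  have iL := (integrable_heatOp_mul hN hh hL.measurable hML hk.integrable).const_mul q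
  have iR := (integrable_heatOp_mul hN hh hR.measurable hMR hk.integrable).const_mul q
  have i0 : Integrable fun x => (q * heatOp N h w x - w x + q * heatOp N h f x) * k x := by
    have := (((integrable_heatOp_mul hN hh hwm hMw hk.integrable).const_mul q).sub
      (hk.integrable.bdd_mul hwm.aestronglyMeasurable (Eventually.of_forall hMw))).add
      ((integrable_heatOp_mul hN hh hf hMf hk.integrable).const_mul q)
    refine this.congr (Eventually.of_forall fun x => ?_)
    simp only [Pi.add_apply, Pi.sub_apply]
    ring
  have hsplit : ∫ x, (q * heatOp N h (glue a b u φ) x - u x) * k x =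
      ((∫ x, (q * heatOp N h w x - w x + q * heatOp N h f x) * k x) +
        q * ∫ x, heatOp N h zL x * k x) + q * ∫ x, heatOp N h zR x * k x := by
    rw [← integral_const_mul, ← integral_const_mul, ← integral_add i0 iL,
      ← integral_add (by exact i0.add iL) iR]
    congr 1
    ext x
    by_cases hx : x ∈ Ioo a b
    · rw [hT, (hwu x hx).eq_of_nhds]; ring
    · rw [hk0 x hx]; ring
  have e0 : |∫ x, (q * heatOp N h w x - w x + q * heatOp N h f x) * k x| ≤
      (K₁ + K₂ * Mf) * h ^ 2 * ∫ x, |k x| := by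
    refine abs_integral_mul_le hk.integrable fun x hx => ?_
    have hxD : x ∈ Ioo a b := by
      by_contra H
      exact hx (hk0 x H)
    have h1 := hf1 h hh f Mf x hMf fun y hy => hf0 y
      ⟨by linarith [hxD.1, (abs_lt.1 hy).2], by linarith [hxD.2, (abs_lt.1 hy).1]⟩
    calc _ ≤ |q * heatOp N h w x - w x| + q * |heatOp N h f x| := by
          refine (abs_add_le _ _).trans ?_
          rw [abs_mul q, abs_of_pos hq]
      _ ≤ K₁ * h ^ 2 + 1 * (K₂ * h ^ 2 * Mf) :=
          add_le_add (hw1 h hh x hxD) (mul_le_mul hq1 h1 (abs_nonneg _) zero_le_one)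
      _ = _ := by ring
  have eL : |q * ∫ x, heatOp N h zL x * k x| ≤
      η * h + heatDefect N h k / 4 + K₄ * h ^ 2 * ∫ x, |k x| := by
    rw [abs_mul, abs_of_pos hq]
    exact (mul_le_of_le_one_left (abs_nonneg _) hq1).trans (hL1 h hh k hk hk0)
  have eR : |q * ∫ x, heatOp N h zR x * k x| ≤
      η * h + heatDefect N h k / 4 + K₃ * h ^ 2 * ∫ x, |k x| := by
    rw [abs_mul, abs_of_pos hq]
    exact (mul_le_of_le_one_left (abs_nonneg _) hq1).trans (hR1 h hh k hk hk0)
  rw [hsplit]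
  refine (abs_add_le _ _).trans ((add_le_add (abs_add_le _ _) le_rfl).trans ?_)
  linarith

/-- Testing the equation with `ψ` gives `(1-q)‖ψ‖² + q D = ⟨residual, ψ⟩`, where `D` is the defect
and `q` the discount. The left side dominates `h‖ψ‖²` and `D`, whereas the residual is `o(h)` up to
`D/2` and a small multiple of `h‖ψ‖²`. -/
theorem tendsto_energy (hN : 0 < N) (hab : a < b) (hlam : 0 < lam)
    (hφ : ContDiff ℝ ∞ φ) {M : ℝ} (hM : ∀ x, |φ x| ≤ M) (hu : ContDiff ℝ ∞ u)
    (hua : ∀ j < N, iteratedDeriv j u a = iteratedDeriv j φ a)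
    (hub : ∀ j < N, iteratedDeriv j u b = iteratedDeriv j φ b)
    (hD : ∀ x ∈ Ioo a b, iteratedDeriv (2 * N) u x = (-1) ^ (N - 1) * (lam * u x))
    {ψ : ℝ → ℝ → ℝ} (hψ : ∀ h, 0 < h → IsBddSupp (ψ h))
    (hψ0 : ∀ h, ∀ x ∉ Ioo a b, ψ h x = 0)
    (heq : ∀ h, 0 < h → ∀ x ∈ Ioo a b, ψ h x = Real.exp (-lam * h) * heatOp N h (ψ h) x +
      (Real.exp (-lam * h) * heatOp N h (glue a b u φ) x - u x)) {ε : ℝ} (hε : 0 < ε) :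
    ∀ᶠ h in 𝓝[>] (0 : ℝ), 2 * (∫ x, ψ h x ^ 2) + heatDefect N h (ψ h) / h ≤ ε := by
  -- The estimate below ends in `λ/4 · A + (B/h)/4 ≤ ε/c`; then `2A` is at most `8/λ` times `ε/c`
  -- and `B/h` at most `4` times it.
  obtain ⟨c, hc⟩ : ∃ c, c = 8 / lam + 4 := ⟨_, rfl⟩
  have hc0 : 0 < c := by rw [hc]; positivity
  obtain ⟨K, hK0, hK⟩ := exists_abs_integral_residual_mul_le hN hab hlam hφ hM hu hua hub hD
    (η := ε / (4 * c)) (by positivity)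
  have hlim : ∀ L : ℝ, 0 < L → ∀ C : ℝ, ∀ᶠ h in 𝓝[>] (0 : ℝ), C * h < L := fun L hL C => by
    have : Tendsto (fun h : ℝ => C * h) (𝓝[>] 0) (𝓝 (C * 0)) :=
      ((continuous_const_mul C).tendsto 0).mono_left nhdsWithin_le_nhds
    rw [mul_zero] at this
    exact this.eventually (gt_mem_nhds hL)
  filter_upwards [self_mem_nhdsWithin, hlim (1 / 4) (by norm_num) lam, hlim (lam / 4) (by positivity) K,
    hlim (ε / (2 * c)) (by positivity) (K * (b - a))] with h hh hl1 hl2 hl3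
  have hh : 0 < h := hh
  have hb := hψ h hh
  set A := ∫ x, ψ h x ^ 2 with hA
  set B := heatDefect N h (ψ h) with hB
  set q := Real.exp (-lam * h) with hq
  have hA0 : 0 ≤ A := integral_nonneg fun _ => sq_nonneg _
  have hB0 : 0 ≤ B := heatDefect_nonneg hh.le _
  have hAint : Integrable fun x => ψ h x ^ 2 := by
    simpa only [sq] using (hb.mul hb).integrable
  obtain ⟨Mψ, hMψ⟩ := hb.bounded
  obtain ⟨Mv, hMv⟩ := exists_abs_glue_le (a := a) (b := b) hu.continuous hM
  have hv := measurable_glue (a := a) (b := b) hu.continuous hφ.continuous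
  have h1 : A = q * (A - B) + ∫ x, (q * heatOp N h (glue a b u φ) x - u x) * ψ h x := by
    have i1 := (integrable_heatOp_mul hN hh hb.measurable hMψ hb.integrable).const_mul q
    rw [← integral_heatOp_mul_self hN hh hb, ← integral_const_mul, hA]
    have i2 : Integrable fun x => (q * heatOp N h (glue a b u φ) x - u x) * ψ h x := by
      refine (hAint.sub i1).congr (Eventually.of_forall fun x => ?_)
      simp only [Pi.sub_apply]
      by_cases hx : x ∈ Ioo a b
      · have h2 := heq h hh x hx
        have h3 : q * heatOp N h (glue a b u φ) x - u x = ψ h x - q * heatOp N h (ψ h) x := by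
          linarith
        rw [h3]; ring
      · rw [hψ0 h x hx]; ring
    rw [← integral_add i1 i2]
    congr 1
    ext x
    by_cases hx : x ∈ Ioo a b
    · have h2 := heq h hh x hx
      have h3 : q * heatOp N h (glue a b u φ) x - u x = ψ h x - q * heatOp N h (ψ h) x := by
        linarith
      rw [h3]; ring
    · rw [hψ0 h x hx]; ring
  have h2 := (le_abs_self _).trans (hK h hh (ψ h) hb (hψ0 h))
  have h3 : ∫ x, |ψ h x| ≤ ((b - a) + A) / 2 := by
    have i3 : Integrable ((Ioo a b).indicator (1 : ℝ → ℝ)) :=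
      (integrable_indicator_iff measurableSet_Ioo).2 (integrableOn_const (by simp))
    have h4 : ∫ x, (Ioo a b).indicator (1 : ℝ → ℝ) x = b - a := by
      rw [integral_indicator_one measurableSet_Ioo, measureReal_def, Real.volume_Ioo,
        ENNReal.toReal_ofReal (by linarith)]
    rw [← h4, ← integral_add i3 hAint, ← integral_div]
    refine integral_mono hb.integrable.abs ((i3.add hAint).div_const 2) fun x => ?_
    simp only
    by_cases hx : x ∈ Ioo a b
    · rw [indicator_of_mem hx, Pi.one_apply, ← sq_abs]
      nlinarith [sq_nonneg (|ψ h x| - 1)]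
    · rw [hψ0 h x hx, indicator_of_notMem hx]; simp
  have h5 : K * h ^ 2 * ∫ x, |ψ h x| ≤ K * h ^ 2 * (((b - a) + A) / 2) :=
    mul_le_mul_of_nonneg_left h3 (by positivity)
  have hq1 : 3 / 4 ≤ q := by
    have := Real.add_one_le_exp (-lam * h)
    rw [hq]; linarith
  have hq2 : lam * h / 2 ≤ 1 - q := by
    have h6 := Real.add_one_le_exp (lam * h)
    have h7 : q * Real.exp (lam * h) = 1 := by rw [hq, ← Real.exp_add]; simp
    have h8 : 0 < lam * h := by positivity
    nlinarith
  -- Of the coefficient `q ≥ 3/4` of the defect, `1/2` absorbs the defect coming from the residual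
  -- and `1/4` remains.
  have h9 : lam * h / 2 * A + B / 4 ≤
      2 * (ε / (4 * c)) * h + K * h ^ 2 * (((b - a) + A) / 2) := by
    nlinarith [mul_le_mul_of_nonneg_right hq2 hA0, mul_le_mul_of_nonneg_right hq1 hB0]
  have h10 : K * h ^ 2 * A ≤ lam / 4 * h * A := by
    have : K * h * (h * A) ≤ lam / 4 * (h * A) :=
      mul_le_mul_of_nonneg_right hl2.le (by positivity)
    linarith
  have h11 : lam / 4 * A + B / h / 4 ≤ ε / c := by
    have h12 : h * (lam / 4 * A + B / h / 4) ≤ h * (ε / c) := by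
      have h13 : h * (B / h / 4) = B / 4 := by field_simp
      have h14 : K * (b - a) * h * h ≤ ε / (2 * c) * h := mul_le_mul_of_nonneg_right hl3.le hh.le
      have h15 : ε / (4 * c) = ε / c / 4 := by field_simp
      have h16 : ε / (2 * c) = ε / c / 2 := by field_simp
      rw [h15] at h9
      rw [h16] at h14
      have h17 : 0 ≤ lam * h * A := by positivity
      have h18 : 0 < h * (ε / c) := by positivity
      rw [mul_add, h13]
      nlinarith
    exact le_of_mul_le_mul_left h12 hh
  have hBh : 0 ≤ B / h := by positivity
  have h19 : 2 * A ≤ 8 / lam * (ε / c) := by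
    rw [div_mul_eq_mul_div, le_div_iff₀ hlam]
    nlinarith
  have h20 : B / h ≤ 4 * (ε / c) := by
    have : 0 ≤ lam / 4 * A := by positivity
    linarith
  calc 2 * A + B / h ≤ c * (ε / c) := by rw [hc] at *; linarith
    _ = ε := by field_simp

/-- The difference from the glued function equals a discounted heat step of itself plus the residual
at `x`. The first is small by the energy estimate and `abs_heatOp_le_of_energy`, the second is
`O(h²)` at fixed `x`. -/
theorem tendsto_exitValue (hN : 0 < N) (hab : a < b) (hlam : 0 < lam)
    (hφ : ContDiff ℝ ∞ φ) {M : ℝ} (hM : ∀ x, |φ x| ≤ M) (hu : ContDiff ℝ ∞ u)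
    (hua : ∀ j < N, iteratedDeriv j u a = iteratedDeriv j φ a)
    (hub : ∀ j < N, iteratedDeriv j u b = iteratedDeriv j φ b)
    (hD : ∀ x ∈ Ioo a b, iteratedDeriv (2 * N) u x = (-1) ^ (N - 1) * (lam * u x))
    {x : ℝ} (hx : x ∈ Ioo a b) :
    Tendsto (fun h => exitValue N a b h (Real.exp (-lam * h)) φ x) (𝓝[>] 0) (𝓝 (u x)) := by
  have hφm := hφ.continuous.measurable
  have hqlt : ∀ {h : ℝ}, 0 < h → Real.exp (-lam * h) < 1 := fun hh =>
    Real.exp_lt_one_iff.2 (by nlinarith)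
  set ψ : ℝ → ℝ → ℝ := fun h => (Ioo a b).indicator
    fun y => exitValue N a b h (Real.exp (-lam * h)) φ y - u y with hψdef
  obtain ⟨Cu, hCu⟩ := isCompact_Icc.exists_bound_of_continuousOn
    (hu.continuous.continuousOn (s := Icc a b))
  have hψ : ∀ h, 0 < h → IsBddSupp (ψ h) := fun h hh => by
    obtain ⟨C, hC⟩ := exists_abs_exitValue_le (a := a) (b := b) hN hh hφm hM (Real.exp_pos _)
      (hqlt hh)
    exact .of_indicator_Ioo ((measurable_exitValue hN hh hφm hM (Real.exp_pos _) (hqlt hh)).sub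
      hu.continuous.measurable) (M := C + Cu) fun y hy =>
        (abs_sub _ _).trans (add_le_add (hC y) (hCu y (Ioo_subset_Icc_self hy)))
  have hψ0 : ∀ h, ∀ y ∉ Ioo a b, ψ h y = 0 := fun h y hy => indicator_of_notMem hy _
  have hsplit : ∀ h, 0 < h → exitValue N a b h (Real.exp (-lam * h)) φ =
      fun y => ψ h y + glue a b u φ y := fun h hh => by
    ext y
    by_cases hy : y ∈ Ioo a b
    · rw [hψdef, glue_of_mem hy]; simp only [indicator_of_mem hy]; ring
    · rw [hψ0 h y hy, glue_of_notMem hy, exitValue_of_notMem hN hh hφm hM hy, zero_add]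
  obtain ⟨Mv, hMv⟩ := exists_abs_glue_le (a := a) (b := b) hu.continuous hM
  have hv := measurable_glue (a := a) (b := b) hu.continuous hφ.continuous
  have heq : ∀ h, 0 < h → ∀ y ∈ Ioo a b, ψ h y = Real.exp (-lam * h) * heatOp N h (ψ h) y +
      (Real.exp (-lam * h) * heatOp N h (glue a b u φ) y - u y) := by
    intro h hh y hy
    obtain ⟨Mψ, hMψ⟩ := (hψ h hh).bounded
    have h1 := exitValue_of_mem hN hh hφm hM (Real.exp_pos _) (hqlt hh) hy
    have h2 : heatOp N h (exitValue N a b h (Real.exp (-lam * h)) φ) y =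
        heatOp N h (ψ h) y + heatOp N h (glue a b u φ) y := by
      rw [hsplit h hh, heatOp_add hN hh (hψ h hh).measurable hMψ hv hMv]
    rw [h2] at h1
    simp only [hψdef, indicator_of_mem hy]
    simp only [hψdef] at h1
    rw [h1]; ring
  obtain ⟨K, hK0, hK⟩ := exists_abs_residual_le hN hab hlam hφ hM hu hua hub hD hx
  rw [Metric.tendsto_nhds]
  intro ε hε
  -- With `r π = ε/2` and energy at most `r ε/2`, the Sobolev-type bound is `(ε/2 + ε/2)/2 = ε/2`;
  -- the residual takes the other half.
  set r := ε / (2 * Real.pi) with hr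
  have hr0 : 0 < r := by positivity
  have hKlim : ∀ᶠ h in 𝓝[>] (0 : ℝ), K * h ^ 2 < ε / 2 := by
    have : Tendsto (fun h : ℝ => K * h ^ 2) (𝓝[>] 0) (𝓝 (K * 0 ^ 2)) :=
      ((by fun_prop : Continuous fun h : ℝ => K * h ^ 2).tendsto 0).mono_left nhdsWithin_le_nhds
    rw [zero_pow two_ne_zero, mul_zero] at this
    exact this.eventually (gt_mem_nhds (by positivity))
  filter_upwards [self_mem_nhdsWithin, hKlim, tendsto_energy hN hab hlam hφ hM hu hua hub hD
    hψ hψ0 heq (ε := r * (ε / 2)) (by positivity)] with h hh h1 h2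
  have hh : 0 < h := hh
  have h3 := abs_heatOp_le_of_energy hN hh (hψ h hh) hr0 x
  have h4 : r⁻¹ * (2 * (∫ y, ψ h y ^ 2) + heatDefect N h (ψ h) / h) ≤ ε / 2 := by
    rw [inv_mul_le_iff₀ hr0]; exact h2
  have h5 : r * Real.pi = ε / 2 := by rw [hr]; field_simp
  have h6 := heq h hh x hx
  have h7 : ψ h x = exitValue N a b h (Real.exp (-lam * h)) φ x - u x := indicator_of_mem hx _
  rw [Real.dist_eq, ← h7, h6]
  have h8 : |Real.exp (-lam * h) * heatOp N h (ψ h) x| ≤ |heatOp N h (ψ h) x| := by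
    rw [abs_mul, abs_of_pos (Real.exp_pos _)]
    exact mul_le_of_le_one_left (abs_nonneg _) (hqlt hh).le
  refine (abs_add_le _ _).trans_lt ?_
  linarith [hK h hh]

end ExitLimit

/-! ### Identification of the joint pseudo-distribution. -/

section JointDensity

theorem conj_leftData {N : ℕ} (k : Fin N) (j : Fin (2 * N)) :
    (starRingEnd ℂ) (leftData k j) = leftData k j := by
  rw [leftData, Pi.single_apply]; split_ifs <;> simp

theorem conj_rightData {N : ℕ} (k : Fin N) (j : Fin (2 * N)) :
    (starRingEnd ℂ) (rightData k j) = rightData k j := by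
  rw [rightData, Pi.single_apply]; split_ifs <;> simp

variable {N : ℕ} [NeZero N] {a b lam : ℝ} {φ : ℝ → ℝ}

/-- The `l`-th derivative of the solution of `u^(2N) = (-1)^(N-1) lam u` that has the derivatives
of `φ` of order less than `N` as boundary data at `a` and `b`. -/
def dirichletSol (N : ℕ) [NeZero N] (a b lam : ℝ) (φ : ℝ → ℝ) (l : ℕ) (x : ℝ) : ℝ :=
  (∑ k : Fin N, iteratedDeriv k φ a * (sol N a b (leftData k) lam l x).re) +
    ∑ k : Fin N, iteratedDeriv k φ b * (sol N a b (rightData k) lam l x).re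

theorem hasDerivAt_dirichletSol (l : ℕ) (x : ℝ) :
    HasDerivAt (dirichletSol N a b lam φ l) (dirichletSol N a b lam φ (l + 1) x) x := by
  have h : ∀ d : Fin (2 * N) → ℂ, HasDerivAt (fun x => (sol N a b d lam l x).re)
      (sol N a b d lam (l + 1) x).re x := fun d =>
    Complex.reCLM.hasFDerivAt.comp_hasDerivAt x (hasDerivAt_sol a b d lam l x)
  exact (HasDerivAt.fun_sum fun k _ => (h (leftData k)).const_mul (iteratedDeriv k φ a)).fun_add
    (HasDerivAt.fun_sum fun k _ => (h (rightData k)).const_mul (iteratedDeriv k φ b))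

theorem iteratedDeriv_dirichletSol (l : ℕ) (x : ℝ) :
    iteratedDeriv l (dirichletSol N a b lam φ 0) x = dirichletSol N a b lam φ l x :=
  iteratedDeriv_eq_of_hasDerivAt_seq isOpen_univ
    (fun l x _ => hasDerivAt_dirichletSol l x) l x (mem_univ x)

theorem contDiff_dirichletSol : ContDiff ℝ ∞ (dirichletSol N a b lam φ 0) :=
  contDiff_infty.2 fun n => contDiffOn_univ.1 <|
    contDiffOn_of_hasDerivAt_seq (g := dirichletSol N a b lam φ) isOpen_univ
      (fun l x _ => hasDerivAt_dirichletSol l x) n 0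

theorem dirichletSol_two_mul (x : ℝ) : dirichletSol N a b lam φ (2 * N) x =
    (-1) ^ (N - 1) * (lam * dirichletSol N a b lam φ 0 x) := by
  have h : ∀ d : Fin (2 * N) → ℂ, (sol N a b d lam (2 * N) x).re =
      (-1) ^ (N - 1) * (lam * (sol N a b d lam 0 x).re) := fun d => by
    rw [sol_two_mul, kappa_eq_ofReal, mul_assoc, Complex.re_ofReal_mul, Complex.re_ofReal_mul]
  simp only [dirichletSol, h, mul_add, Finset.mul_sum]
  congr 1 <;> exact Finset.sum_congr rfl fun k _ => by ring

theorem dirichletSol_left (hab : a < b) (hlam : 0 ≤ lam) {j : ℕ} (hj : j < N) :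
    dirichletSol N a b lam φ j a = iteratedDeriv j φ a := by
  have hlam' : (0 : ℝ) ≤ (lam : ℂ).re := hlam
  simp only [dirichletSol, sol_left hab hlam' j hj, leftData_left _ j hj, rightData_left _ j hj]
  rw [Finset.sum_eq_single (⟨j, hj⟩ : Fin N)]
  · simp
  · intro k _ hk
    rw [if_neg fun H => hk (Fin.ext H)]; simp
  · simp

theorem dirichletSol_right (hab : a < b) (hlam : 0 ≤ lam) {j : ℕ} (hj : j < N) :
    dirichletSol N a b lam φ j b = iteratedDeriv j φ b := by
  have hlam' : (0 : ℝ) ≤ (lam : ℂ).re := hlam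
  simp only [dirichletSol, sol_right hab hlam' j hj, leftData_right _ j hj, rightData_right _ j hj]
  rw [add_comm, Finset.sum_eq_single (⟨j, hj⟩ : Fin N)]
  · simp
  · intro k _ hk
    rw [if_neg fun H => hk (Fin.ext H)]; simp
  · simp

theorem feynmanKacTerm_eq (x : ℝ) (n m : ℕ) : feynmanKacTerm N a b lam φ x n m =
    Real.exp (-lam * (1 / 2 ^ n)) ^ m * exitExpectation N a b (1 / 2 ^ n) φ x m := by
  rw [feynmanKacTerm, ← Real.exp_nat_mul]
  congr 2
  ring

/-- The sign in the density cancels the one in `diracDeriv`, so the Laplace transform of the pairing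
with `φ` is the superposition `dirichletSol`, whose data at the ends are the derivatives of `φ`. The
dyadic walks converge to the same function, as the case `h = 2⁻ⁿ` of `tendsto_exitValue`. -/
theorem isJointPseudoDensity_heatSol (hab : a < b) {x : ℝ} (hx : x ∈ Ioo a b) :
    IsJointPseudoDensity N a b x fun t φ =>
      (∑ k : Fin N, (-1) ^ (k : ℕ) * heatSol N a b (leftData k) 0 t x * diracDeriv a k φ)
        + (∑ k : Fin N, (-1) ^ (k : ℕ) * heatSol N a b (rightData k) 0 t x * diracDeriv b k φ) := by
  rintro φ hφ ⟨M, hM⟩ lam hlam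
  have hN := NeZero.pos N
  have hφm := hφ.continuous.measurable
  have hh : ∀ n : ℕ, (0 : ℝ) < 1 / 2 ^ n := fun n => by positivity
  have hI : ∀ (c : ℝ) (d : Fin N → Fin (2 * N) → ℂ) (t : ℝ),
      Real.exp (-lam * t) * ∑ k : Fin N, (-1) ^ (k : ℕ) * heatSol N a b (d k) 0 t x *
        diracDeriv c k φ =
      ∑ k : Fin N, iteratedDeriv k φ c * (Real.exp (-lam * t) * heatSol N a b (d k) 0 t x) := by
    intro c d t
    rw [Finset.mul_sum]
    refine Finset.sum_congr rfl fun k _ => ?_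
    have h1 : ((-1 : ℝ)) ^ (k : ℕ) * (-1) ^ (k : ℕ) = 1 := by rw [← mul_pow]; simp
    rw [diracDeriv]
    linear_combination (Real.exp (-lam * t) * heatSol N a b (d k) 0 t x *
      iteratedDeriv k φ c) * h1
  have hint : ∀ (c : ℝ) (d : Fin N → Fin (2 * N) → ℂ) (k : Fin N), IntegrableOn (fun t =>
      iteratedDeriv k φ c * (Real.exp (-lam * t) * heatSol N a b (d k) 0 t x)) (Ioi 0) :=
    fun c d k => (laplace_heatSol hab (d k) 0 hx hlam).1.const_mul _
  have hsum : ∀ (c : ℝ) (d : Fin N → Fin (2 * N) → ℂ), IntegrableOn (fun t =>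
      ∑ k : Fin N, iteratedDeriv k φ c * (Real.exp (-lam * t) * heatSol N a b (d k) 0 t x))
      (Ioi 0) := fun c d => integrable_finsetSum _ fun k _ => hint c d k
  refine ⟨fun n m => (integrable_exitIntegrand hN (hh n) hφm hM m x).1, fun n => ?_, ?_, ?_⟩
  · simp only [funext (feynmanKacTerm_eq (N := N) (a := a) (b := b) (lam := lam) (φ := φ) x n)]
    exact summable_exitExpectation hN (hh n) hφm hM (Real.exp_pos _)
      (Real.exp_lt_one_iff.2 (by nlinarith [hh n])) x
  · simp only [mul_add, hI]
    exact (hsum a leftData).add (hsum b rightData)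
  · have hval : ∫ t in Ioi (0 : ℝ), Real.exp (-lam * t) *
        ((∑ k : Fin N, (-1) ^ (k : ℕ) * heatSol N a b (leftData k) 0 t x * diracDeriv a k φ)
        + (∑ k : Fin N, (-1) ^ (k : ℕ) * heatSol N a b (rightData k) 0 t x * diracDeriv b k φ)) =
        dirichletSol N a b lam φ 0 x := by
      simp only [mul_add, hI]
      rw [integral_add (hsum a leftData) (hsum b rightData),
        integral_finsetSum _ fun k _ => hint a leftData k,
        integral_finsetSum _ fun k _ => hint b rightData k]
      simp only [integral_const_mul, (laplace_heatSol hab _ 0 hx hlam).2]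
      rfl
    simp only [hval]
    have hlim := tendsto_exitValue hN hab hlam hφ hM
      (contDiff_dirichletSol (N := N) (a := a) (b := b) (lam := lam) (φ := φ))
      (fun j hj => by rw [iteratedDeriv_dirichletSol, dirichletSol_left hab hlam.le hj])
      (fun j hj => by rw [iteratedDeriv_dirichletSol, dirichletSol_right hab hlam.le hj])
      (fun x _ => by rw [iteratedDeriv_dirichletSol, dirichletSol_two_mul]) hx
    have hseq : Tendsto (fun n : ℕ => (1 : ℝ) / 2 ^ n) atTop (𝓝[>] 0) := by
      refine tendsto_nhdsWithin_iff.2 ⟨?_, Eventually.of_forall hh⟩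
      simpa only [one_div, inv_pow] using
        tendsto_pow_atTop_nhds_zero_of_lt_one (r := (2 : ℝ)⁻¹) (by norm_num) (by norm_num)
    refine (hlim.comp hseq).congr fun n => ?_
    simp only [Function.comp_apply, exitValue, feynmanKacApprox, feynmanKacTerm_eq]

end JointDensity

end PseudoBM

end

theorem mainTheorem2 (N : ℕ) (hN : 1 < N) (a b : ℝ) (hab : a < b) :
    (∀ lam : ℝ, 0 < lam → PseudoBM.Delta N a b lam ≠ 0) ∧
    ∃ Iminus Iplus : Fin N → ℝ → ℝ → ℝ,
      (∀ x ∈ Ioo a b, PseudoBM.IsJointPseudoDensity N a b x fun t φ =>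
        (∑ k : Fin N, (-1) ^ (k : ℕ) * Iminus k t x * PseudoBM.diracDeriv a k φ)
          + (∑ k : Fin N, (-1) ^ (k : ℕ) * Iplus k t x * PseudoBM.diracDeriv b k φ)) ∧
      (∀ k : Fin N, ∀ x ∈ Ioo a b,
        PseudoBM.IsCharacterizedByLaplace (fun t => Iminus k t x) (fun lam =>
          ((lam ^ (-(k : ℝ) / (2 * N)) : ℝ) : ℂ) *
            (PseudoBM.DeltaMinus N a b k lam x / PseudoBM.Delta N a b lam)) ∧
        PseudoBM.IsCharacterizedByLaplace (fun t => Iplus k t x) (fun lam =>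
          ((lam ^ (-(k : ℝ) / (2 * N)) : ℝ) : ℂ) *
            (PseudoBM.DeltaPlus N a b k lam x / PseudoBM.Delta N a b lam))) ∧
      (∀ k : Fin N,
        PseudoBM.IsCharacterizedByBVP N a b (PseudoBM.kron k) (fun _ => 0) (Iminus k) ∧
        PseudoBM.IsCharacterizedByBVP N a b (fun _ => 0) (PseudoBM.kron k) (Iplus k)) := by
  have : NeZero N := ⟨by omega⟩
  refine ⟨fun lam hlam => PseudoBM.Delta_ne_zero hab hlam,
    fun k => PseudoBM.heatSol N a b (PseudoBM.leftData k) 0,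
    fun k => PseudoBM.heatSol N a b (PseudoBM.rightData k) 0,
    fun x hx => PseudoBM.isJointPseudoDensity_heatSol hab hx, fun k x hx => ⟨?_, ?_⟩,
    fun k => ⟨?_, ?_⟩⟩
  · exact PseudoBM.isCharacterizedByLaplace_heatSol hab (PseudoBM.conj_leftData k) hx
      fun lam hlam => PseudoBM.DeltaMinus_ratio hab hlam k x hx
  · exact PseudoBM.isCharacterizedByLaplace_heatSol hab (PseudoBM.conj_rightData k) hx
      fun lam hlam => PseudoBM.DeltaPlus_ratio hab hlam k x hx
  · refine PseudoBM.isCharacterizedByBVP_heatSol hab (fun l hl => ?_) fun l hl => ?_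
    · rw [PseudoBM.leftData_left k l hl, PseudoBM.kron]; split_ifs <;> simp
    · rw [PseudoBM.leftData_right k l hl]; simp
  · refine PseudoBM.isCharacterizedByBVP_heatSol hab (fun l hl => ?_) fun l hl => ?_
    · rw [PseudoBM.rightData_left k l hl]; simp
    · rw [PseudoBM.rightData_right k l hl, PseudoBM.kron]; split_ifs <;> simp
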